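/- **Theorem 3.** *Setting.* For a formal power series $f$ let $\bar f$ be the series with conjugated coefficients. Let $Z=(Z_1,\dots,Z_N)$, $\zeta=(\zeta_1,\dots,\zeta_N)$. A tuple $\rho=(\rho_1,\dots,\rho_d)$ in $\mathbb C[[Z,\zeta]]$ is called a *generic defining series* if $\rho(Z,\zeta)=\bar\rho(\zeta,Z)$, $\rho(0)=0$ and $\partial_Z\rho_1(0)\wedge\dots\wedge\partial_Z\rho_d(0)\neq0$. A set $M\subset\mathbb C^N$ is, near $p_0$, a *real-analytic generic submanifold* of codimension $d$ through $p_0$ if there is a convergent generic defining series $\rho$ such that, for $Z$ near $p_0$, $Z\in M$ if and only if $\rho(Z-p_0,\overline{Z-p_0})=0$. A formal vector field $X=\sum_j a_j\,\partial/\partial Z_j+\sum_j b_j\,\partial/\partial\zeta_j$, with $a_j,b_j\in\mathbb C[[Z,\zeta]]$, is tangent to $M$ if $X\rho=a\rho$ for some $d\times d$ matrix $a$ over $\mathbb C[[Z,\zeta]]$; it is of type $(1,0)$ if all $b_j=0$, and of type $(0,1)$ if all $a_j=0$. Let $\mathcal D_M$ be the $\mathbb C[[Z,\zeta]]$-module generated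 by the tangent vector fields of type $(1,0)$ and $(0,1)$, let $\mathfrak g_M$ be the complex Lie algebra generated by $\mathcal D_M$, and let $\mathcal D_M(0)\subset\mathfrak g_M(0)\subset\mathbb C^{2N}$ be the spaces of values at $0$. $M$ is of *finite type* at $p_0$ if $\dim_{\mathbb C}\mathfrak g_M(0)=2N-d$. $M$ is *finitely nondegenerate* at $p_0$ if for some $\ell\ge0$ the vectors $L^\alpha(\partial\rho_j/\partial Z)(0)$, $1\le j\le d$, $|\alpha|\le\ell$, span $\mathbb C^N$, where $L^\alpha=L_1^{\alpha_1}\cdots L_n^{\alpha_n}$ and $L_1,\dots,L_n$ is a basis of the tangent $(0,1)$ vector fields modulo those with coefficients in the ideal $(\rho_1,\dots,\rho_d)$. Let $M'\subset\mathbb C^{N'}$ be a real-analytic generic submanifold through $p_0'$, given by $\rho'$. A formal mapping $\hat H:(\mathbb C^N,p_0)\to(\mathbb C^{N'},p_0')$ is an $N'$-tuple of formal power series in $Z-p_0$ with constant term $p_0'$; put $H_0(Z)=\hat H(p_0+Z)-p_0'$ and $\mathcal H(Z,\zeta)=(H_0(Z),\bar H_0(\zeta))$. It maps $(M,p_0)$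 into $(M',p_0')$ if $\rho'(\mathcal H(Z,\zeta))=c(Z,\zeta)\rho(Z,\zeta)$ for some $d'\times d$ matrix $c$ of formal power series, where $d'$ is the codimension of $M'$; it is then *CR submersive* if $d\mathcal H(0)$ maps $\mathcal D_M(0)$ onto $\mathcal D_{M'}(0)$. $(M,p_0)$ and $(M',p_0')$ are *formally equivalent* if there is an invertible formal mapping of $(M,p_0)$ into $(M',p_0')$ whose inverse maps $(M',p_0')$ into $(M,p_0)$. They are *biholomorphically equivalent* if there is a biholomorphic mapping $H$ from a neighborhood of $p_0$ onto a neighborhood of $p_0'$, with $H(p_0)=p_0'$, such that $H(Z)\in M'$ for all $Z\in M$ near $p_0$ and $H^{-1}(W)\in M$ for all $W\in M'$ near $p_0'$. *Statement.* Let $M$ and $M'$ be real-analytic generic submanifolds through $p_0\in\mathbb C^N$ and $p_0'\in\mathbb C^{N'}$, respectively, such that $M$ is of finite type at $p_0$ and $M'$ is finitely nondegenerate at $p_0'$. Then any formal CR submersive mapping $\hat H:(M,p_0)\to(M',p_0')$ is convergent, i.e. $\hat H$ is the Taylor series at $p_0$ of a holomorphic mapping $H:(\mathbb C^N,p_0)\to(\mathbb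 C^{N'},p_0')$ defined near $p_0$ such that $H(Z)\in M'$ for all $Z\in M$ sufficiently near $p_0$. In particular, $(M,p_0)$ and $(M',p_0')$ are formally equivalent if and only if they are biholomorphically equivalent. -/

import Mathlib

open Filter Topology

noncomputable section

namespace FormalCR

/-- The ring `ℂ[[Z, ζ]]`, `Z = (Z_1, …, Z_N)` (left summand), `ζ = (ζ_1, …, ζ_N)`
(right summand). -/
abbrev Ser (N : ℕ) : Type := MvPowerSeries (Fin N ⊕ Fin N) ℂ

/-! ### Convergence of power series -/

/-- `f` converges (absolutely) on some polydisc about the origin. -/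
def Convergent {σ : Type} (f : MvPowerSeries σ ℂ) : Prop :=
  ∃ r : ℝ, 0 < r ∧ Summable fun n : σ →₀ ℕ => ‖MvPowerSeries.coeff n f‖ * r ^ n.degree

/-- The term of multi-degree `n` of the power series `f` at the point `x`. -/
def term {σ : Type} [Fintype σ] (f : MvPowerSeries σ ℂ) (x : σ → ℂ) (n : σ →₀ ℕ) : ℂ :=
  MvPowerSeries.coeff n f * ∏ i, x i ^ n i

/-- The sum of the power series `f` at `x` (used only where `f` converges). -/
def value {σ : Type} [Fintype σ] (f : MvPowerSeries σ ℂ) (x : σ → ℂ) : ℂ :=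
  ∑' n : σ →₀ ℕ, term f x n

/-- The point `(v, v̄)` of `ℂ^N × ℂ^N`. -/
def diag {N : ℕ} (v : Fin N → ℂ) : Fin N ⊕ Fin N → ℂ :=
  Sum.elim v fun i => (starRingEnd ℂ) (v i)

/-! ### Formal generic submanifolds -/

/-- `f̄`: the series obtained by conjugating every coefficient. -/
def conj {σ : Type} (f : MvPowerSeries σ ℂ) : MvPowerSeries σ ℂ :=
  MvPowerSeries.map (starRingEnd ℂ) f

/-- `ρ = (ρ_1, …, ρ_d)` defines a formal generic submanifold of `ℂ^N` through `0`
of codimension `d`. -/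
structure IsFormalGeneric {N d : ℕ} (ρ : Fin d → Ser N) : Prop where
  /-- `ρ(Z, ζ) = ρ̄(ζ, Z)` -/
  real : ∀ j, ρ j = MvPowerSeries.rename Sum.swap (conj (ρ j))
  /-- `ρ(0) = 0` -/
  zero : ∀ j, MvPowerSeries.constantCoeff (ρ j) = 0
  /-- `∂_Z ρ_1(0) ∧ … ∧ ∂_Z ρ_d(0) ≠ 0` -/
  generic : LinearIndependent ℂ fun (j : Fin d) (k : Fin N) =>
    MvPowerSeries.constantCoeff (MvPowerSeries.pderiv ℂ (Sum.inl k) (ρ j))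

/-- Near `p ∈ M`, the set `M ⊆ ℂ^N` is a real-analytic generic submanifold of codimension `d`,
given by the real-analytic equations `ρ(Z - p, conj (Z - p)) = 0`. -/
structure IsRealAnalyticGenericAt {N d : ℕ} (M : Set (Fin N → ℂ)) (p : Fin N → ℂ)
    (ρ : Fin d → Ser N) : Prop where
  formalGeneric : IsFormalGeneric ρ
  convergent : ∀ j, Convergent (ρ j)
  mem_iff : ∀ᶠ Z in 𝓝 p, (Z ∈ M ↔ ∀ j, value (ρ j) (diag (Z - p)) = 0)

/-! ### Formal vector fields -/

/-- A formal vector field `∑ a_j ∂/∂Z_j + ∑ b_j ∂/∂ζ_j`, given by its coefficients. -/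
abbrev VF (N : ℕ) : Type := Fin N ⊕ Fin N → Ser N

/-- `X f` for a formal vector field `X`. -/
def VF.app {N : ℕ} (X : VF N) (f : Ser N) : Ser N :=
  ∑ i, X i * MvPowerSeries.pderiv ℂ i f

/-- The commutator `[X, Y]`. -/
def VF.bracket {N : ℕ} (X Y : VF N) : VF N :=
  fun i => VF.app X (Y i) - VF.app Y (X i)

/-- Type `(1,0)`: no `∂/∂ζ_j` components. -/
def VF.IsType10 {N : ℕ} (X : VF N) : Prop := ∀ j, X (Sum.inr j) = 0

/-- Type `(0,1)`: no `∂/∂Z_j` components. -/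
def VF.IsType01 {N : ℕ} (X : VF N) : Prop := ∀ j, X (Sum.inl j) = 0

/-- `X` is tangent to the formal submanifold defined by `ρ`: `X ρ = a ρ`. -/
def VF.IsTangent {N d : ℕ} (ρ : Fin d → Ser N) (X : VF N) : Prop :=
  ∃ a : Matrix (Fin d) (Fin d) (Ser N), ∀ j, VF.app X (ρ j) = ∑ k, a j k * ρ k

/-- Evaluation of the coefficients of a formal vector field at `0`. -/
def evalZero (N : ℕ) : VF N →ₗ[ℂ] (Fin N ⊕ Fin N → ℂ) :=
  LinearMap.pi fun i => (MvPowerSeries.coeff (R := ℂ) 0).comp (LinearMap.proj i)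

/-- `𝒟_M`: the `ℂ[[Z, ζ]]`-module generated by the `(1,0)` and `(0,1)` vector fields
tangent to `M`. -/
def crModule {N d : ℕ} (ρ : Fin d → Ser N) : Submodule (Ser N) (VF N) :=
  Submodule.span (Ser N) {X | VF.IsTangent ρ X ∧ (VF.IsType10 X ∨ VF.IsType01 X)}

/-- `𝔤_M`: the complex Lie algebra generated by `𝒟_M`, i.e. the smallest complex subspace
containing `𝒟_M` and closed under commutators. -/
def crLie {N d : ℕ} (ρ : Fin d → Ser N) : Submodule ℂ (VF N) :=
  sInf {S | (crModule ρ : Set (VF N)) ⊆ S ∧ ∀ X ∈ S, ∀ Y ∈ S, VF.bracket X Y ∈ S}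

/-- `𝒟_M(0)` -/
def crModuleAt {N d : ℕ} (ρ : Fin d → Ser N) : Submodule ℂ (Fin N ⊕ Fin N → ℂ) :=
  ((crModule ρ).restrictScalars ℂ).map (evalZero N)

/-- `𝔤_M(0)` -/
def crLieAt {N d : ℕ} (ρ : Fin d → Ser N) : Submodule ℂ (Fin N ⊕ Fin N → ℂ) :=
  (crLie ρ).map (evalZero N)

/-- Finite type at `0`: `dim 𝔤_M(0) = dim M = 2N - d`. -/
def FiniteType {N d : ℕ} (ρ : Fin d → Ser N) : Prop :=
  Module.finrank ℂ (crLieAt ρ) + d = 2 * N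

/-! ### Finite nondegeneracy -/

/-- The ideal generated by `ρ_1, …, ρ_d`. -/
def defIdeal {N d : ℕ} (ρ : Fin d → Ser N) : Ideal (Ser N) := Ideal.span (Set.range ρ)

/-- `L_1, …, L_n` is a basis of the `(0,1)` vector fields tangent to `M`, modulo those whose
coefficients lie in the ideal generated by `ρ`: the classes generate, and are independent over
`ℂ[[Z, ζ]] / (ρ)`. -/
structure IsBasis01 {N d n : ℕ} (ρ : Fin d → Ser N) (L : Fin n → VF N) : Prop where
  type01 : ∀ i, VF.IsType01 (L i)
  tangent : ∀ i, VF.IsTangent ρ (L i)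
  generates : ∀ X : VF N, VF.IsType01 X → VF.IsTangent ρ X →
    ∃ c : Fin n → Ser N, ∀ s, X s - ∑ i, c i * L i s ∈ defIdeal ρ
  independent : ∀ c : Fin n → Ser N,
    (∀ s, ∑ i, c i * L i s ∈ defIdeal ρ) → ∀ i, c i ∈ defIdeal ρ

/-- `L^α f = L_1^{α_1} ⋯ L_n^{α_n} f`. -/
def multiApp {N n : ℕ} (L : Fin n → VF N) (α : Fin n → ℕ) (f : Ser N) : Ser N :=
  (List.finRange n).foldr (fun i g => (VF.app (L i))^[α i] g) f

/-- Finite nondegeneracy at `0`: for some `ℓ`, the vectors `L^α(∂ρ_j/∂Z)(0)`, `|α| ≤ ℓ`,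
`1 ≤ j ≤ d`, span `ℂ^N`. -/
def FinitelyNondegenerate {N d : ℕ} (ρ : Fin d → Ser N) : Prop :=
  ∃ (n : ℕ) (L : Fin n → VF N), IsBasis01 ρ L ∧ ∃ ℓ : ℕ,
    Submodule.span ℂ {v : Fin N → ℂ | ∃ (j : Fin d) (α : Fin n → ℕ), ∑ i, α i ≤ ℓ ∧
      v = fun k => MvPowerSeries.constantCoeff
        (multiApp L α (MvPowerSeries.pderiv ℂ (Sum.inl k) (ρ j)))} = ⊤

/-! ### Formal mappings -/

/-- The complexification `ℋ(Z, ζ) = (H(Z), H̄(ζ))` of a formal mapping. -/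
def complexify {N N' : ℕ} (H : Fin N' → MvPowerSeries (Fin N) ℂ) : Fin N' ⊕ Fin N' → Ser N :=
  Sum.elim (fun k => MvPowerSeries.rename Sum.inl (H k))
    (fun k => MvPowerSeries.rename Sum.inr (conj (H k)))

/-- The formal mapping `H : (ℂ^N, 0) → (ℂ^N', 0)` maps `M` into `M'`: there are no constant
terms and `ρ'(H(Z), H̄(ζ)) = c(Z, ζ) ρ(Z, ζ)`. -/
def MapsInto {N N' d d' : ℕ} (ρ : Fin d → Ser N) (ρ' : Fin d' → Ser N')
    (H : Fin N' → MvPowerSeries (Fin N) ℂ) : Prop :=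
  (∀ k, MvPowerSeries.constantCoeff (H k) = 0) ∧
  ∃ c : Matrix (Fin d') (Fin d) (Ser N), ∀ j,
    MvPowerSeries.subst (complexify H) (ρ' j) = ∑ k, c j k * ρ k

/-- The tangent map `dℋ` at `0` of the complexification of `H`. -/
def tangentMap {N N' : ℕ} (H : Fin N' → MvPowerSeries (Fin N) ℂ) :
    (Fin N ⊕ Fin N → ℂ) →ₗ[ℂ] (Fin N' ⊕ Fin N' → ℂ) :=
  Matrix.mulVecLin (Matrix.of fun k i =>
    MvPowerSeries.constantCoeff (MvPowerSeries.pderiv ℂ i (complexify H k)))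

/-- CR submersivity at `0`: `dℋ(𝒟_M(0)) = 𝒟_{M'}(0)`. -/
def CRSubmersive {N N' d d' : ℕ} (ρ : Fin d → Ser N) (ρ' : Fin d' → Ser N')
    (H : Fin N' → MvPowerSeries (Fin N) ℂ) : Prop :=
  (crModuleAt ρ).map (tangentMap H) = crModuleAt ρ'

/-- A formal mapping `(ℂ^N, p) → (ℂ^N', p')` is a tuple of power series in `Z - p` with constant
term `p'`; `recentre p' H` is the corresponding formal mapping `(ℂ^N, 0) → (ℂ^N', 0)`. -/
def recentre {N N' : ℕ} (p' : Fin N' → ℂ) (H : Fin N' → MvPowerSeries (Fin N) ℂ) :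
    Fin N' → MvPowerSeries (Fin N) ℂ :=
  fun k => H k - MvPowerSeries.C (p' k)

/-- `H : (ℂ^N, p) → (ℂ^N', p')` is a formal CR submersive mapping between the formal
submanifolds given (after translation of `p`, `p'` to the origin) by `ρ` and `ρ'`. -/
structure IsFormalCRSubmersiveMap {N N' d d' : ℕ} (ρ : Fin d → Ser N) (p' : Fin N' → ℂ)
    (ρ' : Fin d' → Ser N') (H : Fin N' → MvPowerSeries (Fin N) ℂ) : Prop where
  constantTerm : ∀ k, MvPowerSeries.constantCoeff (H k) = p' k
  mapsInto : MapsInto ρ ρ' (recentre p' H)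
  submersive : CRSubmersive ρ ρ' (recentre p' H)

/-- `Hhat` is the Taylor series at `p` of the holomorphic mapping `H`. -/
def IsTaylorSeriesAt {N N' : ℕ} (p : Fin N → ℂ) (Hhat : Fin N' → MvPowerSeries (Fin N) ℂ)
    (H : (Fin N → ℂ) → (Fin N' → ℂ)) : Prop :=
  ∀ᶠ Z in 𝓝 p, ∀ k, HasSum (term (Hhat k) (Z - p)) (H Z k)

/-! ### Equivalences -/

/-- Formal equivalence of the formal submanifolds given by `ρ` and `ρ'`: an invertible formal
mapping which, together with its inverse, maps one into the other. -/
def FormallyEquivalent {N N' d d' : ℕ} (ρ : Fin d → Ser N) (ρ' : Fin d' → Ser N') : Prop :=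
  ∃ (H : Fin N' → MvPowerSeries (Fin N) ℂ) (K : Fin N → MvPowerSeries (Fin N') ℂ),
    MapsInto ρ ρ' H ∧ MapsInto ρ' ρ K ∧
    (∀ k, MvPowerSeries.subst H (K k) = MvPowerSeries.X k) ∧
    (∀ k, MvPowerSeries.subst K (H k) = MvPowerSeries.X k)

/-- Biholomorphic equivalence of the germs `(M, p)` and `(M', p')`. -/
def BiholomorphicallyEquivalent {N N' : ℕ} (M : Set (Fin N → ℂ)) (p : Fin N → ℂ)
    (M' : Set (Fin N' → ℂ)) (p' : Fin N' → ℂ) : Prop :=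
  ∃ (H : (Fin N → ℂ) → (Fin N' → ℂ)) (K : (Fin N' → ℂ) → (Fin N → ℂ)),
    AnalyticAt ℂ H p ∧ AnalyticAt ℂ K p' ∧ H p = p' ∧ K p' = p ∧
    (∀ᶠ Z in 𝓝 p, K (H Z) = Z) ∧ (∀ᶠ W in 𝓝 p', H (K W) = W) ∧
    (∀ᶠ Z in 𝓝 p, Z ∈ M → H Z ∈ M') ∧ (∀ᶠ W in 𝓝 p', W ∈ M' → K W ∈ M)

end FormalCR

end

noncomputable section

namespace FormalCR

open MvPowerSeries
open scoped ENNReal NNReal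

variable {σ τ υ ι κ κ' ε δ : Type}

/-! ### Substitution of series without constant term -/

/-! The work takes place on the complexified manifold ρ(Z, ζ) = 0, near the origin after
translation. Solving ρ(Z, ζ) = r for ζ gives a convergent Θ(Z, r, t), where t stands for the
coordinates of ζ left free (`IsStraight`). Translating t in the fibre over a fixed Z moves points
along the tangent (0,1) directions (`flow01`); exchanging the blocks and conjugating gives the moves
in the (1,0) directions. All these moves preserve ρ and start from the origin, so a finite chain of
them with convergent parameters yields a convergent family V(x) in the complexified manifold
(`Reach`).

Reflection. Suppose that all jets of H̄ along V_ζ converge, in the sense that H̄(V_ζ(x) + s) agrees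
with a convergent series to any order in s (`JetConv`). Let ζ = ψ(x, s, u) run over the fibre above
Z = V_Z(x) + s. The identity ρ'(H(Z), H̄(ζ)) = 0, expanded in powers of u, becomes infinitely many
equations for the unknown h = H(V_Z(x) + s). Their linear parts at the origin are the vectors
`segreJet`. If these span, finitely many combinations form a system with identity linear part, and
the implicit function theorem modulo powers of s shows that the jets of h converge
(`jetConv_reflection`). The spanning property is where CR submersivity and finite nondegeneracy
enter: H̄ maps the Segre variety of 0 in M submersively to that in M', so a functional killing all
jets would kill every L^α(∂ρ'/∂Z)(0) (`span_segreJet_eq_top`). At the origin the jets of a formal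
series are polynomials. Each elementary move changes only one of Z, ζ, so reflection carries
convergence along the chain (`IsStraight.reach_jetConv`); in particular H∘V_Z converges for every
reached V.

Finite type. Among all reached families take V of maximal generic rank. A further flow step cannot
raise the rank, so the flow directions are, up to a nonzero factor, combinations of the partial
derivatives of V (`isAlong_flow`). This property passes to brackets (`IsAlong.bracket`), so all of
𝔤_M is tangential along V. Finite type makes 𝔤_M(0) equal to the kernel of dρ(0), which projects
onto the Z space. Running the chain backwards from V(x + y) with the parameters of V(x) produces a
reached W(x, y) with W(x, 0) = 0 whose Z part is generically submersive in y
(`exists_reach_submersion`).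

Descent. If F∘w converges for a convergent w(x, y) with w(x, 0) = 0 and det ∂_y w(x, 0) ≠ 0, then F
converges: a convergent change of y turns w into η(x) v with η ≠ 0, and x may be frozen at a point
where η does not vanish (`convergent_of_subst`). Applied to the Z part of W, this gives the
convergence of H.

For the equivalence, an invertible formal map carrying each manifold into the other is CR submersive
(`MapsInto.crSubmersive`), so it converges, and so does its inverse (`convergent_inverse`).
Conversely, Taylor series of a biholomorphism satisfy the formal identities because a convergent
series vanishing at the points of M lies in the ideal of ρ; this uses a parametrization of M with
real coefficients (`Convergent.mem_defIdeal`). -/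

/-- A tuple of power series without constant terms. -/
def NoConst (g : σ → MvPowerSeries τ ℂ) : Prop := ∀ i, constantCoeff (g i) = 0

theorem NoConst.hasSubst [Finite σ] {g : σ → MvPowerSeries τ ℂ} (hg : NoConst g) : HasSubst g :=
  hasSubst_of_constantCoeff_zero hg

theorem noConst_X : NoConst (X : σ → MvPowerSeries σ ℂ) := fun i => constantCoeff_X i

theorem noConst_zero : NoConst (0 : σ → MvPowerSeries τ ℂ) := fun _ => map_zero _

theorem NoConst.sumElim {g : σ → MvPowerSeries υ ℂ} {h : τ → MvPowerSeries υ ℂ}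
    (hg : NoConst g) (hh : NoConst h) : NoConst (Sum.elim g h) := by
  rintro (i | i)
  · exact hg i
  · exact hh i

theorem NoConst.add {g h : σ → MvPowerSeries τ ℂ} (hg : NoConst g) (hh : NoConst h) :
    NoConst (fun i => g i + h i) := fun i => by rw [map_add, hg i, hh i, add_zero]

theorem NoConst.sub {g h : σ → MvPowerSeries τ ℂ} (hg : NoConst g) (hh : NoConst h) :
    NoConst (fun i => g i - h i) := fun i => by rw [map_sub, hg i, hh i, sub_zero]

theorem NoConst.comp {g : σ → MvPowerSeries τ ℂ} (hg : NoConst g) (e : υ → σ) :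
    NoConst (fun i => g (e i)) := fun i => hg (e i)

theorem constantCoeff_subst' [Finite σ] {g : σ → MvPowerSeries τ ℂ} (hg : NoConst g)
    (f : MvPowerSeries σ ℂ) : constantCoeff (subst g f) = constantCoeff f := by
  have h : constantCoeff (subst g (f - C (constantCoeff f))) = 0 :=
    constantCoeff_subst_eq_zero hg.hasSubst hg (by simp)
  rw [subst_sub hg.hasSubst, subst_C] at h
  simpa [sub_eq_zero] using h

theorem NoConst.subst [Finite σ] [Finite τ] {g : σ → MvPowerSeries τ ℂ} (hg : NoConst g)
    {h : τ → MvPowerSeries υ ℂ} (hh : NoConst h) : NoConst (fun i => subst h (g i)) :=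
  fun i => by rw [constantCoeff_subst' hh, hg i]

theorem subst_subst [Finite σ] [Finite τ] {g : σ → MvPowerSeries τ ℂ} (hg : NoConst g)
    {h : τ → MvPowerSeries υ ℂ} (hh : NoConst h) (f : MvPowerSeries σ ℂ) :
    subst h (subst g f) = subst (fun i => subst h (g i)) f :=
  subst_comp_subst_apply hg.hasSubst hh.hasSubst f

theorem subst_X' [Finite σ] {g : σ → MvPowerSeries τ ℂ} (hg : NoConst g) (i : σ) :
    subst g (X i : MvPowerSeries σ ℂ) = g i := subst_X hg.hasSubst i

theorem subst_sum' [Finite σ] {g : σ → MvPowerSeries τ ℂ} (hg : NoConst g) {κ : Type*}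
    (s : Finset κ) (f : κ → MvPowerSeries σ ℂ) :
    subst g (∑ k ∈ s, f k) = ∑ k ∈ s, subst g (f k) := by
  rw [← substAlgHom_apply hg.hasSubst, map_sum]
  simp only [substAlgHom_apply]

theorem subst_zero' [Finite σ] {g : σ → MvPowerSeries τ ℂ} (hg : NoConst g) :
    subst g (0 : MvPowerSeries σ ℂ) = 0 := by
  rw [← substAlgHom_apply hg.hasSubst, map_zero]

theorem subst_one' [Finite σ] {g : σ → MvPowerSeries τ ℂ} (hg : NoConst g) :
    subst g (1 : MvPowerSeries σ ℂ) = 1 := by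
  rw [← substAlgHom_apply hg.hasSubst, map_one]

theorem subst_neg' [Finite σ] {g : σ → MvPowerSeries τ ℂ} (hg : NoConst g)
    (f : MvPowerSeries σ ℂ) : subst g (-f) = -subst g f := by
  rw [← substAlgHom_apply hg.hasSubst, map_neg, substAlgHom_apply]

theorem subst_X_self (f : MvPowerSeries σ ℂ) : subst X f = f := congrFun subst_self f

/-! ### Series of high weighted order -/

/-- The ideal of series all of whose terms have weight at least `k`. -/
def ordIdeal (w : σ → ℕ) (k : ℕ) : Ideal (MvPowerSeries σ ℂ) where
  carrier := {f | (k : ℕ∞) ≤ f.weightedOrder w}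
  add_mem' ha hb := (le_min ha hb).trans (min_weightedOrder_le_add w)
  zero_mem' := by simp
  smul_mem' c f hf := (le_add_left hf).trans (le_weightedOrder_mul w)

theorem mem_ordIdeal {w : σ → ℕ} {k : ℕ} {f : MvPowerSeries σ ℂ} :
    f ∈ ordIdeal w k ↔ (k : ℕ∞) ≤ f.weightedOrder w := Iff.rfl

theorem mem_ordIdeal_iff {w : σ → ℕ} {k : ℕ} {f : MvPowerSeries σ ℂ} :
    f ∈ ordIdeal w k ↔ ∀ n, Finsupp.weight w n < k → coeff n f = 0 := by
  constructor
  · intro h n hn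
    exact coeff_eq_zero_of_lt_weightedOrder w (lt_of_lt_of_le (by exact_mod_cast hn) h)
  · intro h
    exact nat_le_weightedOrder w h

theorem mul_mem_ordIdeal {w : σ → ℕ} {k l : ℕ} {f g : MvPowerSeries σ ℂ}
    (hf : f ∈ ordIdeal w k) (hg : g ∈ ordIdeal w l) : f * g ∈ ordIdeal w (k + l) := by
  rw [mem_ordIdeal] at *
  push_cast
  exact (add_le_add hf hg).trans (le_weightedOrder_mul w)

theorem mem_ordIdeal_zero {w : σ → ℕ} (f : MvPowerSeries σ ℂ) : f ∈ ordIdeal w 0 := by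
  simp [mem_ordIdeal]

theorem ordIdeal_mono {w : σ → ℕ} {k l : ℕ} (h : k ≤ l) : ordIdeal w l ≤ ordIdeal w k :=
  fun _ hf => mem_ordIdeal.2 (le_trans (Nat.cast_le.2 h) (mem_ordIdeal.1 hf))

theorem mem_ordIdeal_one_iff {f : MvPowerSeries σ ℂ} :
    f ∈ ordIdeal (fun _ => 1) 1 ↔ constantCoeff f = 0 := by
  rw [mem_ordIdeal, ← one_le_order_iff_constCoeff_eq_zero]
  rfl

theorem coeff_eq_zero_of_mem_ordIdeal {k : ℕ} {f : MvPowerSeries σ ℂ}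
    (hf : f ∈ ordIdeal (fun _ => 1) k) {n : σ →₀ ℕ} (hn : n.degree < k) : coeff n f = 0 :=
  coeff_of_lt_order (lt_of_lt_of_le (by exact_mod_cast hn) hf)

theorem eq_zero_of_forall_mem_ordIdeal {f : MvPowerSeries σ ℂ}
    (hf : ∀ k, f ∈ ordIdeal (fun _ => 1) k) : f = 0 := by
  ext n
  simpa using coeff_eq_zero_of_mem_ordIdeal (hf (n.degree + 1)) (Nat.lt_succ_self _)

/-- Each variable of weight `w i` is replaced by a series of at least that order, so no monomial
loses weight. -/
theorem subst_mem_ordIdeal [Finite σ] {w : σ → ℕ} {w' : τ → ℕ} {g : σ → MvPowerSeries τ ℂ}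
    (hg : NoConst g) (hw : ∀ i, g i ∈ ordIdeal w' (w i)) {k : ℕ} {f : MvPowerSeries σ ℂ}
    (hf : f ∈ ordIdeal w k) : subst g f ∈ ordIdeal w' k := by
  rw [mem_ordIdeal]
  refine le_trans ?_ (le_weightedOrder_subst w' hg.hasSubst f)
  refine le_iInf₂ fun d hd => ?_
  have h1 : k ≤ Finsupp.weight w d := by
    by_contra hlt
    exact hd (mem_ordIdeal_iff.1 hf d (not_le.1 hlt))
  refine le_trans (Nat.cast_le.2 h1) ?_
  simp only [Finsupp.weight_apply, Finsupp.sum, Function.comp_apply]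
  push_cast
  refine Finset.sum_le_sum fun i _ => ?_
  rw [smul_eq_mul, nsmul_eq_mul]
  push_cast
  exact mul_le_mul_right (hw i) _

theorem subst_mem_ordIdeal_one [Finite σ] {g : σ → MvPowerSeries τ ℂ} (hg : NoConst g) {k : ℕ}
    {f : MvPowerSeries σ ℂ} (hf : f ∈ ordIdeal (fun _ => 1) k) :
    subst g f ∈ ordIdeal (fun _ => 1) k :=
  subst_mem_ordIdeal hg (fun i => mem_ordIdeal_one_iff.2 (hg i)) hf

theorem pderiv_mem_ordIdeal {k : ℕ} {f : MvPowerSeries σ ℂ} (i : σ)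
    (hf : f ∈ ordIdeal (fun _ => 1) (k + 1)) : pderiv ℂ i f ∈ ordIdeal (fun _ => 1) k := by
  rw [mem_ordIdeal_iff]
  intro n hn
  rw [coeff_pderiv, coeff_eq_zero_of_mem_ordIdeal hf, zero_mul]
  have : n.degree < k := by
    simpa [Finsupp.degree_eq_weight_one] using! hn
  rw [map_add, Finsupp.degree_single]
  omega

theorem sub_truncTotal_mem_ordIdeal [Finite σ] (k : ℕ) (f : MvPowerSeries σ ℂ) :
    f - (truncTotal k f : MvPolynomial σ ℂ) ∈ ordIdeal (fun _ => 1) k := by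
  rw [mem_ordIdeal_iff]
  intro n hn
  have : n.degree < k := by
    simpa [Finsupp.degree_eq_weight_one] using! hn
  rw [map_sub, MvPolynomial.coeff_coe, coeff_truncTotal _ this, sub_self]

/-! ### The chain rule -/

theorem pderiv_subst_coe [Fintype σ] {g : σ → MvPowerSeries τ ℂ} (hg : NoConst g) (i : τ)
    (p : MvPolynomial σ ℂ) :
    pderiv ℂ i (subst g (p : MvPowerSeries σ ℂ)) =
      ∑ j, subst g (pderiv ℂ j (p : MvPowerSeries σ ℂ)) * pderiv ℂ i (g j) := by
  induction p using MvPolynomial.induction_on with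
  | C a =>
    rw [MvPolynomial.coe_C, subst_C, pderiv_C]
    simp [subst_zero' hg]
  | add p q hp hq =>
    rw [MvPolynomial.coe_add, subst_add hg.hasSubst, map_add, hp, hq, ← Finset.sum_add_distrib]
    refine Finset.sum_congr rfl fun j _ => ?_
    rw [map_add, subst_add hg.hasSubst, add_mul]
  | mul_X p k hp =>
    classical
    rw [MvPolynomial.coe_mul, MvPolynomial.coe_X, subst_mul hg.hasSubst, Derivation.leibniz, hp,
      subst_X' hg]
    simp only [Derivation.leibniz, smul_eq_mul, subst_add hg.hasSubst, subst_mul hg.hasSubst,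
      subst_X' hg, add_mul, Finset.sum_add_distrib, Finset.mul_sum]
    congr 1
    · rw [Finset.sum_eq_single k]
      · rw [pderiv_X_self, subst_one' hg, mul_one]
      · intro j _ hj
        rw [pderiv_X_of_ne hj.symm, subst_zero' hg, mul_zero, zero_mul]
      · simp
    · exact Finset.sum_congr rfl fun j _ => by ring

/-- The rule holds for polynomials, and both sides lower the order by at most one. Truncating `f` at
order `k + 1` therefore gives equality modulo order `k`, for every `k`. -/
theorem pderiv_subst [Fintype σ] {g : σ → MvPowerSeries τ ℂ} (hg : NoConst g) (i : τ)
    (f : MvPowerSeries σ ℂ) :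
    pderiv ℂ i (subst g f) = ∑ j, subst g (pderiv ℂ j f) * pderiv ℂ i (g j) := by
  rw [← sub_eq_zero]
  refine eq_zero_of_forall_mem_ordIdeal fun k => ?_
  have hq := sub_truncTotal_mem_ordIdeal (k + 1) f
  set p : MvPolynomial σ ℂ := truncTotal (k + 1) f with hp
  have key : pderiv ℂ i (subst g f) - ∑ j, subst g (pderiv ℂ j f) * pderiv ℂ i (g j) =
      pderiv ℂ i (subst g (f - (p : MvPowerSeries σ ℂ))) -
        ∑ j, subst g (pderiv ℂ j (f - (p : MvPowerSeries σ ℂ))) * pderiv ℂ i (g j) := by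
    simp only [map_sub, subst_sub hg.hasSubst, sub_mul, Finset.sum_sub_distrib,
      pderiv_subst_coe hg]
    ring
  rw [key]
  refine Ideal.sub_mem _ (pderiv_mem_ordIdeal i (subst_mem_ordIdeal_one hg hq)) ?_
  refine Ideal.sum_mem _ fun j _ => Ideal.mul_mem_right _ _ ?_
  exact subst_mem_ordIdeal_one hg (pderiv_mem_ordIdeal j hq)

/-! ### Hadamard's lemma -/

theorem coeff_X_mul_ite [DecidableEq σ] (i : σ) (f : MvPowerSeries σ ℂ) (n : σ →₀ ℕ) :
    coeff n (X i * f) = if n i = 0 then 0 else coeff (n - Finsupp.single i 1) f := by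
  rw [X_def, coeff_monomial_mul, one_mul]
  simp only [Finsupp.single_le_iff, Nat.one_le_iff_ne_zero]
  split_ifs <;> simp_all

/-- Every exponent that occurs in `f` contains a variable of positive weight. `pick` selects one of
them, and the whole term is charged to the quotient of that variable. -/
theorem exists_eq_sum_X_mul [Fintype σ] {w : σ → ℕ} {f : MvPowerSeries σ ℂ}
    (hf : f ∈ ordIdeal w 1) :
    ∃ M : σ → MvPowerSeries σ ℂ, f = ∑ i, X i * M i ∧ ∀ i, w i = 0 → M i = 0 := by
  classical
  have hpick : ∀ n : σ →₀ ℕ, ∃ i : Option σ, coeff n f ≠ 0 → ∃ j, i = some j ∧ w j ≠ 0 ∧ n j ≠ 0 := by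
    intro n
    by_cases hn : coeff n f = 0
    · exact ⟨none, fun h => (h hn).elim⟩
    · have h1 : ¬ Finsupp.weight w n < 1 := fun h => hn (mem_ordIdeal_iff.1 hf n h)
      have : ∃ j, w j ≠ 0 ∧ n j ≠ 0 := by
        by_contra! hcon
        apply h1
        rw [Finsupp.weight_eq_sum, Finset.sum_eq_zero]
        · exact Nat.zero_lt_one
        · intro j _
          by_cases hj : w j = 0
          · simp [hj]
          · simp [hcon j hj]
      obtain ⟨j, hj⟩ := this
      exact ⟨some j, fun _ => ⟨j, rfl, hj⟩⟩
  choose pick hpick using hpick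
  let M : σ → MvPowerSeries σ ℂ := fun i n =>
    if pick (n + Finsupp.single i 1) = some i ∧ w i ≠ 0 then coeff (n + Finsupp.single i 1) f else 0
  have hM : ∀ i n, coeff n (M i) = if pick (n + Finsupp.single i 1) = some i ∧ w i ≠ 0 then
      coeff (n + Finsupp.single i 1) f else 0 := fun _ _ => rfl
  refine ⟨M, ?_, ?_⟩
  · ext n
    rw [map_sum]
    simp only [coeff_X_mul_ite, hM]
    by_cases hn : coeff n f = 0
    · rw [hn, Finset.sum_eq_zero]
      intro i _
      split_ifs with h1 h2
      · rfl
      · rwa [tsub_add_cancel_of_le (by simpa [Nat.one_le_iff_ne_zero] using h1)]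
      · rfl
    · obtain ⟨j, hj, hw, hnj⟩ := hpick n hn
      rw [Finset.sum_eq_single j]
      · have : n - Finsupp.single j 1 + Finsupp.single j 1 = n :=
          tsub_add_cancel_of_le (by simpa [Nat.one_le_iff_ne_zero] using hnj)
        rw [if_neg hnj, this, if_pos ⟨hj, hw⟩]
      · intro i _ hij
        split_ifs with h1 h2
        · rfl
        · rw [tsub_add_cancel_of_le (by simpa [Nat.one_le_iff_ne_zero] using h1), hj] at h2
          exact (hij (Option.some.inj h2.1).symm).elim
        · rfl
      · simp
  · intro i hi
    ext n
    simp [hM, hi]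

/-- Setting the variables of positive weight to zero keeps exactly the monomials of weight zero.
Hence a series that vanishes under this substitution has positive weighted order, which is how order
conditions are verified below. -/
theorem coeff_subst_kill [Finite σ] (w : σ → ℕ) [DecidablePred fun i => w i = 0]
    (f : MvPowerSeries σ ℂ) {n : σ →₀ ℕ} (hn : Finsupp.weight w n = 0) :
    coeff n (subst (fun i => if w i = 0 then (X i : MvPowerSeries σ ℂ) else 0) f) = coeff n f := by
  have := Fintype.ofFinite σ
  have hk : NoConst (fun i => if w i = 0 then (X i : MvPowerSeries σ ℂ) else 0) := by
    intro i
    dsimp only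
    split_ifs <;> simp
  have hw0 : ∀ m : σ →₀ ℕ, Finsupp.weight w m = 0 ↔ ∀ i, w i = 0 ∨ m i = 0 := by
    intro m
    rw [Finsupp.weight_eq_sum, Finset.sum_eq_zero_iff]
    simp [or_comm]
  have hprod : ∀ m : σ →₀ ℕ, (m.prod fun i k => (if w i = 0 then (X i : MvPowerSeries σ ℂ) else 0) ^ k) =
      if Finsupp.weight w m = 0 then monomial m 1 else 0 := by
    intro m
    split_ifs with hm
    · rw [monomial_one_eq]
      refine Finsupp.prod_congr fun i hi => ?_
      rw [if_pos (((hw0 m).1 hm i).resolve_right (Finsupp.mem_support_iff.1 hi))]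
    · rw [hw0] at hm
      push Not at hm
      obtain ⟨i, hi1, hi2⟩ := hm
      exact Finset.prod_eq_zero (Finsupp.mem_support_iff.2 hi2) (by simp [hi1, hi2])
  rw [coeff_subst hk.hasSubst, finsum_eq_single _ n]
  · rw [hprod, if_pos hn, coeff_monomial_same, smul_eq_mul, mul_one]
  · intro m hm
    rw [hprod]
    split_ifs
    · rw [coeff_monomial_ne hm.symm, smul_zero]
    · simp

theorem mem_ordIdeal_one_of_subst_eq_zero [Finite σ] {w : σ → ℕ} {g : σ → MvPowerSeries σ ℂ}
    (h0 : ∀ i, w i = 0 → g i = X i) (h1 : ∀ i, w i ≠ 0 → g i = 0) {f : MvPowerSeries σ ℂ}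
    (hf : subst g f = 0) : f ∈ ordIdeal w 1 := by
  classical
  have : g = fun i => if w i = 0 then (X i : MvPowerSeries σ ℂ) else 0 := by
    funext i
    split_ifs with h
    · exact h0 i h
    · exact h1 i h
  subst this
  rw [mem_ordIdeal_iff]
  intro n hn
  rw [← coeff_subst_kill w f (Nat.lt_one_iff.1 hn), hf, coeff_zero]

/-- The difference f(x + y) − f(x) vanishes at y = 0, so it lies in the ideal of the increments y;
one derivative in y at the origin identifies the constant terms of the quotients. All other
instances follow by substitution. -/
theorem hadamard_universal [Fintype σ] (f : MvPowerSeries σ ℂ) :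
    ∃ M : σ → MvPowerSeries (σ ⊕ σ) ℂ,
      subst (fun i => X (Sum.inl i) + X (Sum.inr i)) f - subst (fun i => X (Sum.inl i)) f =
        ∑ i, X (Sum.inr i) * M i ∧ ∀ i, constantCoeff (M i) = constantCoeff (pderiv ℂ i f) := by
  classical
  have hs : NoConst (fun i : σ => (X (Sum.inl i) + X (Sum.inr i) : MvPowerSeries (σ ⊕ σ) ℂ)) :=
    fun i => by simp
  have hl : NoConst (fun i : σ => (X (Sum.inl i) : MvPowerSeries (σ ⊕ σ) ℂ)) := fun i => by simp
  have hk : NoConst (Sum.elim (fun i => X (Sum.inl i)) 0 : σ ⊕ σ → MvPowerSeries (σ ⊕ σ) ℂ) :=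
    hl.sumElim noConst_zero
  set F := subst (fun i => X (Sum.inl i) + X (Sum.inr i)) f -
    subst (fun i => (X (Sum.inl i) : MvPowerSeries (σ ⊕ σ) ℂ)) f with hF
  have hmem : F ∈ ordIdeal (Sum.elim (fun _ => 0) (fun _ => 1) : σ ⊕ σ → ℕ) 1 := by
    refine mem_ordIdeal_one_of_subst_eq_zero
      (g := Sum.elim (fun i => X (Sum.inl i)) 0) ?_ ?_ ?_
    · rintro (i | i) hi <;> simp_all
    · rintro (i | i) hi <;> simp_all
    · rw [hF, subst_sub hk.hasSubst, subst_subst hs hk, subst_subst hl hk]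
      simp [subst_add hk.hasSubst, subst_X' hk]
  obtain ⟨M, hM, hM0⟩ := exists_eq_sum_X_mul hmem
  refine ⟨fun i => M (Sum.inr i), ?_, fun i => ?_⟩
  · rw [hM, Fintype.sum_sum_type, Finset.sum_eq_zero, zero_add]
    intro i _
    rw [hM0 _ (by simp), mul_zero]
  · have h1 : constantCoeff (pderiv ℂ (Sum.inr i) F) = constantCoeff (M (Sum.inr i)) := by
      rw [hM, map_sum, map_sum, Finset.sum_eq_single (Sum.inr i)]
      · simp [Derivation.leibniz, pderiv_X_self]
      · intro j _ hj
        simp [Derivation.leibniz, pderiv_X_of_ne hj]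
      · simp
    rw [← h1, hF, map_sub, pderiv_subst hs, pderiv_subst hl]
    simp only [map_sub, map_sum, map_mul, constantCoeff_subst' hs, constantCoeff_subst' hl, map_add]
    rw [Finset.sum_eq_single i]
    · simp [pderiv_X_self]
    · intro j _ hj
      simp [hj]
    · simp

/-- Hadamard's lemma for substitutions. -/
theorem exists_subst_sub_subst [Fintype σ] (f : MvPowerSeries σ ℂ) {g g' : σ → MvPowerSeries τ ℂ}
    (hg : NoConst g) (hg' : NoConst g') :
    ∃ M : σ → MvPowerSeries τ ℂ, subst g f - subst g' f = ∑ i, M i * (g i - g' i) ∧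
      ∀ i, constantCoeff (M i) = constantCoeff (pderiv ℂ i f) := by
  obtain ⟨M, hM, hM0⟩ := hadamard_universal f
  have hs : NoConst (fun i : σ => (X (Sum.inl i) + X (Sum.inr i) : MvPowerSeries (σ ⊕ σ) ℂ)) :=
    fun i => by simp
  have hl : NoConst (fun i : σ => (X (Sum.inl i) : MvPowerSeries (σ ⊕ σ) ℂ)) := fun i => by simp
  have he : NoConst (Sum.elim g' (fun i => g i - g' i)) := hg'.sumElim (hg.sub hg')
  -- The universal identity is evaluated at base point `g'` with increment `g - g'`.
  refine ⟨fun i => subst (Sum.elim g' (fun i => g i - g' i)) (M i), ?_, fun i => ?_⟩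
  · have := congrArg (subst (Sum.elim g' (fun i => g i - g' i))) hM
    rw [subst_sub he.hasSubst, subst_subst hs he, subst_subst hl he, subst_sum' he] at this
    simp only [subst_add he.hasSubst, subst_X' he, subst_mul he.hasSubst, Sum.elim_inl,
      Sum.elim_inr, add_sub_cancel] at this
    rw [this]
    exact Finset.sum_congr rfl fun i _ => mul_comm _ _
  · rw [constantCoeff_subst' he, hM0]

theorem subst_sub_subst_mem [Finite σ] (I : Ideal (MvPowerSeries τ ℂ)) (f : MvPowerSeries σ ℂ)
    {g g' : σ → MvPowerSeries τ ℂ} (hg : NoConst g) (hg' : NoConst g')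
    (h : ∀ i, g i - g' i ∈ I) : subst g f - subst g' f ∈ I := by
  have := Fintype.ofFinite σ
  obtain ⟨M, hM, -⟩ := exists_subst_sub_subst f hg hg'
  rw [hM]
  exact Ideal.sum_mem _ fun i _ => Ideal.mul_mem_left _ _ (h i)

/-! ### Weighted norms -/

/-- The value of the monomial `n` at `r`. -/
def mon (r : σ → ℝ≥0∞) (n : σ →₀ ℕ) : ℝ≥0∞ := n.prod fun i k => r i ^ k

/-- The sum of the absolute values of the terms of `f` on the polydisc of radii `r`. -/
def wnorm (r : σ → ℝ≥0∞) (f : MvPowerSeries σ ℂ) : ℝ≥0∞ := ∑' n, ‖coeff n f‖ₑ * mon r n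

theorem mon_add (r : σ → ℝ≥0∞) (m n : σ →₀ ℕ) : mon r (m + n) = mon r m * mon r n :=
  Finsupp.prod_add_index' (fun _ => pow_zero _) (fun _ _ _ => pow_add _ _ _)

theorem mon_zero (r : σ → ℝ≥0∞) : mon r 0 = 1 := Finsupp.prod_zero_index

theorem mon_single (r : σ → ℝ≥0∞) (i : σ) (k : ℕ) : mon r (Finsupp.single i k) = r i ^ k :=
  Finsupp.prod_single_index (pow_zero _)

theorem mon_mono {r s : σ → ℝ≥0∞} (h : r ≤ s) (n : σ →₀ ℕ) : mon r n ≤ mon s n :=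
  Finset.prod_le_prod' fun i _ => pow_le_pow_left' (h i) _

theorem mon_const (ε : ℝ≥0∞) (n : σ →₀ ℕ) : mon (fun _ => ε) n = ε ^ n.degree :=
  (Finset.prod_pow_eq_pow_sum _ _ _)

theorem mon_mul (r s : σ → ℝ≥0∞) (n : σ →₀ ℕ) : mon (fun i => r i * s i) n = mon r n * mon s n := by
  simp only [mon, Finsupp.prod, mul_pow, Finset.prod_mul_distrib]

theorem wnorm_mono {r s : σ → ℝ≥0∞} (h : r ≤ s) (f : MvPowerSeries σ ℂ) : wnorm r f ≤ wnorm s f :=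
  ENNReal.tsum_le_tsum fun n => mul_le_mul_right (mon_mono h n) _

theorem wnorm_add_le (r : σ → ℝ≥0∞) (f g : MvPowerSeries σ ℂ) :
    wnorm r (f + g) ≤ wnorm r f + wnorm r g := by
  rw [wnorm, wnorm, wnorm, ← ENNReal.tsum_add]
  refine ENNReal.tsum_le_tsum fun n => ?_
  rw [← add_mul, map_add]
  exact mul_le_mul_left (enorm_add_le _ _) _

theorem wnorm_neg (r : σ → ℝ≥0∞) (f : MvPowerSeries σ ℂ) : wnorm r (-f) = wnorm r f := by
  simp [wnorm]

theorem wnorm_zero (r : σ → ℝ≥0∞) : wnorm r (0 : MvPowerSeries σ ℂ) = 0 := by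
  simp [wnorm]

theorem wnorm_monomial (r : σ → ℝ≥0∞) (n : σ →₀ ℕ) (a : ℂ) :
    wnorm r (monomial n a) = ‖a‖ₑ * mon r n := by
  classical
  rw [wnorm, tsum_eq_single n]
  · rw [coeff_monomial_same]
  · intro m hm
    rw [coeff_monomial_ne hm, enorm_zero, zero_mul]

theorem wnorm_X (r : σ → ℝ≥0∞) (i : σ) : wnorm r (X i) = r i := by
  rw [X_def, wnorm_monomial, mon_single]
  simp

theorem wnorm_C (r : σ → ℝ≥0∞) (a : ℂ) : wnorm r (C a : MvPowerSeries σ ℂ) = ‖a‖ₑ := by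
  rw [← monomial_zero_eq_C_apply, wnorm_monomial, mon_zero, mul_one]

theorem wnorm_one (r : σ → ℝ≥0∞) : wnorm r (1 : MvPowerSeries σ ℂ) = 1 := by
  rw [← map_one C, wnorm_C]
  simp

theorem wnorm_mul_le (r : σ → ℝ≥0∞) (f g : MvPowerSeries σ ℂ) :
    wnorm r (f * g) ≤ wnorm r f * wnorm r g := by
  classical
  calc wnorm r (f * g)
      ≤ ∑' n, ∑ p ∈ Finset.HasAntidiagonal.antidiagonal n, (‖coeff p.1 f‖ₑ * mon r p.1) *
          (‖coeff p.2 g‖ₑ * mon r p.2) := by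
        refine ENNReal.tsum_le_tsum fun n => ?_
        rw [coeff_mul]
        refine (mul_le_mul_left (enorm_sum_le _ _) _).trans ?_
        rw [Finset.sum_mul]
        refine Finset.sum_le_sum fun p hp => ?_
        rw [← Finset.HasAntidiagonal.mem_antidiagonal.1 hp, mon_add, enorm_mul]
        exact le_of_eq (by ring)
    _ = ∑' q : Σ n : σ →₀ ℕ, Finset.HasAntidiagonal.antidiagonal n, (‖coeff q.2.1.1 f‖ₑ * mon r q.2.1.1) *
          (‖coeff q.2.1.2 g‖ₑ * mon r q.2.1.2) := by
        rw [ENNReal.tsum_sigma']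
        refine tsum_congr fun n => ?_
        rw [tsum_fintype, ← Finset.sum_coe_sort]
    _ = ∑' p : (σ →₀ ℕ) × (σ →₀ ℕ), (‖coeff p.1 f‖ₑ * mon r p.1) * (‖coeff p.2 g‖ₑ * mon r p.2) :=
        (Finset.HasAntidiagonal.sigmaAntidiagonalEquivProd (A := σ →₀ ℕ)).tsum_eq (fun p =>
          (‖coeff p.1 f‖ₑ * mon r p.1) * (‖coeff p.2 g‖ₑ * mon r p.2))
    _ = wnorm r f * wnorm r g := by
        rw [ENNReal.tsum_prod (f := fun a b => (‖coeff a f‖ₑ * mon r a) * (‖coeff b g‖ₑ * mon r b)),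
          wnorm, wnorm, ← ENNReal.tsum_mul_right]
        simp_rw [ENNReal.tsum_mul_left]

theorem wnorm_pow_le (r : σ → ℝ≥0∞) (f : MvPowerSeries σ ℂ) (k : ℕ) :
    wnorm r (f ^ k) ≤ wnorm r f ^ k := by
  induction k with
  | zero => simp [wnorm_one]
  | succ k ih =>
    rw [pow_succ, pow_succ]
    exact (wnorm_mul_le _ _ _).trans (mul_le_mul_left ih _)

theorem wnorm_prod_le (r : σ → ℝ≥0∞) {ι : Type*} (s : Finset ι) (f : ι → MvPowerSeries σ ℂ) :
    wnorm r (∏ i ∈ s, f i) ≤ ∏ i ∈ s, wnorm r (f i) := by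
  classical
  induction s using Finset.induction_on with
  | empty => simp [wnorm_one]
  | insert a s ha ih =>
    rw [Finset.prod_insert ha, Finset.prod_insert ha]
    exact (wnorm_mul_le _ _ _).trans (mul_le_mul_right ih _)

theorem enorm_coeff_subst_le [Finite σ] {g : σ → MvPowerSeries τ ℂ} (hg : NoConst g)
    (f : MvPowerSeries σ ℂ) (e : τ →₀ ℕ) :
    ‖coeff e (subst g f)‖ₑ ≤ ∑' d : σ →₀ ℕ, ‖coeff d f‖ₑ * ‖coeff e (d.prod fun s k => g s ^ k)‖ₑ := by
  rw [coeff_subst hg.hasSubst, finsum_eq_sum _ (coeff_subst_finite hg.hasSubst f e)]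
  refine (enorm_sum_le _ _).trans ?_
  simp only [smul_eq_mul, enorm_mul]
  exact ENNReal.sum_le_tsum _

theorem wnorm_prod_pow_le (r : τ → ℝ≥0∞) (g : σ → MvPowerSeries τ ℂ) (d : σ →₀ ℕ) :
    wnorm r (d.prod fun s k => g s ^ k) ≤ mon (fun i => wnorm r (g i)) d :=
  (wnorm_prod_le _ _ _).trans (Finset.prod_le_prod' fun _ _ => wnorm_pow_le _ _ _)

/-- Majorant principle for compositions. With values in `ℝ≥0∞` the sums can be exchanged freely, so
no convergence has to be assumed. -/
theorem wnorm_subst_le [Finite σ] (r : τ → ℝ≥0∞) {g : σ → MvPowerSeries τ ℂ} (hg : NoConst g)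
    (f : MvPowerSeries σ ℂ) : wnorm r (subst g f) ≤ wnorm (fun i => wnorm r (g i)) f := by
  calc wnorm r (subst g f)
      ≤ ∑' e, ∑' d : σ →₀ ℕ, ‖coeff d f‖ₑ * (‖coeff e (d.prod fun s k => g s ^ k)‖ₑ * mon r e) := by
        refine ENNReal.tsum_le_tsum fun e => ?_
        refine (mul_le_mul_left (enorm_coeff_subst_le hg f e) _).trans ?_
        rw [← ENNReal.tsum_mul_right]
        simp_rw [mul_assoc]
        exact le_rfl
    _ = ∑' d : σ →₀ ℕ, ‖coeff d f‖ₑ * wnorm r (d.prod fun s k => g s ^ k) := by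
        rw [ENNReal.tsum_comm]
        simp_rw [ENNReal.tsum_mul_left, wnorm]
    _ ≤ _ := ENNReal.tsum_le_tsum fun d => mul_le_mul_right (wnorm_prod_pow_le r g d) _

/-! ### Convergent series -/

theorem convergent_iff {f : MvPowerSeries σ ℂ} :
    Convergent f ↔ ∃ ε : ℝ≥0∞, ε ≠ 0 ∧ wnorm (fun _ => ε) f ≠ ⊤ := by
  have key : ∀ r : ℝ≥0, wnorm (fun _ => (r : ℝ≥0∞)) f ≠ ⊤ ↔
      Summable fun n : σ →₀ ℕ => ‖coeff n f‖ * (r : ℝ) ^ n.degree := by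
    intro r
    have : wnorm (fun _ => (r : ℝ≥0∞)) f = ∑' n, ((‖coeff n f‖₊ * r ^ n.degree : ℝ≥0) : ℝ≥0∞) := by
      refine tsum_congr fun n => ?_
      rw [mon_const, enorm_eq_nnnorm]
      push_cast
      rfl
    rw [this, ENNReal.tsum_coe_ne_top_iff_summable, ← NNReal.summable_coe]
    simp
  constructor
  · rintro ⟨r, hr, hs⟩
    lift r to ℝ≥0 using hr.le
    exact ⟨r, by exact_mod_cast hr.ne', (key r).2 hs⟩
  · rintro ⟨ε, hε, hf⟩
    -- The radius `ε` may be infinite; capping it at 1 makes it a real number.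
    have h1 : min ε 1 ≠ ⊤ := ne_top_of_le_ne_top ENNReal.one_ne_top (min_le_right _ _)
    refine ⟨(min ε 1).toNNReal, ?_, (key _).1 ?_⟩
    · rw [NNReal.coe_pos, ENNReal.toNNReal_pos_iff]
      exact ⟨lt_min (pos_iff_ne_zero.2 hε) one_pos, lt_top_iff_ne_top.2 h1⟩
    · rw [ENNReal.coe_toNNReal h1]
      exact ne_top_of_le_ne_top hf (wnorm_mono (fun _ => min_le_left _ _) f)

theorem Convergent.exists_forall [Finite υ] {f : υ → MvPowerSeries σ ℂ} (hf : ∀ k, Convergent (f k)) :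
    ∃ ε : ℝ≥0∞, ε ≠ 0 ∧ ε ≠ ⊤ ∧ ∀ k, wnorm (fun _ => ε) (f k) ≠ ⊤ := by
  have := Fintype.ofFinite υ
  choose ε hε hw using fun k => convergent_iff.1 (hf k)
  have hne : Finset.univ.inf ε ⊓ 1 ≤ 1 := inf_le_right
  refine ⟨Finset.univ.inf ε ⊓ 1, ?_, ne_top_of_le_ne_top ENNReal.one_ne_top hne, fun k => ?_⟩
  · rw [← pos_iff_ne_zero, lt_inf_iff]
    exact ⟨(Finset.lt_inf_iff (by simp)).2 fun k _ => pos_iff_ne_zero.2 (hε k), one_pos⟩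
  · exact ne_top_of_le_ne_top (hw k)
      (wnorm_mono (fun _ => inf_le_left.trans (Finset.inf_le (Finset.mem_univ k))) _)

/-- Without a constant term, each monomial contains the radius at least once, so shrinking the
radius by `c` gains at least one factor `c`. -/
theorem wnorm_smul_le {f : MvPowerSeries σ ℂ} (hf : constantCoeff f = 0) {c : ℝ≥0∞} (hc : c ≤ 1)
    (ε : ℝ≥0∞) : wnorm (fun _ => c * ε) f ≤ c * wnorm (fun _ => ε) f := by
  rw [wnorm, wnorm, ← ENNReal.tsum_mul_left]
  refine ENNReal.tsum_le_tsum fun n => ?_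
  rcases eq_or_ne n 0 with rfl | hn
  · simp [hf]
  · rw [mon_mul, mon_const]
    have : c ^ n.degree ≤ c := pow_le_of_le_one (zero_le) hc (by simpa [Finsupp.degree_eq_zero_iff] using hn)
    calc ‖coeff n f‖ₑ * (c ^ n.degree * mon (fun _ => ε) n)
        = c ^ n.degree * (‖coeff n f‖ₑ * mon (fun _ => ε) n) := by ring
      _ ≤ _ := mul_le_mul_left this _

theorem Convergent.exists_wnorm_le [Finite υ] {f : υ → MvPowerSeries σ ℂ}
    (hf : ∀ k, Convergent (f k)) (h0 : NoConst f) {η : ℝ≥0∞} (hη : η ≠ 0) :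
    ∃ ε : ℝ≥0∞, ε ≠ 0 ∧ ε ≤ η ∧ ∀ k, wnorm (fun _ => ε) (f k) ≤ η := by
  have := Fintype.ofFinite υ
  obtain ⟨ε, hε, hε', hw⟩ := Convergent.exists_forall hf
  set B := ∑ k, wnorm (fun _ => ε) (f k) + ε + 1 with hB
  have hBtop : B ≠ ⊤ := by
    rw [hB]
    have : ∑ k, wnorm (fun _ => ε) (f k) ≠ ⊤ := ENNReal.sum_ne_top.2 fun k _ => hw k
    exact ENNReal.add_ne_top.2 ⟨ENNReal.add_ne_top.2 ⟨this, hε'⟩, ENNReal.one_ne_top⟩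
  have hB0 : B ≠ 0 := by simp [hB]
  -- `B` dominates the radius and all the norms at that radius, so `c * B ≤ η` bounds both after
  -- shrinking.
  set c := min 1 (η / B) with hc
  have hc1 : c ≤ 1 := min_le_left _ _
  have hcB : c * B ≤ η := by
    calc c * B ≤ η / B * B := mul_le_mul_left (min_le_right _ _) _
      _ = η := ENNReal.div_mul_cancel hB0 hBtop
  have hc0 : c ≠ 0 := by
    rw [← pos_iff_ne_zero, lt_min_iff]
    exact ⟨one_pos, ENNReal.div_pos hη hBtop⟩
  refine ⟨c * ε, mul_ne_zero hc0 hε, le_trans (mul_le_mul_right ?_ _) hcB, fun k => ?_⟩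
  · rw [hB, add_assoc, add_comm]
    exact (le_add_right le_self_add)
  · refine (wnorm_smul_le (h0 k) hc1 ε).trans (le_trans (mul_le_mul_right ?_ _) hcB)
    rw [hB, add_assoc]
    exact le_add_right (Finset.single_le_sum (f := fun k => wnorm (fun _ => ε) (f k))
      (fun _ _ => zero_le) (Finset.mem_univ k))

theorem Convergent.subst [Finite σ] {f : MvPowerSeries σ ℂ} (hf : Convergent f)
    {g : σ → MvPowerSeries τ ℂ} (hg : NoConst g) (hgc : ∀ i, Convergent (g i)) :
    Convergent (subst g f) := by
  obtain ⟨R, hR, hfR⟩ := convergent_iff.1 hf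
  obtain ⟨ε, hε, -, hgε⟩ := Convergent.exists_wnorm_le hgc hg hR
  exact convergent_iff.2 ⟨ε, hε, ne_top_of_le_ne_top hfR
    ((wnorm_subst_le _ hg f).trans (wnorm_mono (fun i => hgε i) f))⟩

theorem Convergent.add {f g : MvPowerSeries σ ℂ} (hf : Convergent f) (hg : Convergent g) :
    Convergent (f + g) := by
  obtain ⟨ε, hε, -, h⟩ := Convergent.exists_forall (f := fun b : Bool => cond b f g)
    (by rintro (_ | _) <;> assumption)
  exact convergent_iff.2 ⟨ε, hε, ne_top_of_le_ne_top (ENNReal.add_ne_top.2 ⟨h true, h false⟩)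
    (wnorm_add_le _ f g)⟩

theorem Convergent.neg {f : MvPowerSeries σ ℂ} (hf : Convergent f) : Convergent (-f) := by
  obtain ⟨ε, hε, h⟩ := convergent_iff.1 hf
  exact convergent_iff.2 ⟨ε, hε, by rwa [wnorm_neg]⟩

theorem Convergent.sub {f g : MvPowerSeries σ ℂ} (hf : Convergent f) (hg : Convergent g) :
    Convergent (f - g) := sub_eq_add_neg f g ▸ hf.add hg.neg

theorem Convergent.mul {f g : MvPowerSeries σ ℂ} (hf : Convergent f) (hg : Convergent g) :
    Convergent (f * g) := by
  obtain ⟨ε, hε, -, h⟩ := Convergent.exists_forall (f := fun b : Bool => cond b f g)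
    (by rintro (_ | _) <;> assumption)
  exact convergent_iff.2 ⟨ε, hε, ne_top_of_le_ne_top (ENNReal.mul_ne_top (h true) (h false))
    (wnorm_mul_le _ f g)⟩

theorem convergent_C (a : ℂ) : Convergent (C a : MvPowerSeries σ ℂ) :=
  convergent_iff.2 ⟨1, one_ne_zero, by rw [wnorm_C]; exact enorm_ne_top⟩

theorem convergent_zero : Convergent (0 : MvPowerSeries σ ℂ) :=
  convergent_iff.2 ⟨1, one_ne_zero, by rw [wnorm_zero]; exact ENNReal.zero_ne_top⟩

theorem convergent_one : Convergent (1 : MvPowerSeries σ ℂ) := by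
  rw [← map_one (C (σ := σ) (R := ℂ))]
  exact convergent_C 1

theorem convergent_X (i : σ) : Convergent (X i : MvPowerSeries σ ℂ) :=
  convergent_iff.2 ⟨1, one_ne_zero, by rw [wnorm_X]; exact ENNReal.one_ne_top⟩

theorem Convergent.sum {κ : Type*} {s : Finset κ} {f : κ → MvPowerSeries σ ℂ}
    (hf : ∀ k ∈ s, Convergent (f k)) : Convergent (∑ k ∈ s, f k) := by
  classical
  induction s using Finset.induction_on with
  | empty => simpa using convergent_zero
  | insert a s ha ih =>
    rw [Finset.sum_insert ha]
    exact (hf a (Finset.mem_insert_self _ _)).add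
      (ih fun k hk => hf k (Finset.mem_insert_of_mem hk))

theorem Convergent.prod {κ : Type*} {s : Finset κ} {f : κ → MvPowerSeries σ ℂ}
    (hf : ∀ k ∈ s, Convergent (f k)) : Convergent (∏ k ∈ s, f k) := by
  classical
  induction s using Finset.induction_on with
  | empty => simpa using convergent_one
  | insert a s ha ih =>
    rw [Finset.prod_insert ha]
    exact (hf a (Finset.mem_insert_self _ _)).mul
      (ih fun k hk => hf k (Finset.mem_insert_of_mem hk))

theorem Convergent.sumElim {g : σ → MvPowerSeries υ ℂ} {h : τ → MvPowerSeries υ ℂ}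
    (hg : ∀ i, Convergent (g i)) (hh : ∀ i, Convergent (h i)) :
    ∀ i, Convergent (Sum.elim g h i) := by
  rintro (i | i)
  · exact hg i
  · exact hh i

theorem wnorm_conj (r : σ → ℝ≥0∞) (f : MvPowerSeries σ ℂ) : wnorm r (conj f) = wnorm r f := by
  refine tsum_congr fun n => ?_
  rw [conj, coeff_map, ← ofReal_norm, ← ofReal_norm]
  simp

theorem Convergent.conj {f : MvPowerSeries σ ℂ} (hf : Convergent f) : Convergent (conj f) := by
  obtain ⟨ε, hε, h⟩ := convergent_iff.1 hf
  exact convergent_iff.2 ⟨ε, hε, by rwa [wnorm_conj]⟩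

/-- Multiplication by a variable only shifts the coefficients, so at radius `ε` it costs exactly a
factor `ε` in the norm. -/
theorem Convergent.of_X_mul {f : MvPowerSeries σ ℂ} {i : σ} (hf : Convergent (X i * f)) :
    Convergent f := by
  classical
  obtain ⟨ε, hε, hε', h⟩ := Convergent.exists_forall (υ := Unit) (fun _ => hf)
  refine convergent_iff.2 ⟨ε, hε, fun htop => h () ?_⟩
  have : ε * wnorm (fun _ => ε) f ≤ wnorm (fun _ => ε) (X i * f) := by
    rw [wnorm, ← ENNReal.tsum_mul_left, wnorm]
    calc ∑' n, ε * (‖coeff n f‖ₑ * mon (fun _ => ε) n)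
        = ∑' n, ‖coeff (n + Finsupp.single i 1) (X i * f)‖ₑ *
            mon (fun _ => ε) (n + Finsupp.single i 1) := by
          refine tsum_congr fun n => ?_
          rw [coeff_X_mul_ite, if_neg (by simp), add_tsub_cancel_right, mon_add, mon_single]
          ring
      _ ≤ _ := ENNReal.tsum_comp_le_tsum_of_injective (add_left_injective (Finsupp.single i 1))
          (fun n => ‖coeff n (X i * f)‖ₑ * mon (fun _ => ε) n)
  rw [htop, ENNReal.mul_top hε] at this
  exact top_le_iff.1 this

theorem Convergent.pderiv {f : MvPowerSeries σ ℂ} (hf : Convergent f) (i : σ) :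
    Convergent (pderiv ℂ i f) := by
  obtain ⟨ε, hε, hε', h⟩ := Convergent.exists_forall (υ := Unit) (fun _ => hf)
  refine convergent_iff.2 ⟨2⁻¹ * ε, mul_ne_zero (by simp) hε, fun htop => h () ?_⟩
  have : ε * wnorm (fun _ => 2⁻¹ * ε) (MvPowerSeries.pderiv ℂ i f) ≤ wnorm (fun _ => ε) f := by
    rw [wnorm, ← ENNReal.tsum_mul_left]
    calc ∑' n, ε * (‖coeff n (MvPowerSeries.pderiv ℂ i f)‖ₑ * mon (fun _ => 2⁻¹ * ε) n)
        ≤ ∑' n, ‖coeff (n + Finsupp.single i 1) f‖ₑ *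
            mon (fun _ => ε) (n + Finsupp.single i 1) := by
          refine ENNReal.tsum_le_tsum fun n => ?_
          rw [coeff_pderiv, mon_add, mon_single, mon_mul, mon_const, enorm_mul]
          -- The factor `n i + 1` produced by the derivative is at most `2 ^ n.degree`, which
          -- halving the radius absorbs.
          have h1 : ‖(n i + 1 : ℂ)‖ₑ * 2⁻¹ ^ n.degree ≤ 1 := by
            have h2 : ‖(n i + 1 : ℂ)‖ₑ = ((n i + 1 : ℕ) : ℝ≥0∞) := by
              rw [← ofReal_norm, ← Nat.cast_succ, Complex.norm_natCast, ENNReal.ofReal_natCast]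
            have h3 : n i + 1 ≤ 2 ^ n.degree :=
              (Nat.lt_two_pow_self).trans_le
                (Nat.pow_le_pow_right (by norm_num) (Finsupp.le_degree i n))
            rw [h2, ← ENNReal.inv_pow]
            calc ((n i + 1 : ℕ) : ℝ≥0∞) * (2 ^ n.degree)⁻¹ ≤ 2 ^ n.degree * (2 ^ n.degree)⁻¹ :=
                  mul_le_mul_left (by exact_mod_cast h3) _
              _ = 1 := ENNReal.mul_inv_cancel (by simp) (by simp)
          calc ε * (‖coeff (n + Finsupp.single i 1) f‖ₑ * ‖(n i + 1 : ℂ)‖ₑ *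
                (2⁻¹ ^ n.degree * mon (fun _ => ε) n))
              = ‖(n i + 1 : ℂ)‖ₑ * 2⁻¹ ^ n.degree *
                (‖coeff (n + Finsupp.single i 1) f‖ₑ * (mon (fun _ => ε) n * ε ^ 1)) := by ring
            _ ≤ 1 * _ := mul_le_mul_left h1 _
            _ = _ := one_mul _
      _ ≤ _ := ENNReal.tsum_comp_le_tsum_of_injective (add_left_injective (Finsupp.single i 1))
          (fun n => ‖coeff n f‖ₑ * mon (fun _ => ε) n)
  rw [htop, ENNReal.mul_top hε] at this
  exact top_le_iff.1 this

/-! ### The implicit function theorem -/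

/-- Two solutions modulo an ideal of a system with invertible linear part in the unknowns agree
modulo that ideal. -/
theorem implicit_unique [Fintype τ] [Fintype ι] [DecidableEq ι] {F : ι → MvPowerSeries (τ ⊕ ι) ℂ}
    (hF' : ∀ i j, constantCoeff (pderiv ℂ (Sum.inr j) (F i)) = if i = j then 1 else 0)
    {a : τ → MvPowerSeries υ ℂ} (ha : NoConst a) {h h' : ι → MvPowerSeries υ ℂ} (hh : NoConst h)
    (hh' : NoConst h') (I : Ideal (MvPowerSeries υ ℂ))
    (hF : ∀ i, subst (Sum.elim a h) (F i) - subst (Sum.elim a h') (F i) ∈ I) (i : ι) :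
    h i - h' i ∈ I := by
  -- Hadamard's lemma makes the difference of the two systems a matrix times `h - h'`. The matrix is
  -- the identity at the origin, so it is invertible and the ideal membership transfers to `h - h'`.
  choose M hM hM0 using fun k => exists_subst_sub_subst (F k) (ha.sumElim hh) (ha.sumElim hh')
  let A : Matrix ι ι (MvPowerSeries υ ℂ) := Matrix.of fun i j => M i (Sum.inr j)
  have hA : IsUnit A.det := by
    rw [isUnit_iff_constantCoeff]
    have : A.map constantCoeff = 1 := by
      ext i j
      rw [Matrix.map_apply, Matrix.one_apply, ← hF', ← hM0]
      rfl
    have h2 : constantCoeff A.det = 1 := by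
      rw [RingHom.map_det, RingHom.mapMatrix_apply, this, Matrix.det_one]
    rw [h2]
    exact isUnit_one
  have h1 : ∀ i, (A.mulVec fun j => h j - h' j) i ∈ I := by
    intro i
    have := hF i
    rw [hM, Fintype.sum_sum_type] at this
    simpa using! this
  have h3 : (fun j => h j - h' j) = A⁻¹.mulVec (A.mulVec fun j => h j - h' j) := by
    rw [Matrix.mulVec_mulVec, Matrix.nonsing_inv_mul _ hA, Matrix.one_mulVec]
  have h4 := congrFun h3 i
  rw [h4]
  exact I.sum_mem fun j _ => I.mul_mem_left _ (h1 j)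

/-- The iteration whose limit is the solution of `h = T(x, h)`. -/
def fixIter (T : ι → MvPowerSeries (τ ⊕ ι) ℂ) : ℕ → ι → MvPowerSeries τ ℂ
  | 0 => 0
  | k + 1 => fun i => subst (Sum.elim X (fixIter T k)) (T i)

section Fix

variable [Finite τ] [Finite ι] {T : ι → MvPowerSeries (τ ⊕ ι) ℂ}

theorem noConst_fixIter (hT : NoConst T) (k : ℕ) : NoConst (fixIter T k) := by
  induction k with
  | zero => exact noConst_zero
  | succ k ih => exact hT.subst (noConst_X.sumElim ih)

/-- `T` has no linear part in the unknowns, so the Hadamard quotients in these variables have no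
constant term. The map h ↦ T(x, h) thus gains one order: it contracts in the order filtration. -/
theorem subst_sub_subst_mem_ordIdeal
    (hT' : ∀ i j, constantCoeff (pderiv ℂ (Sum.inr j) (T i)) = 0) {h h' : ι → MvPowerSeries τ ℂ}
    (hh : NoConst h) (hh' : NoConst h') {k : ℕ}
    (hk : ∀ i, h i - h' i ∈ ordIdeal (fun _ => 1) k) (i : ι) :
    subst (Sum.elim X h) (T i) - subst (Sum.elim X h') (T i) ∈ ordIdeal (fun _ => 1) (k + 1) := by
  have := Fintype.ofFinite τ
  have := Fintype.ofFinite ι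
  obtain ⟨M, hM, hM0⟩ := exists_subst_sub_subst (T i) (noConst_X.sumElim hh) (noConst_X.sumElim hh')
  rw [hM, Fintype.sum_sum_type, Finset.sum_eq_zero (by simp), zero_add]
  refine Ideal.sum_mem _ fun j _ => ?_
  rw [add_comm]
  exact mul_mem_ordIdeal (mem_ordIdeal_one_iff.2 (by rw [hM0, hT'])) (hk j)

theorem fixIter_sub_mem (hT : NoConst T)
    (hT' : ∀ i j, constantCoeff (pderiv ℂ (Sum.inr j) (T i)) = 0) (k : ℕ) (i : ι) :
    fixIter T (k + 1) i - fixIter T k i ∈ ordIdeal (fun _ => 1) (k + 1) := by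
  induction k generalizing i with
  | zero =>
    rw [mem_ordIdeal_one_iff, map_sub, noConst_fixIter hT, noConst_fixIter hT, sub_zero]
  | succ k ih =>
    exact subst_sub_subst_mem_ordIdeal hT' (noConst_fixIter hT _) (noConst_fixIter hT _) ih i

theorem fixIter_sub_mem_of_le (hT : NoConst T)
    (hT' : ∀ i j, constantCoeff (pderiv ℂ (Sum.inr j) (T i)) = 0) {k l : ℕ} (hkl : k ≤ l) (i : ι) :
    fixIter T l i - fixIter T k i ∈ ordIdeal (fun _ => 1) (k + 1) := by
  induction l, hkl using Nat.le_induction with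
  | base => simp
  | succ l hl ih =>
    have := Ideal.add_mem _ (ordIdeal_mono (by omega) (fixIter_sub_mem hT hT' l i)) ih
    rwa [sub_add_sub_cancel] at this

/-- The formal solution of `h = T(x, h)`. -/
def fixSeries (T : ι → MvPowerSeries (τ ⊕ ι) ℂ) (i : ι) : MvPowerSeries τ ℂ :=
  fun n => coeff n (fixIter T n.degree i)

omit [Finite τ] [Finite ι] in
theorem coeff_fixSeries (i : ι) (n : τ →₀ ℕ) :
    coeff n (fixSeries T i) = coeff n (fixIter T n.degree i) := rfl

theorem coeff_fixSeries_of_le (hT : NoConst T)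
    (hT' : ∀ i j, constantCoeff (pderiv ℂ (Sum.inr j) (T i)) = 0) {k : ℕ} (i : ι) {n : τ →₀ ℕ}
    (hn : n.degree ≤ k) : coeff n (fixSeries T i) = coeff n (fixIter T k i) := by
  have := coeff_eq_zero_of_mem_ordIdeal (fixIter_sub_mem_of_le hT hT' hn i) (Nat.lt_succ_self _)
  rw [map_sub, sub_eq_zero] at this
  rw [coeff_fixSeries, this]

theorem fixSeries_sub_mem (hT : NoConst T)
    (hT' : ∀ i j, constantCoeff (pderiv ℂ (Sum.inr j) (T i)) = 0) (k : ℕ) (i : ι) :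
    fixSeries T i - fixIter T k i ∈ ordIdeal (fun _ => 1) (k + 1) := by
  rw [mem_ordIdeal_iff]
  intro n hn
  have hn' : n.degree < k + 1 := by simpa [Finsupp.degree_eq_weight_one] using! hn
  rw [map_sub, coeff_fixSeries_of_le hT hT' i (Nat.lt_succ_iff.1 hn'), sub_self]

theorem noConst_fixSeries (hT : NoConst T) : NoConst (fixSeries T) := fun i => by
  rw [← coeff_zero_eq_constantCoeff_apply, coeff_fixSeries, coeff_zero_eq_constantCoeff_apply]
  exact noConst_fixIter hT _ i

theorem subst_fixSeries (hT : NoConst T)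
    (hT' : ∀ i j, constantCoeff (pderiv ℂ (Sum.inr j) (T i)) = 0) (i : ι) :
    subst (Sum.elim X (fixSeries T)) (T i) = fixSeries T i := by
  rw [← sub_eq_zero]
  refine eq_zero_of_forall_mem_ordIdeal fun k => ?_
  have h1 := subst_sub_subst_mem_ordIdeal hT' (noConst_fixSeries hT) (noConst_fixIter hT k)
    (fixSeries_sub_mem hT hT' k) i
  have h2 := fixSeries_sub_mem hT hT' (k + 1) i
  have := Ideal.sub_mem _ h1 h2
  rw [fixIter, sub_sub_sub_cancel_right] at this
  exact ordIdeal_mono (by omega) this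

/-- If `T` maps the polydisc of radii `e` over that of radii `r` into itself, all iterates starting
from 0 stay there. A finite partial sum of the limit is a partial sum of a sufficiently late
iterate. -/
theorem wnorm_fixSeries_le (hT : NoConst T)
    (hT' : ∀ i j, constantCoeff (pderiv ℂ (Sum.inr j) (T i)) = 0) {r : τ → ℝ≥0∞} {e : ι → ℝ≥0∞}
    (hr : ∀ i, wnorm (Sum.elim r e) (T i) ≤ e i) (i : ι) : wnorm r (fixSeries T i) ≤ e i := by
  have h1 : ∀ k i, wnorm r (fixIter T k i) ≤ e i := by
    intro k
    induction k with
    | zero => intro i; simp [fixIter, wnorm_zero]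
    | succ k ih =>
      intro i
      refine (wnorm_subst_le r (noConst_X.sumElim (noConst_fixIter hT k)) (T i)).trans
        (le_trans (wnorm_mono ?_ _) (hr i))
      rintro (j | j)
      · simp [wnorm_X]
      · simpa using ih j
  rw [wnorm, ENNReal.tsum_eq_iSup_sum]
  refine iSup_le fun s => ?_
  refine le_trans ?_ (h1 (s.sup Finsupp.degree) i)
  refine le_trans (le_of_eq ?_) (ENNReal.sum_le_tsum s)
  refine Finset.sum_congr rfl fun n hn => ?_
  rw [coeff_fixSeries_of_le hT hT' i (Finset.le_sup (f := Finsupp.degree) hn)]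

/-- Give the parameters radius `a ^ 2 * R` and the unknowns radius `a * R`. Since `T` has no
constant term and no term linear in the unknowns, each remaining monomial shrinks by a factor at
most `a ^ 2`. So the norm of `T` is at most `a ^ 2 * B ≤ a * R` once `a * B ≤ R`, which is the
invariance needed for `wnorm_fixSeries_le`. -/
theorem convergent_fixSeries (hT : NoConst T)
    (hT' : ∀ i j, constantCoeff (pderiv ℂ (Sum.inr j) (T i)) = 0) (hTc : ∀ i, Convergent (T i))
    (i : ι) : Convergent (fixSeries T i) := by
  classical
  have := Fintype.ofFinite ι
  obtain ⟨R, hR, hR', hTR⟩ := Convergent.exists_forall hTc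
  set B := ∑ i, wnorm (fun _ => R) (T i) + 1 with hB
  have hBtop : B ≠ ⊤ := ENNReal.add_ne_top.2
    ⟨ENNReal.sum_ne_top.2 fun k _ => hTR k, ENNReal.one_ne_top⟩
  have hB0 : B ≠ 0 := by simp [hB]
  set a := min 1 (R / B) with ha
  have ha1 : a ≤ 1 := min_le_left _ _
  have haB : a * B ≤ R := by
    calc a * B ≤ R / B * B := mul_le_mul_left (min_le_right _ _) _
      _ = R := ENNReal.div_mul_cancel hB0 hBtop
  have ha0 : a ≠ 0 := by
    rw [← pos_iff_ne_zero, lt_min_iff]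
    exact ⟨one_pos, ENNReal.div_pos hR hBtop⟩
  have hmon : ∀ (n : τ ⊕ ι →₀ ℕ), n ≠ 0 → (∀ j, n ≠ Finsupp.single (Sum.inr j) 1) →
      mon (Sum.elim (fun _ => a ^ 2) (fun _ => a)) n ≤ a ^ 2 := by
    intro n hn hn'
    have hle : ∀ x : τ ⊕ ι, (Sum.elim (fun _ => a ^ 2) (fun _ => a) x : ℝ≥0∞) ≤ 1 := by
      rintro (x | x)
      · exact pow_le_one₀ zero_le ha1
      · exact ha1
    have hmle : ∀ m : τ ⊕ ι →₀ ℕ, mon (Sum.elim (fun _ => a ^ 2) (fun _ => a)) m ≤ 1 :=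
      fun m => Finset.prod_le_one' fun x _ => pow_le_one₀ zero_le (hle x)
    by_cases hx : ∃ x, n (Sum.inl x) ≠ 0
    · obtain ⟨x, hx⟩ := hx
      have : n = Finsupp.single (Sum.inl x) 1 + (n - Finsupp.single (Sum.inl x) 1) :=
        (add_tsub_cancel_of_le (by simpa [Nat.one_le_iff_ne_zero] using hx)).symm
      rw [this, mon_add, mon_single]
      simpa using mul_le_of_le_one_right' (a := a ^ 2) (hmle (n - Finsupp.single (Sum.inl x) 1))
    · push Not at hx
      obtain ⟨x, hxn⟩ := Finsupp.ne_iff.1 hn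
      obtain ⟨j, rfl⟩ : ∃ j, x = Sum.inr j := by
        rcases x with x | j
        · exact (hxn (hx x)).elim
        · exact ⟨j, rfl⟩
      obtain ⟨m, hm⟩ : ∃ m, n = Finsupp.single (Sum.inr j) 1 + m :=
        ⟨_, (add_tsub_cancel_of_le
          (by simpa [Nat.one_le_iff_ne_zero] using hxn)).symm⟩
      have hm0 : m ≠ 0 := fun h => hn' j (by rw [hm, h, add_zero])
      obtain ⟨y, hym⟩ := Finsupp.ne_iff.1 hm0
      obtain ⟨l, rfl⟩ : ∃ l, y = Sum.inr l := by
        rcases y with y | l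
        · have := hx y
          rw [hm] at this
          simp at this
          exact (hym this).elim
        · exact ⟨l, rfl⟩
      obtain ⟨p, hp⟩ : ∃ p, m = Finsupp.single (Sum.inr l) 1 + p :=
        ⟨_, (add_tsub_cancel_of_le
          (by simpa [Nat.one_le_iff_ne_zero] using hym)).symm⟩
      rw [hm, hp, mon_add, mon_add, mon_single, mon_single, ← mul_assoc]
      simp only [Sum.elim_inr, pow_one]
      rw [← sq]
      exact mul_le_of_le_one_right' (hmle p)
  have hr : ∀ i, wnorm (Sum.elim (fun _ => a ^ 2 * R) (fun _ => a * R)) (T i) ≤ a * R := by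
    intro i
    have h1 : wnorm (Sum.elim (fun _ => a ^ 2 * R) (fun _ => a * R)) (T i) ≤
        a ^ 2 * wnorm (fun _ => R) (T i) := by
      rw [wnorm, wnorm, ← ENNReal.tsum_mul_left]
      refine ENNReal.tsum_le_tsum fun n => ?_
      by_cases hn0 : n = 0
      · subst hn0
        rw [coeff_zero_eq_constantCoeff_apply, hT i]
        simp
      by_cases hn1 : ∃ j, n = Finsupp.single (Sum.inr j) 1
      · obtain ⟨j, rfl⟩ := hn1
        have := hT' i j
        rw [← coeff_zero_eq_constantCoeff_apply, coeff_pderiv] at this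
        simp at this
        simp [this]
      push Not at hn1
      have h2 : (Sum.elim (fun _ => a ^ 2 * R) (fun _ => a * R) : τ ⊕ ι → ℝ≥0∞) =
          fun x => Sum.elim (fun _ => a ^ 2) (fun _ => a) x * R := by
        funext x
        rcases x with x | x <;> rfl
      rw [h2, mon_mul]
      calc _ = mon (Sum.elim (fun _ => a ^ 2) (fun _ => a)) n *
            (‖coeff n (T i)‖ₑ * mon (fun _ => R) n) := by ring
        _ ≤ _ := mul_le_mul_left (hmon n hn0 hn1) _
    refine h1.trans ?_
    have h3 : wnorm (fun _ => R) (T i) ≤ B :=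
      le_add_right (Finset.single_le_sum (f := fun k => wnorm (fun _ => R) (T k))
        (fun _ _ => zero_le) (Finset.mem_univ i))
    calc a ^ 2 * wnorm (fun _ => R) (T i) ≤ a ^ 2 * B := mul_le_mul_right h3 _
      _ = a * (a * B) := by ring
      _ ≤ a * R := mul_le_mul_right haB _
  refine convergent_iff.2 ⟨a ^ 2 * R, mul_ne_zero (pow_ne_zero _ ha0) hR, ?_⟩
  exact ne_top_of_le_ne_top (ENNReal.mul_ne_top (ne_top_of_le_ne_top ENNReal.one_ne_top ha1) hR')
    (wnorm_fixSeries_le hT hT' hr i)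

end Fix

/-- The implicit function theorem, formal and convergent. -/
theorem exists_implicit [Finite τ] [Fintype ι] [DecidableEq ι] {F : ι → MvPowerSeries (τ ⊕ ι) ℂ}
    (hF : NoConst F)
    (hF' : ∀ i j, constantCoeff (pderiv ℂ (Sum.inr j) (F i)) = if i = j then 1 else 0) :
    ∃ h : ι → MvPowerSeries τ ℂ, NoConst h ∧ (∀ i, subst (Sum.elim X h) (F i) = 0) ∧
      ((∀ i, Convergent (F i)) → ∀ i, Convergent (h i)) := by
  -- A zero of `F` is a fixed point of y ↦ y − F(x, y), and the normalization of `F` removes the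
  -- linear part in y.
  let T : ι → MvPowerSeries (τ ⊕ ι) ℂ := fun i => X (Sum.inr i) - F i
  have hT : NoConst T := fun i => by simp [T, hF i]
  have hT' : ∀ i j, constantCoeff (pderiv ℂ (Sum.inr j) (T i)) = 0 := by
    intro i j
    classical
    simp only [T, map_sub, hF', pderiv_X]
    by_cases h : i = j
    · subst h
      simp
    · simp [h]
  refine ⟨fixSeries T, noConst_fixSeries hT, fun i => ?_, fun hc i =>
    convergent_fixSeries hT hT' (fun i => (convergent_X _).sub (hc i)) i⟩
  have h1 := subst_fixSeries hT hT' i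
  have hs := (noConst_X (σ := τ)).sumElim (noConst_fixSeries hT)
  simp only [T] at h1 hs
  rw [subst_sub hs.hasSubst, subst_X' hs] at h1
  simpa using h1

/-! ### Straightening a submersion -/

/-- The basis extension is made inside the union of the given family and the standard basis, so
every added vector is a coordinate vector. This is why the complementary coordinates of a
straightening are original variables. -/
theorem exists_completion {K : Type} [Field K] [Fintype ι] [DecidableEq ι] {v : δ → ι → K}
    (hv : LinearIndependent K v) :
    ∃ (κ : Type) (_ : Fintype κ) (c : κ → ι),
      LinearIndependent K (Sum.elim v fun k => (Pi.single (c k) 1 : ι → K)) ∧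
      ⊤ ≤ Submodule.span K (Set.range (Sum.elim v fun k => (Pi.single (c k) 1 : ι → K))) := by
  classical
  have hs : LinearIndepOn K id (Set.range v) := hv.linearIndepOn_id
  set t : Set (ι → K) := Set.range v ∪ Set.range (fun i => (Pi.single i 1 : ι → K)) with ht
  have hst : Set.range v ⊆ t := Set.subset_union_left
  set e := hs.extend hst with he
  have hli : LinearIndepOn K id e := hs.linearIndepOn_extend hst
  have hfin : e.Finite := hli.finite
  have hc : ∀ x : ↥(e \ Set.range v), ∃ i, (Pi.single i 1 : ι → K) = x := by
    rintro ⟨x, hx, hxv⟩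
    rcases hs.extend_subset hst hx with h | h
    · exact (hxv h).elim
    · exact h
  choose c hc using hc
  have : Finite ↥(e \ Set.range v) := (hfin.subset Set.sdiff_subset).to_subtype
  have hsub : Set.range v ⊆ e := hs.subset_extend hst
  refine ⟨↥(e \ Set.range v), Fintype.ofFinite _, c, ?_, ?_⟩
  · let f : δ ⊕ ↥(e \ Set.range v) → e :=
      Sum.elim (fun j => ⟨v j, hsub ⟨j, rfl⟩⟩) (fun x => ⟨x, x.2.1⟩)
    have hf : Function.Injective f := by
      rintro (j | x) (j' | x') h
      · rw [hv.injective (congrArg Subtype.val h)]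
      · exact (x'.2.2 ⟨j, congrArg Subtype.val h⟩).elim
      · exact (x.2.2 ⟨j', (congrArg Subtype.val h).symm⟩).elim
      · exact congrArg Sum.inr (Subtype.ext (Subtype.mk.inj h))
    have h1 := LinearIndependent.comp (ι := e) hli f hf
    convert h1 using 1
    funext x
    rcases x with j | x
    · rfl
    · exact hc x
  · have h2 : e ⊆ Set.range (Sum.elim v fun k => (Pi.single (c k) 1 : ι → K)) := by
      intro x hx
      by_cases hxv : x ∈ Set.range v
      · obtain ⟨j, rfl⟩ := hxv
        exact ⟨Sum.inl j, rfl⟩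
      · exact ⟨Sum.inr ⟨x, hx, hxv⟩, hc _⟩
    refine le_trans ?_ (Submodule.span_mono h2)
    have h3 : t ⊆ Submodule.span K e := hs.subset_span_extend hst
    rw [← (Pi.basisFun K ι).span_eq, Submodule.span_le]
    rintro _ ⟨i, rfl⟩
    exact h3 (Or.inr ⟨i, by simp⟩)

theorem exists_completion_inverse {K : Type} [Field K] [Fintype ι] [DecidableEq ι] [Fintype δ]
    [DecidableEq δ] {v : δ → ι → K} (hv : LinearIndependent K v) :
    ∃ (κ : Type) (_ : Fintype κ) (_ : DecidableEq κ) (c : κ → ι) (B : ι → δ ⊕ κ → K),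
      Nonempty (δ ⊕ κ ≃ ι) ∧
      (∀ i j, ∑ q, B i q * Sum.elim v (fun k => (Pi.single (c k) 1 : ι → K)) q j =
        if i = j then 1 else 0) ∧
      (∀ q q', ∑ i, Sum.elim v (fun k => (Pi.single (c k) 1 : ι → K)) q i * B i q' =
        if q = q' then 1 else 0) := by
  obtain ⟨κ, hκ, c, h1, h2⟩ := exists_completion hv
  have hdec : DecidableEq κ := Classical.decEq κ
  let b := Module.Basis.mk h1 h2
  refine ⟨κ, hκ, hdec, c, fun i q => b.repr (Pi.single i 1) q,
    ⟨b.indexEquiv (Pi.basisFun K ι)⟩, fun i j => ?_, fun q q' => ?_⟩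
  · have h3 := congrFun (b.sum_repr (Pi.single i 1)) j
    rw [Finset.sum_apply, Pi.single_apply] at h3
    simp only [eq_comm (a := i)]
    rw [← h3]
    refine Finset.sum_congr rfl fun q _ => ?_
    simp [b]
  · have h3 : b q = ∑ i, (b q i) • (Pi.single i 1 : ι → K) := by
      conv_lhs => rw [← (Pi.basisFun K ι).sum_repr (b q)]
      simp
    have h4 : b.repr (b q) q' = ∑ i, (b q i) * b.repr (Pi.single i 1) q' := by
      conv_lhs => rw [h3]
      simp
    rw [b.repr_self, Finsupp.single_apply] at h4
    rw [h4]
    simp [b]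

/-- A submersion (with parameters) can be straightened: `ρ` and some of the coordinates form a
coordinate system, with inverse `Θ`. -/
theorem exists_straighten [Fintype τ] [Fintype ι] [DecidableEq ι] [Fintype δ] [DecidableEq δ]
    {ρ : δ → MvPowerSeries (τ ⊕ ι) ℂ} (hρ : NoConst ρ)
    (hgen : LinearIndependent ℂ fun (j : δ) (i : ι) => constantCoeff (pderiv ℂ (Sum.inr i) (ρ j))) :
    ∃ (κ : Type) (_ : Fintype κ) (_ : DecidableEq κ) (c : κ → ι)
      (Θ : ι → MvPowerSeries (τ ⊕ (δ ⊕ κ)) ℂ), NoConst Θ ∧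
      ((∀ j, Convergent (ρ j)) → ∀ i, Convergent (Θ i)) ∧
      (∀ j, subst (Sum.elim (fun x => X (Sum.inl x)) Θ) (ρ j) = X (Sum.inr (Sum.inl j))) ∧
      (∀ k, Θ (c k) = X (Sum.inr (Sum.inr k))) ∧
      (∀ i, subst (Sum.elim (fun x => X (Sum.inl x))
        (Sum.elim ρ (fun k => X (Sum.inr (c k))))) (Θ i) = X (Sum.inr i)) := by
  obtain ⟨κ, hκ, hdec, c, B, -, hBA, hAB⟩ := exists_completion_inverse hgen
  let s : τ ⊕ ι → MvPowerSeries ((τ ⊕ (δ ⊕ κ)) ⊕ ι) ℂ :=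
    Sum.elim (fun x => X (Sum.inl (Sum.inl x))) (fun i => X (Sum.inr i))
  have hs : NoConst s := by rintro (x | x) <;> exact constantCoeff_X _
  let G : δ ⊕ κ → MvPowerSeries ((τ ⊕ (δ ⊕ κ)) ⊕ ι) ℂ := fun q =>
    Sum.elim (fun j => subst s (ρ j)) (fun k => X (Sum.inr (c k))) q - X (Sum.inl (Sum.inr q))
  have hG : NoConst G := by
    rintro (j | k)
    · simp [G, constantCoeff_subst' hs, hρ j]
    · simp [G]
  have hG' : ∀ q i, constantCoeff (pderiv ℂ (Sum.inr i) (G q)) =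
      Sum.elim (fun (j : δ) (i : ι) => constantCoeff (pderiv ℂ (Sum.inr i) (ρ j)))
        (fun k => (Pi.single (c k) 1 : ι → ℂ)) q i := by
    rintro (j | k) i
    · have hsl : ∀ x, pderiv ℂ (Sum.inr i) (s (Sum.inl x)) = 0 := fun x => pderiv_X_of_ne (by simp)
      have hsr : ∀ i', pderiv ℂ (Sum.inr i) (s (Sum.inr i')) = if i' = i then 1 else 0 := by
        intro i'
        split_ifs with h
        · rw [h]
          exact pderiv_X_self
        · exact pderiv_X_of_ne (by simpa using h)
      simp only [G, Sum.elim_inl, map_sub, pderiv_subst hs, Fintype.sum_sum_type,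
        hsl, hsr]
      rw [pderiv_X_of_ne (by simp), map_zero, sub_zero]
      simp [constantCoeff_subst' hs]
    · simp only [G, Sum.elim_inr, map_sub]
      by_cases h : i = c k
      · subst h
        simp
      · simp [Ne.symm h, h]
  -- `G` expresses that ρ and the chosen coordinates take prescribed values. Composing with the
  -- inverse `B` of its Jacobian in the unknowns gives the identity linear part that
  -- `exists_implicit` requires.
  let F : ι → MvPowerSeries ((τ ⊕ (δ ⊕ κ)) ⊕ ι) ℂ := fun i => ∑ q, C (B i q) * G q
  have hF : NoConst F := fun i => by simp [F, hG _]
  have hF' : ∀ i j, constantCoeff (pderiv ℂ (Sum.inr j) (F i)) = if i = j then 1 else 0 := by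
    intro i j
    simp only [F, map_sum, Derivation.leibniz, smul_eq_mul, pderiv_C, mul_zero, add_zero, map_mul,
      constantCoeff_C, hG']
    exact hBA i j
  have hGF : ∀ q, G q = ∑ i, C (Sum.elim (fun (j : δ) (i : ι) =>
      constantCoeff (pderiv ℂ (Sum.inr i) (ρ j))) (fun k => (Pi.single (c k) 1 : ι → ℂ)) q i) *
        F i := by
    intro q
    simp only [F, Finset.mul_sum, ← mul_assoc, ← map_mul]
    rw [Finset.sum_comm]
    simp only [← Finset.sum_mul, ← map_sum, hAB]
    simp
  obtain ⟨Θ, hΘ, hΘF, hΘc⟩ := exists_implicit hF hF'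
  have hXΘ := (noConst_X (σ := τ ⊕ (δ ⊕ κ))).sumElim hΘ
  have hΘG : ∀ q, subst (Sum.elim X Θ) (G q) = 0 := by
    intro q
    rw [hGF, subst_sum' hXΘ]
    refine Finset.sum_eq_zero fun i _ => ?_
    rw [subst_mul hXΘ.hasSubst, hΘF, mul_zero]
  refine ⟨κ, hκ, hdec, c, Θ, hΘ, ?_, ?_, ?_, ?_⟩
  · intro hc
    refine hΘc fun i => Convergent.sum fun q _ => (convergent_C _).mul (Convergent.sub ?_
      (convergent_X _))
    rcases q with j | k
    · exact (hc j).subst hs (by rintro (x | x) <;> exact convergent_X _)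
    · exact convergent_X _
  · intro j
    have := hΘG (Sum.inl j)
    simp only [G, Sum.elim_inl] at this
    rw [subst_sub hXΘ.hasSubst, subst_X' hXΘ, sub_eq_zero, subst_subst hs hXΘ] at this
    simp only [Sum.elim_inl] at this
    rw [← this]
    congr 1
    funext x
    rcases x with x | x <;> simp [s, subst_X' hXΘ]
  · intro k
    have := hΘG (Sum.inr k)
    simp only [G, Sum.elim_inr] at this
    rw [subst_sub hXΘ.hasSubst, subst_X' hXΘ, subst_X' hXΘ, sub_eq_zero] at this
    simpa using this
  · have ha : NoConst (Sum.elim (fun x => X (Sum.inl x))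
        (Sum.elim ρ (fun k => X (Sum.inr (c k)))) : τ ⊕ (δ ⊕ κ) → MvPowerSeries (τ ⊕ ι) ℂ) := by
      rintro (x | j | k)
      · exact constantCoeff_X _
      · exact hρ j
      · exact constantCoeff_X _
    set a := (Sum.elim (fun x => X (Sum.inl x))
        (Sum.elim ρ (fun k => X (Sum.inr (c k)))) : τ ⊕ (δ ⊕ κ) → MvPowerSeries (τ ⊕ ι) ℂ) with hadef
    have hXi : NoConst (fun i : ι => (X (Sum.inr i) : MvPowerSeries (τ ⊕ ι) ℂ)) :=
      fun i => constantCoeff_X _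
    -- Both Θ evaluated at (x, ρ, coordinates) and the original variables solve the same system;
    -- uniqueness modulo the zero ideal identifies them.
    have key := implicit_unique hF' ha (hΘ.subst ha) hXi ⊥ (fun i => ?_)
    · intro i
      exact sub_eq_zero.1 (by simpa using key i)
    · have h1 : subst (Sum.elim a fun i => subst a (Θ i)) (F i) = 0 := by
        have h2 : (Sum.elim a fun i => subst a (Θ i)) =
            fun x => subst a (Sum.elim X Θ x) := by
          funext x
          rcases x with x | x
          · simp [subst_X' ha]
          · simp
        rw [h2, ← subst_subst hXΘ ha, hΘF, subst_zero' ha]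
      have haX := ha.sumElim hXi
      have h3 : subst (Sum.elim a fun i => X (Sum.inr i)) (F i) = 0 := by
        simp only [F]
        rw [subst_sum' haX]
        refine Finset.sum_eq_zero fun q _ => ?_
        rw [subst_mul haX.hasSubst]
        convert mul_zero _
        simp only [G]
        rw [subst_sub haX.hasSubst, subst_X' haX, sub_eq_zero]
        rcases q with j | k
        · simp only [Sum.elim_inl]
          rw [subst_subst hs haX]
          change _ = ρ j
          conv_rhs => rw [← subst_X_self (ρ j)]
          congr 1
          funext x
          rcases x with x | x <;> exact subst_X' haX _
        · exact subst_X' haX _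
      rw [h1, h3, sub_zero]
      exact Submodule.zero_mem _

/-! ### Series convergent up to any weighted order -/

/-- `f` agrees with a convergent series up to any weighted order. -/
def JetConv (w : σ → ℕ) (f : MvPowerSeries σ ℂ) : Prop :=
  ∀ k, ∃ g, Convergent g ∧ f - g ∈ ordIdeal w k

theorem Convergent.jetConv {f : MvPowerSeries σ ℂ} (hf : Convergent f) (w : σ → ℕ) :
    JetConv w f := fun k => ⟨f, hf, by simp⟩

theorem JetConv.convergent {f : MvPowerSeries σ ℂ} (hf : JetConv (fun _ => 0) f) :
    Convergent f := by
  obtain ⟨g, hg, h⟩ := hf 1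
  have : f - g = 0 := by
    ext n
    exact mem_ordIdeal_iff.1 h n (by simp [Finsupp.weight_apply, Finsupp.sum])
  rwa [sub_eq_zero.1 this]

theorem JetConv.add {w : σ → ℕ} {f g : MvPowerSeries σ ℂ} (hf : JetConv w f) (hg : JetConv w g) :
    JetConv w (f + g) := fun k => by
  obtain ⟨f', hf', h⟩ := hf k
  obtain ⟨g', hg', h'⟩ := hg k
  exact ⟨f' + g', hf'.add hg', by rw [add_sub_add_comm]; exact Ideal.add_mem _ h h'⟩

theorem JetConv.C_mul {w : σ → ℕ} {f : MvPowerSeries σ ℂ} (a : ℂ) (hf : JetConv w f) :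
    JetConv w (C a * f) := fun k => by
  obtain ⟨f', hf', h⟩ := hf k
  exact ⟨C a * f', (convergent_C a).mul hf', by rw [← mul_sub]; exact Ideal.mul_mem_left _ _ h⟩

theorem JetConv.sum {w : σ → ℕ} {κ : Type*} {s : Finset κ} {f : κ → MvPowerSeries σ ℂ}
    (hf : ∀ k ∈ s, JetConv w (f k)) : JetConv w (∑ k ∈ s, f k) := by
  classical
  induction s using Finset.induction_on with
  | empty => simpa using convergent_zero.jetConv w
  | insert a s ha ih =>
    rw [Finset.sum_insert ha]
    exact (hf a (Finset.mem_insert_self _ _)).add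
      (ih fun k hk => hf k (Finset.mem_insert_of_mem hk))

theorem constantCoeff_eq_zero_of_mem_ordIdeal {w : σ → ℕ} {k : ℕ} {f : MvPowerSeries σ ℂ}
    (hf : f ∈ ordIdeal w (k + 1)) : constantCoeff f = 0 := by
  rw [← coeff_zero_eq_constantCoeff_apply]
  exact mem_ordIdeal_iff.1 hf 0 (by simp)

theorem constantCoeff_eq_of_sub_mem_ordIdeal {w : σ → ℕ} {k : ℕ} {f g : MvPowerSeries σ ℂ}
    (hf : f - g ∈ ordIdeal w (k + 1)) : constantCoeff g = constantCoeff f := by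
  have := constantCoeff_eq_zero_of_mem_ordIdeal hf
  rw [map_sub, sub_eq_zero] at this
  exact this.symm

theorem JetConv.subst [Finite σ] {w : σ → ℕ} {w' : τ → ℕ} {f : MvPowerSeries σ ℂ}
    (hf : JetConv w f) {g : σ → MvPowerSeries τ ℂ} (hg : NoConst g) (hgc : ∀ i, JetConv w' (g i))
    (hgw : ∀ i, g i ∈ ordIdeal w' (w i)) : JetConv w' (subst g f) := fun k => by
  obtain ⟨f', hf', h⟩ := hf k
  -- Order `k + 1` rather than `k`, so that even for `k = 0` the approximants have no constant term
  -- and may be substituted.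
  choose g' hg' h' using fun i => hgc i (k + 1)
  have hg0 : NoConst g' := fun i => by
    rw [constantCoeff_eq_of_sub_mem_ordIdeal (h' i), hg i]
  refine ⟨MvPowerSeries.subst g' f', hf'.subst hg0 hg', ?_⟩
  have h1 : MvPowerSeries.subst g f - MvPowerSeries.subst g f' ∈ ordIdeal w' k := by
    rw [← subst_sub hg.hasSubst]
    exact subst_mem_ordIdeal hg hgw h
  have h2 : MvPowerSeries.subst g f' - MvPowerSeries.subst g' f' ∈ ordIdeal w' k :=
    subst_sub_subst_mem _ f' hg hg0 fun i => ordIdeal_mono (Nat.le_succ k) (h' i)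
  have := Ideal.add_mem _ h1 h2
  rwa [sub_add_sub_cancel] at this

theorem Convergent.jetConv_subst [Finite σ] {w' : τ → ℕ} {f : MvPowerSeries σ ℂ}
    (hf : Convergent f) {g : σ → MvPowerSeries τ ℂ} (hg : NoConst g)
    (hgc : ∀ i, JetConv w' (g i)) : JetConv w' (MvPowerSeries.subst g f) :=
  (hf.jetConv fun _ => 0).subst hg hgc fun _ => mem_ordIdeal_zero _

theorem coeff_eq_of_sub_mem_ordIdeal {w : σ → ℕ} {k : ℕ} {f g : MvPowerSeries σ ℂ}
    (hf : f - g ∈ ordIdeal w k) {n : σ →₀ ℕ} (hn : Finsupp.weight w n < k) :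
    coeff n f = coeff n g := by
  have := mem_ordIdeal_iff.1 hf n hn
  rwa [map_sub, sub_eq_zero] at this

/-- Formal solutions of a nondegenerate implicit system that converges up to any weighted order
converge up to any weighted order. -/
theorem jetConv_of_implicit [Fintype τ] [Fintype ι] [DecidableEq ι] {w : τ → ℕ}
    {F : ι → MvPowerSeries (τ ⊕ ι) ℂ}
    (hF' : ∀ i j, constantCoeff (pderiv ℂ (Sum.inr j) (F i)) = if i = j then 1 else 0)
    (hFc : ∀ i, JetConv (Sum.elim w fun _ => 0) (F i)) {h : ι → MvPowerSeries τ ℂ} (hh : NoConst h)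
    (hFh : ∀ i, subst (Sum.elim X h) (F i) = 0) (i : ι) : JetConv w (h i) := by
  intro k
  -- The unknowns have weight 0, so agreement at a positive order preserves both the constant terms
  -- and the coefficients linear in the unknowns.
  choose G hGc hG using fun i => hFc i (k + 1)
  have hX := (noConst_X (σ := τ)).sumElim hh
  have hF0 : NoConst F := fun i => by
    rw [← constantCoeff_subst' hX, hFh, map_zero]
  have hG0 : NoConst G := fun i => by
    rw [constantCoeff_eq_of_sub_mem_ordIdeal (hG i), hF0 i]
  have hG' : ∀ i j, constantCoeff (pderiv ℂ (Sum.inr j) (G i)) = if i = j then 1 else 0 := by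
    intro i j
    rw [← hF' i j, ← coeff_zero_eq_constantCoeff_apply, ← coeff_zero_eq_constantCoeff_apply,
      coeff_pderiv, coeff_pderiv, coeff_eq_of_sub_mem_ordIdeal (hG i)]
    rw [zero_add, Finsupp.weight_single]
    simp
  obtain ⟨h', hh', hGh', hc⟩ := exists_implicit hG0 hG'
  refine ⟨h' i, hc hGc i, ?_⟩
  -- The formal `h` solves the convergent system `G` modulo the order ideal, and `h'` solves it
  -- exactly; uniqueness modulo that ideal compares them.
  refine implicit_unique hG' noConst_X hh hh' _ (fun j => ?_) i
  rw [hGh', sub_zero]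
  have h1 : subst (Sum.elim X h) (F j - G j) ∈ ordIdeal w (k + 1) := by
    refine subst_mem_ordIdeal hX ?_ (hG j)
    rintro (x | x)
    · rw [mem_ordIdeal_iff]
      intro n hn
      simp only [Sum.elim_inl] at hn ⊢
      classical
      rw [coeff_X, if_neg]
      rintro rfl
      rw [Finsupp.weight_single] at hn
      simp at hn
    · exact mem_ordIdeal_zero _
  rw [subst_sub hX.hasSubst, hFh, zero_sub] at h1
  exact ordIdeal_mono (Nat.le_succ k) (neg_mem_iff.1 h1)

/-! ### Coefficients with respect to a block of variables -/

/-- The coefficient of `u^α` of a series in the variables `x` (left) and `u` (right). -/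
def slice (α : κ →₀ ℕ) (f : MvPowerSeries (σ ⊕ κ) ℂ) : MvPowerSeries σ ℂ :=
  fun m => coeff (m.sumElim α) f

theorem coeff_slice (α : κ →₀ ℕ) (f : MvPowerSeries (σ ⊕ κ) ℂ) (m : σ →₀ ℕ) :
    coeff m (slice α f) = coeff (m.sumElim α) f := rfl

theorem slice_sub (α : κ →₀ ℕ) (f g : MvPowerSeries (σ ⊕ κ) ℂ) :
    slice α (f - g) = slice α f - slice α g := by
  ext m
  simp [coeff_slice]

theorem slice_zero (α : κ →₀ ℕ) : slice α (0 : MvPowerSeries (σ ⊕ κ) ℂ) = 0 := by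
  ext m
  simp [coeff_slice]

theorem sumElim_eq_add (m : σ →₀ ℕ) (α : κ →₀ ℕ) :
    m.sumElim α = m.sumElim 0 + (0 : σ →₀ ℕ).sumElim α := by
  ext (x | x) <;> simp

theorem pderiv_slice (α : κ →₀ ℕ) (f : MvPowerSeries (σ ⊕ κ) ℂ) (i : σ) :
    pderiv ℂ i (slice α f) = slice α (pderiv ℂ (Sum.inl i) f) := by
  ext m
  rw [coeff_pderiv, coeff_slice, coeff_slice, coeff_pderiv]
  congr 2
  congr 1
  classical
  ext (x | x) <;> simp [Finsupp.single_apply]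

theorem mon_sumElim [Finite σ] [Finite κ] (r : σ ⊕ κ → ℝ≥0∞) (m : σ →₀ ℕ) (α : κ →₀ ℕ) :
    mon r (m.sumElim α) = mon (fun i => r (Sum.inl i)) m * mon (fun i => r (Sum.inr i)) α := by
  have := Fintype.ofFinite σ
  have := Fintype.ofFinite κ
  simp [mon, Finsupp.prod_fintype, Fintype.prod_sum_type]

theorem sumElim_left_injective (α : κ →₀ ℕ) :
    Function.Injective fun m : σ →₀ ℕ => m.sumElim α := by
  intro m m' h
  ext x
  simpa using DFunLike.congr_fun h (Sum.inl x)

theorem Convergent.slice [Finite σ] [Finite κ] {f : MvPowerSeries (σ ⊕ κ) ℂ} (hf : Convergent f)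
    (α : κ →₀ ℕ) : Convergent (slice α f) := by
  obtain ⟨ε, hε, hε', h⟩ := Convergent.exists_forall (υ := Unit) (fun _ => hf)
  refine convergent_iff.2 ⟨ε, hε, fun htop => h () ?_⟩
  have h1 : ε ^ α.degree * wnorm (fun _ => ε) (FormalCR.slice α f) ≤ wnorm (fun _ => ε) f := by
    rw [wnorm, ← ENNReal.tsum_mul_left]
    refine le_trans (le_of_eq (tsum_congr fun m => ?_))
      (ENNReal.tsum_comp_le_tsum_of_injective (sumElim_left_injective α)
        fun n => ‖coeff n f‖ₑ * mon (fun _ => ε) n)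
    rw [coeff_slice, mon_sumElim, mon_const _ α]
    ring
  rw [htop, ENNReal.mul_top (pow_ne_zero _ hε)] at h1
  exact top_le_iff.1 h1

theorem slice_mem_ordIdeal [Finite σ] [Finite κ] {w : σ ⊕ κ → ℕ} {k : ℕ}
    {f : MvPowerSeries (σ ⊕ κ) ℂ} (α : κ →₀ ℕ)
    (hf : f ∈ ordIdeal w (k + Finsupp.weight (fun i => w (Sum.inr i)) α)) :
    slice α f ∈ ordIdeal (fun i => w (Sum.inl i)) k := by
  have := Fintype.ofFinite σ
  have := Fintype.ofFinite κ
  rw [mem_ordIdeal_iff] at *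
  intro n hn
  rw [coeff_slice]
  refine hf _ ?_
  rw [Finsupp.weight_eq_sum, Fintype.sum_sum_type]
  simp only [Finsupp.sumElim_inl, Finsupp.sumElim_inr]
  rw [Finsupp.weight_eq_sum] at hn ⊢
  rw [Finsupp.weight_eq_sum] at *
  omega

/-- Extracting the coefficient of u^α costs at most the weight of α, which is harmless because
approximation is available at every order. -/
theorem JetConv.slice [Finite σ] [Finite κ] {w : σ ⊕ κ → ℕ} {f : MvPowerSeries (σ ⊕ κ) ℂ}
    (hf : JetConv w f) (α : κ →₀ ℕ) : JetConv (fun i => w (Sum.inl i)) (slice α f) := fun k => by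
  obtain ⟨g, hg, h⟩ := hf (k + Finsupp.weight (fun i => w (Sum.inr i)) α)
  exact ⟨FormalCR.slice α g, hg.slice α, by rw [← slice_sub]; exact slice_mem_ordIdeal α h⟩

theorem coeff_rename_inl (p : MvPowerSeries σ ℂ) (m : σ →₀ ℕ) (γ : κ →₀ ℕ)
    [Finite σ] [DecidableEq κ] :
    coeff (m.sumElim γ) (rename Sum.inl p : MvPowerSeries (σ ⊕ κ) ℂ) =
      if γ = 0 then coeff m p else 0 := by
  split_ifs with h
  · subst h
    have : m.sumElim (0 : κ →₀ ℕ) = Finsupp.embDomain Function.Embedding.inl m := by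
      ext (x | x)
      · exact (Finsupp.embDomain_apply_self Function.Embedding.inl m x).symm
      · rw [Finsupp.embDomain_of_notMem_range]
        · rfl
        · simp
    rw [this]
    exact coeff_embDomain_rename Function.Embedding.inl p m
  · refine coeff_rename_eq_zero _ _ ?_
    rintro ⟨n, hn⟩
    apply h
    ext x
    have := DFunLike.congr_fun hn (Sum.inr x)
    rw [Finsupp.mapDomain_of_notMem_range _ _ (by simp)] at this
    simpa using this.symm

/-- A substitution that leaves the block u alone preserves the u-exponent of every monomial. This is
what allows an identity depending on u to be split into equations free of u. -/
theorem slice_subst [Finite σ] [Finite κ] [Finite υ] {g : σ → MvPowerSeries υ ℂ} (hg : NoConst g)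
    (α : κ →₀ ℕ) (f : MvPowerSeries (σ ⊕ κ) ℂ) :
    slice α (subst (Sum.elim (fun i => rename Sum.inl (g i)) (fun k => X (Sum.inr k)) :
      σ ⊕ κ → MvPowerSeries (υ ⊕ κ) ℂ) f) = subst g (slice α f) := by
  classical
  have := Fintype.ofFinite σ
  have := Fintype.ofFinite κ
  have := Fintype.ofFinite υ
  set G := (Sum.elim (fun i => rename Sum.inl (g i)) (fun k => X (Sum.inr k)) :
      σ ⊕ κ → MvPowerSeries (υ ⊕ κ) ℂ) with hGdef
  have hG : NoConst G := by
    rintro (i | k)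
    · simp [hGdef, hg i]
    · simp [hGdef]
  have hprod : ∀ d : σ ⊕ κ →₀ ℕ, d.prod (fun s e => G s ^ e) =
      rename Sum.inl ((d.comapDomain Sum.inl Sum.inl_injective.injOn).prod fun s e => g s ^ e) *
        monomial ((0 : υ →₀ ℕ).sumElim (d.comapDomain Sum.inr Sum.inr_injective.injOn)) 1 := by
    intro d
    rw [Finsupp.prod_fintype _ _ (fun _ => pow_zero _), Fintype.prod_sum_type, monomial_one_eq,
      Finsupp.prod_fintype _ _ (fun _ => pow_zero _),
      Finsupp.prod_fintype _ _ (fun _ => pow_zero _), map_prod]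
    congr 1
    · simp [hGdef]
    · rw [Fintype.prod_sum_type]
      simp [hGdef]
  have hcoeff : ∀ (d : σ ⊕ κ →₀ ℕ) (m : υ →₀ ℕ), coeff (m.sumElim α) (d.prod fun s e => G s ^ e) =
      if d.comapDomain Sum.inr Sum.inr_injective.injOn = α then
        coeff m ((d.comapDomain Sum.inl Sum.inl_injective.injOn).prod fun s e => g s ^ e) else 0 := by
    intro d m
    rw [hprod, coeff_mul_monomial]
    set β := d.comapDomain Sum.inr Sum.inr_injective.injOn
    have hle : (0 : υ →₀ ℕ).sumElim β ≤ m.sumElim α ↔ β ≤ α := by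
      simp [Finsupp.le_def]
    by_cases h : β ≤ α
    · rw [if_pos (hle.2 h)]
      have : m.sumElim α - (0 : υ →₀ ℕ).sumElim β = m.sumElim (α - β) := by
        ext (x | x) <;> simp
      rw [this, coeff_rename_inl, mul_one]
      have : α - β = 0 ↔ β = α := by
        rw [tsub_eq_zero_iff_le]
        exact ⟨fun h' => le_antisymm h h', fun h' => h'.ge⟩
      simp [this]
    · rw [if_neg (mt hle.1 h), if_neg (fun h' => h h'.le)]
  ext m
  rw [coeff_slice, coeff_subst hG.hasSubst, coeff_subst hg.hasSubst]
  have hinj := sumElim_left_injective (σ := σ) α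
  calc ∑ᶠ d, coeff d f • coeff (m.sumElim α) (d.prod fun s e => G s ^ e)
      = ∑ᶠ d ∈ Set.range (fun d : σ →₀ ℕ => d.sumElim α),
          coeff d f • coeff (m.sumElim α) (d.prod fun s e => G s ^ e) := by
        rw [finsum_mem_def, Set.indicator_eq_self.2]
        intro d hd
        rw [Function.mem_support, hcoeff] at hd
        have h1 : d.comapDomain Sum.inr Sum.inr_injective.injOn = α := by
          by_contra h
          exact hd (by rw [if_neg h, smul_zero])
        refine ⟨d.comapDomain Sum.inl Sum.inl_injective.injOn, ?_⟩
        rw [← h1]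
        ext (x | x) <;> simp
    _ = ∑ᶠ d : σ →₀ ℕ, coeff (d.sumElim α) f •
          coeff (m.sumElim α) ((d.sumElim α).prod fun s e => G s ^ e) := finsum_mem_range hinj
    _ = _ := by
        refine finsum_congr fun d => ?_
        have h1 : (d.sumElim α).comapDomain Sum.inr Sum.inr_injective.injOn = α := by
          ext x
          simp
        have h2 : (d.sumElim α).comapDomain Sum.inl Sum.inl_injective.injOn = d := by
          ext x
          simp
        rw [hcoeff, h1, h2, if_pos rfl, coeff_slice]

/-- The case of `slice_subst` in which the first block is set to zero, with `Empty` as the remaining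
block. -/
theorem constantCoeff_slice [Finite σ] [Finite κ] (α : κ →₀ ℕ) (f : MvPowerSeries (σ ⊕ κ) ℂ) :
    constantCoeff (slice α f) =
      coeff α (subst (Sum.elim 0 X : σ ⊕ κ → MvPowerSeries κ ℂ) f) := by
  classical
  have h0 : NoConst (0 : σ → MvPowerSeries Empty ℂ) := noConst_zero
  have h1 := congrArg constantCoeff (slice_subst h0 α f)
  rw [constantCoeff_subst' h0] at h1
  rw [← h1, ← coeff_zero_eq_constantCoeff_apply, coeff_slice]
  have hE : NoConst (Sum.elim 0 X : σ ⊕ κ → MvPowerSeries κ ℂ) := noConst_zero.sumElim noConst_X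
  have h2 : (Sum.elim (fun i => rename Sum.inl ((0 : σ → MvPowerSeries Empty ℂ) i))
      (fun k => X (Sum.inr k)) : σ ⊕ κ → MvPowerSeries (Empty ⊕ κ) ℂ) =
      fun x => subst (fun k => X (Sum.inr k)) ((Sum.elim 0 X : σ ⊕ κ → MvPowerSeries κ ℂ) x) := by
    have hr : NoConst (fun k : κ => (X (Sum.inr k) : MvPowerSeries (Empty ⊕ κ) ℂ)) :=
      fun k => constantCoeff_X _
    funext x
    rcases x with x | x
    · simp [subst_zero' hr]
    · simp [subst_X' hr]
  have hr : NoConst (fun k : κ => (X (Sum.inr k) : MvPowerSeries (Empty ⊕ κ) ℂ)) :=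
    fun k => constantCoeff_X _
  rw [h2, ← subst_subst hE hr]
  have h3 : ∀ p : MvPowerSeries κ ℂ, subst (fun k : κ => (X (Sum.inr k) :
      MvPowerSeries (Empty ⊕ κ) ℂ)) p = rename Sum.inr p := fun p => (rename_eq_subst _ p).symm
  rw [h3]
  have h4 : (0 : Empty →₀ ℕ).sumElim α = Finsupp.embDomain Function.Embedding.inr α := by
    ext (x | x)
    · exact x.elim
    · exact (Finsupp.embDomain_apply_self Function.Embedding.inr α x).symm
  rw [h4]
  exact coeff_embDomain_rename Function.Embedding.inr _ α

/-! ### The reflection principle -/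

/-- `Θ` straightens the system `ρ` with respect to the variables `ζ`:
`ζ = Θ(Z, r, t)` if and only if `ρ(Z, ζ) = r` and the coordinates `ζ_c` of `ζ` are `t`. -/
structure IsStraight {N d : ℕ} (ρ : Fin d → Ser N) (c : κ → Fin N)
    (Θ : Fin N → MvPowerSeries (Fin N ⊕ (Fin d ⊕ κ)) ℂ) : Prop where
  noConst : NoConst Θ
  convergent : ∀ i, Convergent (Θ i)
  noConst_def : NoConst ρ
  convergent_def : ∀ j, Convergent (ρ j)
  eq_def : ∀ j, subst (Sum.elim (fun x => X (Sum.inl x)) Θ) (ρ j) = X (Sum.inr (Sum.inl j))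
  eq_coord : ∀ k, Θ (c k) = X (Sum.inr (Sum.inr k))
  inv : ∀ i, subst (Sum.elim (fun x => X (Sum.inl x))
    (Sum.elim ρ (fun k => X (Sum.inr (c k))))) (Θ i) = X (Sum.inr i)

/-- `v(x) + s`, as a series in `(x, s)`. -/
def shift [Finite τ] (v : ι → MvPowerSeries τ ℂ) (i : ι) : MvPowerSeries (τ ⊕ ι) ℂ :=
  rename Sum.inl (v i) + X (Sum.inr i)

/-- The weight that counts the second block of variables. -/
def jetWeight (τ ι : Type) : τ ⊕ ι → ℕ := Sum.elim (fun _ => 0) fun _ => 1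

theorem rename_eq_subst' [Finite σ] (e : σ → τ) (p : MvPowerSeries σ ℂ) :
    rename e p = subst (fun x => X (e x)) p := rename_eq_subst e p

theorem noConst_X_comp (e : σ → τ) : NoConst (fun x => (X (e x) : MvPowerSeries τ ℂ)) :=
  fun _ => constantCoeff_X _

theorem X_mem_ordIdeal (w : σ → ℕ) (i : σ) : (X i : MvPowerSeries σ ℂ) ∈ ordIdeal w (w i) := by
  classical
  rw [mem_ordIdeal_iff]
  intro n hn
  rw [coeff_X, if_neg]
  rintro rfl
  rw [Finsupp.weight_single] at hn
  simp at hn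

theorem Convergent.rename [Finite σ] {f : MvPowerSeries σ ℂ} (hf : Convergent f) (e : σ → τ) :
    Convergent (rename e f) := by
  rw [rename_eq_subst']
  exact hf.subst (noConst_X_comp e) fun _ => convergent_X _

theorem NoConst.rename [Finite τ] {g : σ → MvPowerSeries τ ℂ} (hg : NoConst g) (e : τ → υ) :
    NoConst (fun i => rename e (g i)) := fun i => by
  rw [constantCoeff_rename]
  exact hg i

theorem subst_rename [Finite σ] [Finite τ] (e : σ → τ) {g : τ → MvPowerSeries υ ℂ} (hg : NoConst g)
    (f : MvPowerSeries σ ℂ) : subst g (rename e f) = subst (fun x => g (e x)) f := by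
  rw [rename_eq_subst', subst_subst (noConst_X_comp e) hg]
  simp only [subst_X' hg]

theorem rename_subst [Finite σ] [Finite τ] {g : σ → MvPowerSeries τ ℂ} (hg : NoConst g) (e : τ → υ)
    (f : MvPowerSeries σ ℂ) : rename e (subst g f) = subst (fun i => rename e (g i)) f := by
  rw [rename_eq_subst', subst_subst hg (noConst_X_comp e)]
  simp only [rename_eq_subst']

theorem noConst_shift [Finite τ] {v : ι → MvPowerSeries τ ℂ} (hv : NoConst v) :
    NoConst (shift v) := fun i => by simp [shift, hv i]

theorem subst_mem_zero_of_mem_defIdeal {N d : ℕ} {ρ : Fin d → Ser N}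
    {q : Fin N ⊕ Fin N → MvPowerSeries τ ℂ} (hq : NoConst q) (h : ∀ j, subst q (ρ j) = 0)
    {f : Ser N} (hf : f ∈ defIdeal ρ) : subst q f = 0 := by
  have : defIdeal ρ ≤ RingHom.ker (substAlgHom (R := ℂ) hq.hasSubst) := by
    rw [defIdeal, Ideal.span_le]
    rintro _ ⟨j, rfl⟩
    rw [SetLike.mem_coe, RingHom.mem_ker, substAlgHom_apply, h]
  have h2 := this hf
  rwa [RingHom.mem_ker, substAlgHom_apply] at h2

/-- The restriction of `(G, ρ')` to the Segre variety of the origin. -/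
def segreJet {N d N' d' : ℕ} (Θ : Fin N → MvPowerSeries (Fin N ⊕ (Fin d ⊕ κ)) ℂ)
    (ρ' : Fin d' → Ser N') (G : Fin N' → MvPowerSeries (Fin N) ℂ) (q : Fin d' × (κ →₀ ℕ))
    (k : Fin N') : ℂ :=
  coeff q.2 (subst (Sum.elim 0 (fun k => subst (fun i => subst (Sum.elim 0 (Sum.elim 0 X)) (Θ i))
    (G k)) : Fin N' ⊕ Fin N' → MvPowerSeries κ ℂ) (pderiv ℂ (Sum.inl k) (ρ' q.1)))

-- Over the base point V_Z(x) + s the fibre of the complexified manifold is parametrized by ψ(x, s,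
-- u), with free coordinates V_{ζ,c} + u. The identity ρ'(F(V_Z + s), G(ψ)) = 0 is expanded in u:
-- each coefficient is an equation for F(V_Z + s) alone, with convergent jets, and with linear part
-- at 0 given by `segreJet`. The spanning hypothesis selects combinations whose linear part is the
-- identity, and `jetConv_of_implicit` applies.
set_option maxHeartbeats 1000000 in
theorem jetConv_reflection {N d N' d' : ℕ} [Fintype κ] {ρ : Fin d → Ser N} {c : κ → Fin N}
    {Θ : Fin N → MvPowerSeries (Fin N ⊕ (Fin d ⊕ κ)) ℂ} (hΘ : IsStraight ρ c Θ)
    {ρ' : Fin d' → Ser N'} (hρ'c : ∀ j, Convergent (ρ' j))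
    {F G : Fin N' → MvPowerSeries (Fin N) ℂ} (hF : NoConst F) (hG : NoConst G)
    (hmap : ∀ j, subst (Sum.elim (fun k => rename Sum.inl (F k)) (fun k => rename Sum.inr (G k)))
      (ρ' j) ∈ defIdeal ρ)
    (hspan : Submodule.span ℂ (Set.range (segreJet Θ ρ' G)) = ⊤)
    [Fintype τ] {V : Fin N ⊕ Fin N → MvPowerSeries τ ℂ} (hV : NoConst V)
    (hVc : ∀ i, Convergent (V i)) (hVρ : ∀ j, subst V (ρ j) = 0)
    (hGV : ∀ k, JetConv (jetWeight τ (Fin N)) (subst (shift fun i => V (Sum.inr i)) (G k)))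
    (k : Fin N') : JetConv (jetWeight τ (Fin N)) (subst (shift fun i => V (Sum.inl i)) (F k)) := by
  have hVZ : NoConst (fun i => V (Sum.inl i)) := hV.comp _
  have hVζ : NoConst (fun i => V (Sum.inr i)) := hV.comp _
  have hsZ := noConst_shift hVZ
  have hsζ := noConst_shift hVζ
  -- the point `ψ` with `(V_Z + s, ψ)` on the complexified manifold
  let a : Fin N ⊕ (Fin d ⊕ κ) → MvPowerSeries ((τ ⊕ Fin N) ⊕ κ) ℂ :=
    Sum.elim (fun i => rename Sum.inl (shift (fun i => V (Sum.inl i)) i))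
      (Sum.elim 0 (fun k => rename (fun x => Sum.inl (Sum.inl x)) (V (Sum.inr (c k))) +
        X (Sum.inr k)))
  have ha : NoConst a := by
    rintro (i | j | k)
    · exact hsZ.rename _ i
    · exact map_zero _
    · simp [a, hV _]
  let ψ : Fin N → MvPowerSeries ((τ ⊕ Fin N) ⊕ κ) ℂ := fun i => subst a (Θ i)
  have hψ : NoConst ψ := hΘ.noConst.subst ha
  let gψ : Fin N' → MvPowerSeries ((τ ⊕ Fin N) ⊕ κ) ℂ := fun k => subst ψ (G k)
  have hgψ : NoConst gψ := hG.subst hψ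
  -- The weight counts s and u together, because ψ leaves V_ζ as soon as either of them is nonzero.
  let W : (τ ⊕ Fin N) ⊕ κ → ℕ := Sum.elim (jetWeight τ (Fin N)) fun _ => 1
  let b : τ ⊕ Fin N → MvPowerSeries ((τ ⊕ Fin N) ⊕ κ) ℂ :=
    Sum.elim (fun x => X (Sum.inl (Sum.inl x)))
      (fun i => ψ i - rename (fun x => Sum.inl (Sum.inl x)) (V (Sum.inr i)))
  have hb : NoConst b := by
    rintro (x | i)
    · exact constantCoeff_X _
    · simp [b, hψ i, hV _]
  have hac : ∀ q, Convergent (a q) := by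
    rintro (i | j | k)
    · exact (((hVc _).rename _).add (convergent_X _)).rename _
    · exact convergent_zero
    · exact ((hVc _).rename _).add (convergent_X _)
  have hψc : ∀ i, Convergent (ψ i) := fun i => (hΘ.convergent i).subst ha hac
  have hgψ_eq : ∀ k, gψ k = subst b (subst (shift fun i => V (Sum.inr i)) (G k)) := by
    intro k
    rw [subst_subst hsζ hb]
    change subst ψ (G k) = _
    congr 1
    funext i
    simp only [shift]
    rw [subst_add hb.hasSubst, subst_rename _ hb, subst_X' hb]
    simp only [b, Sum.elim_inl, Sum.elim_inr]
    rw [rename_eq_subst']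
    ring
  have hgψ_jet : ∀ k, JetConv W (gψ k) := by
    intro k
    rw [hgψ_eq]
    refine (hGV k).subst hb ?_ ?_
    · rintro (x | i)
      · exact (convergent_X _).jetConv _
      · exact ((hψc i).sub ((hVc _).rename _)).jetConv _
    · rintro (x | i)
      · exact mem_ordIdeal_zero _
      -- At s = u = 0 the point ψ is V_ζ, since V lies on the manifold and a point is determined by
      -- Z, ρ and its free coordinates. Hence ψ − V_ζ has positive weight, and the jets of G along
      -- V_ζ give jets of G∘ψ in (s, u).
      · refine mem_ordIdeal_one_of_subst_eq_zero
          (g := Sum.elim (Sum.elim (fun x => X (Sum.inl (Sum.inl x))) 0) 0) ?_ ?_ ?_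
        · rintro ((x | x) | x) hx <;> simp_all [W, jetWeight]
        · rintro ((x | x) | x) hx <;> simp_all [W, jetWeight]
        · set z : (τ ⊕ Fin N) ⊕ κ → MvPowerSeries ((τ ⊕ Fin N) ⊕ κ) ℂ :=
            Sum.elim (Sum.elim (fun x => X (Sum.inl (Sum.inl x))) 0) 0 with hzdef
          have hz : NoConst z := ((noConst_X_comp _).sumElim noConst_zero).sumElim noConst_zero
          have hinv := congrArg (fun p => rename (fun x => (Sum.inl (Sum.inl x) :
            (τ ⊕ Fin N) ⊕ κ)) (subst V p)) (hΘ.inv i)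
          have hin : NoConst (Sum.elim (fun x => X (Sum.inl x))
              (Sum.elim ρ (fun k => X (Sum.inr (c k)))) : Fin N ⊕ (Fin d ⊕ κ) → Ser N) := by
            rintro (x | j | k)
            · exact constantCoeff_X _
            · exact hΘ.noConst_def j
            · exact constantCoeff_X _
          rw [subst_subst hin hV, rename_subst (hin.subst hV), subst_X' hV] at hinv
          simp only [b, Sum.elim_inr]
          rw [subst_sub hz.hasSubst, subst_subst ha hz, sub_eq_zero, subst_rename _ hz]
          have h2 : subst (fun x => z (Sum.inl (Sum.inl x))) (V (Sum.inr i)) =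
              rename (fun x => Sum.inl (Sum.inl x)) (V (Sum.inr i)) := by
            rw [rename_eq_subst']
            rfl
          rw [h2, ← hinv]
          congr 1
          funext q
          rcases q with i | j | k
          · simp only [a, Sum.elim_inl, shift]
            rw [subst_rename _ hz, subst_add (hz.comp _).hasSubst, subst_rename _ (hz.comp _),
              subst_X' (hz.comp _), subst_X' hV, rename_eq_subst']
            simp [z]
          · simp only [a, Sum.elim_inl, Sum.elim_inr]
            rw [hVρ, map_zero]
            exact subst_zero' hz
          · simp only [a, Sum.elim_inr]
            rw [subst_add hz.hasSubst, subst_rename _ hz, subst_X' hz, subst_X' hV,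
              rename_eq_subst']
            simp [z]
  -- the equations for the unknown `h`
  let e : (τ ⊕ Fin N) ⊕ κ → (((τ ⊕ Fin N) ⊕ Fin N') ⊕ κ) :=
    Sum.elim (fun x => Sum.inl (Sum.inl x)) (fun k => Sum.inr k)
  let s : Fin N' ⊕ Fin N' → MvPowerSeries (((τ ⊕ Fin N) ⊕ Fin N') ⊕ κ) ℂ :=
    Sum.elim (fun k => X (Sum.inl (Sum.inr k))) (fun k => rename e (gψ k))
  have hs : NoConst s := (noConst_X_comp _).sumElim (hgψ.rename e)
  let R : Fin d' → MvPowerSeries (((τ ⊕ Fin N) ⊕ Fin N') ⊕ κ) ℂ := fun j => subst s (ρ' j)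
  -- The unknowns receive weight 0, as `jetConv_of_implicit` demands.
  let W' : ((τ ⊕ Fin N) ⊕ Fin N') ⊕ κ → ℕ :=
    Sum.elim (Sum.elim (jetWeight τ (Fin N)) fun _ => 0) fun _ => 1
  have hWe : ∀ x, W' (e x) = W x := by rintro (x | x) <;> rfl
  have hR : ∀ j, JetConv W' (R j) := by
    intro j
    refine (hρ'c j).jetConv_subst hs ?_
    rintro (k | k)
    · exact (convergent_X _).jetConv _
    · simp only [s, Sum.elim_inr]
      rw [rename_eq_subst']
      refine (hgψ_jet k).subst (noConst_X_comp e) (fun _ => (convergent_X _).jetConv _)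
        fun x => ?_
      rw [← hWe]
      exact X_mem_ordIdeal _ _
  let h : Fin N' → MvPowerSeries (τ ⊕ Fin N) ℂ :=
    fun k => subst (shift fun i => V (Sum.inl i)) (F k)
  have hh : NoConst h := hF.subst hsZ
  have hXh := (noConst_X (σ := τ ⊕ Fin N)).sumElim hh
  -- Inserting the true value of the unknown gives ρ'(F, G) at the point (V_Z + s, ψ), where ρ
  -- vanishes because ψ was built with r = 0. All u-coefficients then vanish.
  have hRh : ∀ j α, subst (Sum.elim X h) (slice α (R j)) = 0 := by
    intro j α
    rw [← slice_subst hXh]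
    convert slice_zero α
    have hy : NoConst (Sum.elim (fun i => rename Sum.inl ((Sum.elim X h) i))
        (fun k => X (Sum.inr k)) : ((τ ⊕ Fin N) ⊕ Fin N') ⊕ κ →
          MvPowerSeries ((τ ⊕ Fin N) ⊕ κ) ℂ) := (hXh.rename _).sumElim (noConst_X_comp _)
    set y := (Sum.elim (fun i => rename Sum.inl ((Sum.elim X h) i))
        (fun k => X (Sum.inr k)) : ((τ ⊕ Fin N) ⊕ Fin N') ⊕ κ →
          MvPowerSeries ((τ ⊕ Fin N) ⊕ κ) ℂ) with hydef
    have hq : NoConst (Sum.elim (fun i => rename Sum.inl (shift (fun i => V (Sum.inl i)) i)) ψ :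
        Fin N ⊕ Fin N → MvPowerSeries ((τ ⊕ Fin N) ⊕ κ) ℂ) := (hsZ.rename _).sumElim hψ
    have hqρ : ∀ j, subst (Sum.elim (fun i => rename Sum.inl (shift (fun i => V (Sum.inl i)) i)) ψ :
        Fin N ⊕ Fin N → MvPowerSeries ((τ ⊕ Fin N) ⊕ κ) ℂ) (ρ j) = 0 := by
      intro j
      have h1 := congrArg (subst a) (hΘ.eq_def j)
      rw [subst_subst ((noConst_X_comp _).sumElim hΘ.noConst) ha, subst_X' ha] at h1
      have h2 : a (Sum.inr (Sum.inl j)) = 0 := rfl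
      rw [h2] at h1
      rw [← h1]
      congr 1
      funext q
      rcases q with i | i
      · simp only [Sum.elim_inl]
        rw [subst_X' ha]
        rfl
      · rfl
    have h0 := subst_mem_zero_of_mem_defIdeal hq hqρ (hmap j)
    rw [subst_subst ((hF.rename _).sumElim (hG.rename _)) hq] at h0
    rw [subst_subst hs hy, ← h0]
    congr 1
    funext q
    rcases q with i | i
    · simp only [s, Sum.elim_inl]
      rw [subst_X' hy, subst_rename _ hq]
      simp only [hydef, Sum.elim_inl, Sum.elim_inr, h]
      rw [rename_subst hsZ]
    · simp only [s, Sum.elim_inr]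
      rw [subst_rename _ hy, subst_rename _ hq]
      simp only [Sum.elim_inr]
      have h3 : (fun x => y (e x)) = X := by
        funext x
        rcases x with x | x
        · simp [hydef, e]
        · simp [hydef, e]
      rw [h3, subst_X_self]
  -- At x = s = 0 and unknown 0, the point ψ runs over the Segre variety of the origin as u varies.
  have hRd : ∀ j α k, constantCoeff (pderiv ℂ (Sum.inr k) (slice α (R j))) =
      segreJet Θ ρ' G (j, α) k := by
    intro j α k
    classical
    have hz : NoConst (Sum.elim 0 X :
        ((τ ⊕ Fin N) ⊕ Fin N') ⊕ κ → MvPowerSeries κ ℂ) := noConst_zero.sumElim noConst_X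
    rw [pderiv_slice, constantCoeff_slice]
    have h1 : pderiv ℂ (Sum.inl (Sum.inr k)) (R j) = subst s (pderiv ℂ (Sum.inl k) (ρ' j)) := by
      rw [pderiv_subst hs, Finset.sum_eq_single (Sum.inl k)]
      · simp [s, pderiv_X_self]
      · rintro (l | l) _ hl
        · simp only [s, Sum.elim_inl]
          rw [pderiv_X_of_ne (by simpa using hl), mul_zero]
        · simp only [s, Sum.elim_inr]
          rw [rename_eq_subst', pderiv_subst (noConst_X_comp e), Finset.sum_eq_zero, mul_zero]
          rintro (x | x) _
          · rw [pderiv_X_of_ne (by simp [e]), mul_zero]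
          · rw [pderiv_X_of_ne (by simp [e]), mul_zero]
      · simp
    rw [h1, subst_subst hs hz, segreJet]
    congr 2
    funext q
    rcases q with l | l
    · simp only [s, Sum.elim_inl]
      rw [subst_X' hz]
      rfl
    · simp only [s, Sum.elim_inr]
      rw [subst_rename _ hz, subst_subst hψ (hz.comp e)]
      congr 1
      funext i
      rw [subst_subst ha (hz.comp e)]
      congr 1
      funext q
      rcases q with x | x | x
      · simp only [a, Sum.elim_inl, shift]
        rw [subst_rename _ (hz.comp e), subst_add ((hz.comp e).comp _).hasSubst,
          subst_rename _ ((hz.comp e).comp _), subst_X' ((hz.comp e).comp _)]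
        simp only [e, Sum.elim_inl, Pi.zero_apply, add_zero]
        rw [show (fun _ : τ => (0 : MvPowerSeries κ ℂ)) = 0 from rfl,
          subst_zero_of_constantCoeff_zero (hV _)]
      · simp only [a, Sum.elim_inl, Sum.elim_inr]
        exact subst_zero' (hz.comp e)
      · simp only [a, Sum.elim_inr]
        rw [subst_add (hz.comp e).hasSubst, subst_rename _ (hz.comp e), subst_X' (hz.comp e)]
        simp only [e, Sum.elim_inl, Pi.zero_apply, Sum.elim_inr]
        rw [show (fun _ : τ => (0 : MvPowerSeries κ ℂ)) = 0 from rfl,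
          subst_zero_of_constantCoeff_zero (hV _), zero_add]
  -- Spanning expresses each unit vector by finitely many jets; these constant coefficients combine
  -- the equations into a normalized square system.
  have hB : ∀ k : Fin N', ∃ B : Fin d' × (κ →₀ ℕ) →₀ ℂ,
      (B.sum fun q r => r • segreJet Θ ρ' G q) = Pi.single k 1 := by
    intro k
    rw [← Finsupp.mem_span_range_iff_exists_finsupp, hspan]
    exact Submodule.mem_top
  choose B hB using hB
  refine jetConv_of_implicit (F := fun k => ∑ q ∈ (B k).support, C (B k q) * slice q.2 (R q.1))
    ?_ ?_ hh ?_ k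
  · intro i j
    simp only [map_sum, Derivation.leibniz, smul_eq_mul, pderiv_C, mul_zero, add_zero, map_mul,
      constantCoeff_C, hRd]
    have := congrFun (hB i) j
    rw [Finsupp.sum, Finset.sum_apply, Pi.single_apply] at this
    simp only [eq_comm (a := i)]
    rw [← this]
    rfl
  · intro i
    refine JetConv.sum fun q _ => JetConv.C_mul _ ?_
    exact (hR q.1).slice q.2
  · intro i
    rw [subst_sum' hXh]
    refine Finset.sum_eq_zero fun q _ => ?_
    rw [subst_mul hXh.hasSubst, hRh, mul_zero]

/-! ### Conjugation -/

theorem conj_subst [Finite σ] {g : σ → MvPowerSeries τ ℂ} (hg : NoConst g) (f : MvPowerSeries σ ℂ) :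
    conj (subst g f) = subst (fun i => conj (g i)) (conj f) := map_subst hg.hasSubst f

theorem conj_X (i : σ) : conj (X i : MvPowerSeries σ ℂ) = X i := map_X _ i

theorem conj_conj (f : MvPowerSeries σ ℂ) : conj (conj f) = f := by
  ext n
  simp [conj]

theorem coeff_conj (f : MvPowerSeries σ ℂ) (n : σ →₀ ℕ) :
    coeff n (conj f) = (starRingEnd ℂ) (coeff n f) := coeff_map _ _ _

theorem constantCoeff_conj (f : MvPowerSeries σ ℂ) :
    constantCoeff (conj f) = (starRingEnd ℂ) (constantCoeff f) := by
  rw [← coeff_zero_eq_constantCoeff_apply, coeff_conj, coeff_zero_eq_constantCoeff_apply]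

theorem NoConst.conj {g : σ → MvPowerSeries τ ℂ} (hg : NoConst g) : NoConst (fun i => conj (g i)) :=
  fun i => by rw [constantCoeff_conj, hg i, map_zero]

theorem conj_rename [Finite σ] (e : σ → τ) (f : MvPowerSeries σ ℂ) :
    conj (rename e f) = rename e (conj f) := by
  rw [rename_eq_subst', conj_subst (noConst_X_comp e), rename_eq_subst']
  simp only [conj_X]

theorem conj_zero : conj (0 : MvPowerSeries σ ℂ) = 0 := map_zero _

theorem pderiv_conj (i : σ) (f : MvPowerSeries σ ℂ) :
    pderiv ℂ i (conj f) = conj (pderiv ℂ i f) := by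
  ext n
  rw [coeff_conj, coeff_pderiv, coeff_pderiv, coeff_conj]
  simp

theorem span_range_conj {q : Type} {n : ℕ} {v : q → Fin n → ℂ}
    (hv : Submodule.span ℂ (Set.range v) = ⊤) :
    Submodule.span ℂ (Set.range fun x k => (starRingEnd ℂ) (v x k)) = ⊤ := by
  have h1 := Submodule.map_span (starLinearEquiv ℂ (A := Fin n → ℂ)).toLinearMap (Set.range v)
  rw [hv, Submodule.map_top, LinearMap.range_eq_top.2 (starLinearEquiv ℂ).surjective,
    ← Set.range_comp] at h1
  exact h1.symm

/-- For a real ρ, conjugation amounts to exchanging Z and ζ, so this yields the straightening with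
respect to Z without a second construction. -/
theorem IsStraight.conj {N d : ℕ} [Finite κ] {ρ : Fin d → Ser N} {c : κ → Fin N}
    {Θ : Fin N → MvPowerSeries (Fin N ⊕ (Fin d ⊕ κ)) ℂ} (h : IsStraight ρ c Θ) :
    IsStraight (fun j => conj (ρ j)) c (fun i => conj (Θ i)) where
  noConst := h.noConst.conj
  convergent i := (h.convergent i).conj
  noConst_def := h.noConst_def.conj
  convergent_def j := (h.convergent_def j).conj
  eq_def j := by
    have := congrArg FormalCR.conj (h.eq_def j)
    rw [conj_subst ((noConst_X_comp _).sumElim h.noConst), conj_X] at this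
    rw [← this]
    congr 1
    funext x
    rcases x with x | x
    · exact (conj_X _).symm
    · rfl
  eq_coord k := by rw [h.eq_coord, conj_X]
  inv i := by
    have := congrArg FormalCR.conj (h.inv i)
    rw [conj_subst ((noConst_X_comp _).sumElim (h.noConst_def.sumElim (noConst_X_comp _))),
      conj_X] at this
    rw [← this]
    congr 1
    funext x
    rcases x with x | x | x
    · exact (conj_X _).symm
    · rfl
    · exact (conj_X _).symm

theorem IsFormalGeneric.conj_eq {N d : ℕ} {ρ : Fin d → Ser N} (h : IsFormalGeneric ρ) (j : Fin d) :
    conj (ρ j) = rename Sum.swap (ρ j) := by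
  conv_rhs => rw [h.real j]
  rw [rename_rename]
  simp

theorem pderiv_rename_equiv [Fintype σ] (e : σ ≃ τ) (f : MvPowerSeries σ ℂ) (i : σ) :
    pderiv ℂ (e i) (rename e f) = rename e (pderiv ℂ i f) := by
  rw [rename_eq_subst', rename_eq_subst', pderiv_subst (noConst_X_comp e),
    Finset.sum_eq_single i]
  · rw [pderiv_X_self, mul_one]
  · intro j _ hj
    rw [pderiv_X_of_ne (by simpa using hj), mul_zero]
  · simp

theorem pderiv_rename_swap {N : ℕ} (f : Ser N) (i : Fin N ⊕ Fin N) :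
    pderiv ℂ (Sum.swap i) (rename Sum.swap f) = rename Sum.swap (pderiv ℂ i f) :=
  pderiv_rename_equiv (Equiv.sumComm (Fin N) (Fin N)) f i

theorem IsFormalGeneric.pderiv_inr {N d : ℕ} {ρ : Fin d → Ser N} (h : IsFormalGeneric ρ)
    (j : Fin d) (k : Fin N) : constantCoeff (pderiv ℂ (Sum.inr k) (ρ j)) =
      (starRingEnd ℂ) (constantCoeff (pderiv ℂ (Sum.inl k) (ρ j))) := by
  have h1 := pderiv_rename_swap (ρ j) (Sum.inr k)
  rw [Sum.swap_inr] at h1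
  rw [← constantCoeff_conj, ← pderiv_conj, h.conj_eq, h1, constantCoeff_rename]

theorem IsFormalGeneric.exists_isStraight {N d : ℕ} {ρ : Fin d → Ser N} (h : IsFormalGeneric ρ)
    (hc : ∀ j, Convergent (ρ j)) :
    ∃ (κ : Type) (_ : Fintype κ) (_ : DecidableEq κ) (c : κ → Fin N)
      (Θ : Fin N → MvPowerSeries (Fin N ⊕ (Fin d ⊕ κ)) ℂ), IsStraight ρ c Θ := by
  -- Genericity is assumed for the Z derivatives; reality of ρ turns it into independence of the ζ
  -- derivatives, which are their conjugates.
  have hgen : LinearIndependent ℂ fun (j : Fin d) (k : Fin N) =>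
      constantCoeff (pderiv ℂ (Sum.inr k) (ρ j)) := by
    rw [Fintype.linearIndependent_iff]
    intro g hg j
    have h1 := Fintype.linearIndependent_iff.1 h.generic (fun j => (starRingEnd ℂ) (g j)) (by
      funext k
      have := congrArg (starRingEnd ℂ) (congrFun hg k)
      simpa [h.pderiv_inr, Finset.sum_apply] using this) j
    simpa using h1
  obtain ⟨κ, h1, h2, c, Θ, h3, h4, h5, h6, h7⟩ := exists_straighten h.zero hgen
  exact ⟨κ, h1, h2, c, Θ, h3, h4 hc, h.zero, hc, h5, h6, h7⟩

/-! ### Tangent vector fields -/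

theorem VF.app_X {N : ℕ} (Y : VF N) (i : Fin N ⊕ Fin N) : VF.app Y (X i) = Y i := by
  rw [VF.app, Finset.sum_eq_single i]
  · rw [pderiv_X_self, mul_one]
  · intro j _ hj
    rw [pderiv_X_of_ne hj.symm, mul_zero]
  · simp

theorem VF.app_subst {N : ℕ} [Fintype σ] (Y : VF N) {S : σ → Ser N} (hS : NoConst S)
    (f : MvPowerSeries σ ℂ) :
    VF.app Y (subst S f) = ∑ q, subst S (pderiv ℂ q f) * VF.app Y (S q) := by
  simp only [VF.app, pderiv_subst hS, Finset.mul_sum]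
  rw [Finset.sum_comm]
  exact Finset.sum_congr rfl fun q _ => Finset.sum_congr rfl fun i _ => by ring

section Straight

variable {N d : ℕ} [Fintype κ] {ρ : Fin d → Ser N} {c : κ → Fin N}
  {Θ : Fin N → MvPowerSeries (Fin N ⊕ (Fin d ⊕ κ)) ℂ}

/-- The coordinates `(Z, ρ(Z, ζ), ζ_c)`. -/
def straightCoord (ρ : Fin d → Ser N) (c : κ → Fin N) : Fin N ⊕ (Fin d ⊕ κ) → Ser N :=
  Sum.elim (fun x => X (Sum.inl x)) (Sum.elim ρ (fun k => X (Sum.inr (c k))))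

omit [Fintype κ] in
theorem IsStraight.noConst_coord (h : IsStraight ρ c Θ) : NoConst (straightCoord ρ c) :=
  (noConst_X_comp _).sumElim (h.noConst_def.sumElim (noConst_X_comp _))

omit [Fintype κ] in
theorem IsStraight.subst_coord (h : IsStraight ρ c Θ) (i : Fin N) :
    subst (straightCoord ρ c) (Θ i) = X (Sum.inr i) := h.inv i

/-- A tangent field of type `(0,1)` is, along a map into the manifold, a combination of the
derivatives of the flow. -/
theorem IsStraight.tangent_expand (h : IsStraight ρ c Θ) {Y : VF N} (hY : VF.IsType01 Y)
    (hYt : VF.IsTangent ρ Y) {V : Fin N ⊕ Fin N → MvPowerSeries τ ℂ} (hV : NoConst V)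
    (hVρ : ∀ j, subst V (ρ j) = 0) (i : Fin N) :
    subst V (Y (Sum.inr i)) = ∑ k, subst V (Y (Sum.inr (c k))) *
      subst (Sum.elim (fun x => V (Sum.inl x)) (Sum.elim 0 fun k => V (Sum.inr (c k))))
        (pderiv ℂ (Sum.inr (Sum.inr k)) (Θ i)) := by
  have hS := h.noConst_coord
  -- Apply Y to Θ(Z, ρ, ζ_c) = ζ. The Z terms vanish by type, and the terms through ρ vanish along V
  -- by tangency; only the free coordinates remain.
  have h1 := congrArg (VF.app Y) (h.subst_coord i)
  rw [VF.app_X, VF.app_subst Y hS, Fintype.sum_sum_type, Fintype.sum_sum_type] at h1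
  simp only [straightCoord, Sum.elim_inl, Sum.elim_inr, VF.app_X] at h1
  rw [Finset.sum_eq_zero (fun x _ => by rw [hY x, mul_zero]), zero_add] at h1
  obtain ⟨a, ha⟩ := hYt
  simp only [ha] at h1
  have hSV : (fun q => subst V (straightCoord ρ c q)) =
      Sum.elim (fun x => V (Sum.inl x)) (Sum.elim 0 fun k => V (Sum.inr (c k))) := by
    funext q
    rcases q with x | j | k
    · exact subst_X' hV _
    · exact hVρ j
    · exact subst_X' hV _
  rw [← h1, subst_add hV.hasSubst, subst_sum' hV, subst_sum' hV, Finset.sum_eq_zero, zero_add]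
  · refine Finset.sum_congr rfl fun k _ => ?_
    rw [subst_mul hV.hasSubst, ← hSV, ← subst_subst hS hV, mul_comm]
    rfl
  · intro j _
    rw [subst_mul hV.hasSubst, subst_sum' hV, Finset.sum_eq_zero, mul_zero]
    intro l _
    rw [subst_mul hV.hasSubst, hVρ, mul_zero]

/-- The linear part at 0 of Θ(Z, ρ, ζ_c) = ζ: on the kernel of ∂_ζ ρ(0) the contribution of ρ drops
out, so the free coordinates determine the vector. -/
theorem IsStraight.eq_sum_of_ker (h : IsStraight ρ c Θ) {v : Fin N → ℂ}
    (hv : ∀ j, ∑ i, constantCoeff (pderiv ℂ (Sum.inr i) (ρ j)) * v i = 0) (i : Fin N) :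
    v i = ∑ k, constantCoeff (pderiv ℂ (Sum.inr (Sum.inr k)) (Θ i)) * v (c k) := by
  classical
  have hS := h.noConst_coord
  have h1 : ∀ l : Fin N, (if i = l then (1 : ℂ) else 0) =
      ∑ j, constantCoeff (pderiv ℂ (Sum.inr (Sum.inl j)) (Θ i)) *
        constantCoeff (pderiv ℂ (Sum.inr l) (ρ j)) +
      ∑ k, constantCoeff (pderiv ℂ (Sum.inr (Sum.inr k)) (Θ i)) * (if c k = l then 1 else 0) := by
    intro l
    have h2 := congrArg (fun p => constantCoeff (pderiv ℂ (Sum.inr l) p)) (h.subst_coord i)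
    rw [pderiv_subst hS, Fintype.sum_sum_type, Fintype.sum_sum_type] at h2
    simp only [map_add, map_sum, map_mul, constantCoeff_subst' hS] at h2
    simp only [straightCoord, Sum.elim_inl, Sum.elim_inr] at h2
    have h3 : ∀ m : Fin N, constantCoeff (pderiv ℂ (Sum.inr l) (X (Sum.inr m) : Ser N)) =
        if m = l then 1 else 0 := by
      intro m
      split_ifs with hm
      · rw [hm, pderiv_X_self, map_one]
      · rw [pderiv_X_of_ne (by simpa using hm), map_zero]
    rw [Finset.sum_eq_zero, zero_add] at h2
    · simp only [h3] at h2
      exact h2.symm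
    · intro x _
      rw [pderiv_X_of_ne (by simp), map_zero, mul_zero]
  have h4 : v i = ∑ l, (if i = l then (1 : ℂ) else 0) * v l := by simp
  rw [h4]
  simp only [h1, add_mul, Finset.sum_add_distrib, Finset.sum_mul]
  rw [Finset.sum_comm, Finset.sum_eq_zero, zero_add, Finset.sum_comm]
  · refine Finset.sum_congr rfl fun k _ => ?_
    simp
  · intro j _
    simp only [mul_assoc]
    rw [← Finset.mul_sum, hv, mul_zero]

omit [Fintype κ] in
-- Differentiate ρ(Z, Θ(Z, r, t)) = r in t: the vectors ∂Θ/∂t_k are tangent to the fibres.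
theorem IsStraight.pderiv_def (h : IsStraight ρ c Θ) (j : Fin d) (k : κ) :
    ∑ i, subst (Sum.elim (fun x => X (Sum.inl x)) Θ) (pderiv ℂ (Sum.inr i) (ρ j)) *
      pderiv ℂ (Sum.inr (Sum.inr k)) (Θ i) = 0 := by
  have hS : NoConst (Sum.elim (fun x => X (Sum.inl x)) Θ :
    Fin N ⊕ Fin N → MvPowerSeries (Fin N ⊕ (Fin d ⊕ κ)) ℂ) := (noConst_X_comp _).sumElim h.noConst
  have h1 := congrArg (pderiv ℂ (Sum.inr (Sum.inr k))) (h.eq_def j)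
  rw [pderiv_subst hS, Fintype.sum_sum_type, pderiv_X_of_ne (by simp)] at h1
  simp only [Sum.elim_inl, Sum.elim_inr] at h1
  rwa [Finset.sum_eq_zero, zero_add] at h1
  intro x _
  rw [pderiv_X_of_ne (by simp), mul_zero]

omit [Fintype κ] in
theorem IsStraight.pderiv_def_zero (h : IsStraight ρ c Θ) (j : Fin d) (k : κ) :
    ∑ i, constantCoeff (pderiv ℂ (Sum.inr i) (ρ j)) *
      constantCoeff (pderiv ℂ (Sum.inr (Sum.inr k)) (Θ i)) = 0 := by
  have := congrArg constantCoeff (h.pderiv_def j k)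
  simpa [constantCoeff_subst' ((noConst_X_comp _).sumElim h.noConst)] using this

/-- The fields with coefficients ∂Θ/∂t_k, written in the original coordinates, annihilate ρ exactly,
so the matrix of tangency is 0. Their combination with the constants `v (c k)` has value `v` at the
origin. -/
theorem IsStraight.exists_type01 (h : IsStraight ρ c Θ) {v : Fin N → ℂ}
    (hv : ∀ j, ∑ i, constantCoeff (pderiv ℂ (Sum.inr i) (ρ j)) * v i = 0) :
    ∃ Y : VF N, VF.IsType01 Y ∧ VF.IsTangent ρ Y ∧ ∀ i, constantCoeff (Y (Sum.inr i)) = v i := by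
  have hS := h.noConst_coord
  have hXΘ : NoConst (Sum.elim (fun x => X (Sum.inl x)) Θ :
    Fin N ⊕ Fin N → MvPowerSeries (Fin N ⊕ (Fin d ⊕ κ)) ℂ) := (noConst_X_comp _).sumElim h.noConst
  refine ⟨Sum.elim 0 fun i => ∑ k, C (v (c k)) *
    subst (straightCoord ρ c) (pderiv ℂ (Sum.inr (Sum.inr k)) (Θ i)), fun j => rfl,
    ⟨0, fun j => ?_⟩, fun i => ?_⟩
  · simp only [VF.app, Fintype.sum_sum_type, Sum.elim_inl, Sum.elim_inr, Pi.zero_apply, zero_mul,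
      Finset.sum_const_zero, zero_add, Matrix.zero_apply, Finset.sum_mul]
    rw [Finset.sum_comm]
    refine Finset.sum_eq_zero fun k _ => ?_
    have h1 := congrArg (subst (straightCoord ρ c)) (h.pderiv_def j k)
    rw [subst_sum' hS, subst_zero' hS] at h1
    have h2 : (fun q => subst (straightCoord ρ c) ((Sum.elim (fun x => X (Sum.inl x)) Θ :
        Fin N ⊕ Fin N → MvPowerSeries (Fin N ⊕ (Fin d ⊕ κ)) ℂ) q)) = X := by
      funext q
      rcases q with x | x
      · exact subst_X' hS _
      · exact h.inv x
    simp only [subst_mul hS.hasSubst, subst_subst hXΘ hS, h2, subst_X_self] at h1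
    have h3 : ∀ i, C (v (c k)) * subst (straightCoord ρ c) (pderiv ℂ (Sum.inr (Sum.inr k)) (Θ i)) *
        pderiv ℂ (Sum.inr i) (ρ j) = C (v (c k)) * (pderiv ℂ (Sum.inr i) (ρ j) *
        subst (straightCoord ρ c) (pderiv ℂ (Sum.inr (Sum.inr k)) (Θ i))) := fun i => by ring
    simp only [h3]
    rw [← Finset.mul_sum, h1, mul_zero]
  · simp only [Sum.elim_inr, map_sum, map_mul, constantCoeff_C, constantCoeff_subst' hS]
    rw [h.eq_sum_of_ker hv i]
    exact Finset.sum_congr rfl fun k _ => mul_comm _ _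

end Straight

/-- Exchange of the two blocks of variables. -/
def swapVF {N : ℕ} (Y : VF N) : VF N := fun i => rename Sum.swap (Y (Sum.swap i))

theorem swapVF_app {N : ℕ} (Y : VF N) (f : Ser N) :
    VF.app (swapVF Y) (rename Sum.swap f) = rename Sum.swap (VF.app Y f) := by
  rw [VF.app, VF.app, map_sum, ← (Equiv.sumComm (Fin N) (Fin N)).sum_comp]
  refine Finset.sum_congr rfl fun i _ => ?_
  rw [map_mul, Equiv.sumComm_apply, pderiv_rename_swap, swapVF, Sum.swap_swap]

theorem VF.IsTangent.swap {N d : ℕ} {ρ : Fin d → Ser N} {Y : VF N} (h : VF.IsTangent ρ Y) :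
    VF.IsTangent (fun j => rename Sum.swap (ρ j)) (swapVF Y) := by
  obtain ⟨a, ha⟩ := h
  refine ⟨a.map (rename Sum.swap), fun j => ?_⟩
  rw [swapVF_app, ha, map_sum]
  simp

theorem rename_swap_swap {N : ℕ} (f : Ser N) : rename Sum.swap (rename Sum.swap f) = f := by
  rw [rename_rename]
  simp

/-- Tangency evaluated at 0, where ρ vanishes, gives the two linear conditions separately because
the generators have pure type. Conversely `exists_type01` supplies the (0,1) part, and its conjugate
with blocks exchanged supplies the (1,0) part. -/
theorem mem_crModuleAt_iff {N d : ℕ} {ρ : Fin d → Ser N} (hρ : IsFormalGeneric ρ)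
    (hc : ∀ j, Convergent (ρ j)) {v : Fin N ⊕ Fin N → ℂ} :
    v ∈ crModuleAt ρ ↔
      (∀ j, ∑ i, constantCoeff (pderiv ℂ (Sum.inl i) (ρ j)) * v (Sum.inl i) = 0) ∧
      (∀ j, ∑ i, constantCoeff (pderiv ℂ (Sum.inr i) (ρ j)) * v (Sum.inr i) = 0) := by
  constructor
  · rintro ⟨Y, hY, rfl⟩
    have hY' : Y ∈ crModule ρ := hY
    suffices ∀ j, constantCoeff (∑ i, pderiv ℂ (Sum.inl i) (ρ j) * Y (Sum.inl i)) = 0 ∧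
        constantCoeff (∑ i, pderiv ℂ (Sum.inr i) (ρ j) * Y (Sum.inr i)) = 0 by
      refine ⟨fun j => ?_, fun j => ?_⟩
      · have := (this j).1
        rw [map_sum] at this
        simpa using! this
      · have := (this j).2
        rw [map_sum] at this
        simpa using! this
    intro j
    clear hY
    rw [crModule] at hY'
    induction hY' using Submodule.span_induction with
    | mem Y hY =>
      obtain ⟨⟨a, ha⟩, hY⟩ := hY
      have h1 : constantCoeff (VF.app Y (ρ j)) = 0 := by
        rw [ha, map_sum]
        exact Finset.sum_eq_zero fun k _ => by rw [map_mul, hρ.zero, mul_zero]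
      rw [VF.app, Fintype.sum_sum_type] at h1
      simp only [mul_comm (Y _)] at h1
      rcases hY with hY | hY
      · simp only [hY _, mul_zero, Finset.sum_const_zero, add_zero] at h1 ⊢
        exact ⟨h1, map_zero _⟩
      · simp only [hY _, mul_zero, Finset.sum_const_zero, zero_add] at h1 ⊢
        exact ⟨map_zero _, h1⟩
    | zero => simp
    | add Y Y' _ _ h h' =>
      simp only [Pi.add_apply, mul_add, Finset.sum_add_distrib, map_add]
      rw [h.1, h.2, h'.1, h'.2]
      simp
    | smul f Y _ h =>
      simp only [Pi.smul_apply, smul_eq_mul, mul_left_comm _ f, ← Finset.mul_sum]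
      rw [map_mul, map_mul, h.1, h.2]
      simp
  · rintro ⟨h1, h2⟩
    obtain ⟨κ, _, _, c, Θ, hΘ⟩ := hρ.exists_isStraight hc
    obtain ⟨Y, hY1, hY2, hY3⟩ := hΘ.exists_type01 h2
    obtain ⟨Y', hY1', hY2', hY3'⟩ := hΘ.conj.exists_type01 (v := fun i => v (Sum.inl i)) (by
      intro j
      rw [← h1 j]
      refine Finset.sum_congr rfl fun i _ => ?_
      rw [pderiv_conj, constantCoeff_conj, hρ.pderiv_inr, Complex.conj_conj])
    refine ⟨swapVF Y' + Y, Submodule.add_mem _ (Submodule.subset_span ⟨?_, Or.inl ?_⟩)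
      (Submodule.subset_span ⟨hY2, Or.inr hY1⟩), ?_⟩
    · have := hY2'.swap
      simp only [hρ.conj_eq, rename_swap_swap] at this
      exact this
    · intro j
      rw [swapVF, Sum.swap_inr, hY1' j, map_zero]
    · funext i
      rcases i with i | i
      · change constantCoeff (swapVF Y' (Sum.inl i) + Y (Sum.inl i)) = _
        rw [hY1, add_zero, swapVF, constantCoeff_rename]
        exact hY3' i
      · change constantCoeff (swapVF Y' (Sum.inr i) + Y (Sum.inr i)) = _
        rw [swapVF, Sum.swap_inr, hY1', map_zero, zero_add, hY3]

/-! ### Transfer of finite nondegeneracy -/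

/-- Substitution of a submersion is injective. -/
theorem eq_zero_of_subst_submersion [Fintype κ] [Fintype κ'] {θ : κ' → MvPowerSeries κ ℂ}
    (hθ : NoConst θ)
    (hsub : ∀ e : κ' → ℂ, ∃ w : κ → ℂ, ∀ k', ∑ k, constantCoeff (pderiv ℂ k (θ k')) * w k = e k')
    {f : MvPowerSeries κ' ℂ} (hf : subst θ f = 0) : f = 0 := by
  classical
  choose w hw using fun k' => hsub (Pi.single k' 1)
  -- `l` is a linear right inverse of dθ(0). So θ∘l is formally invertible with inverse η, and l∘η
  -- is a right inverse of θ; substituting it into f∘θ = 0 gives f = 0.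
  let l : κ → MvPowerSeries κ' ℂ := fun k => ∑ k', C (w k' k) * X k'
  have hl : NoConst l := fun k => by simp [l]
  let F : κ' → MvPowerSeries (κ' ⊕ κ') ℂ := fun i =>
    rename Sum.inr (subst l (θ i)) - X (Sum.inl i)
  have hF : NoConst F := fun i => by simp [F, constantCoeff_subst' hl, hθ i]
  have hF' : ∀ i j, constantCoeff (pderiv ℂ (Sum.inr j) (F i)) = if i = j then 1 else 0 := by
    intro i j
    have hr := noConst_X_comp (Sum.inr : κ' → κ' ⊕ κ')
    have h1 : constantCoeff (pderiv ℂ (Sum.inr j) (F i)) =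
        constantCoeff (pderiv ℂ j (subst l (θ i))) := by
      simp only [F, map_sub]
      rw [rename_eq_subst', pderiv_subst hr, pderiv_X_of_ne (by simp), map_zero, sub_zero,
        Finset.sum_eq_single j]
      · rw [pderiv_X_self, mul_one, constantCoeff_subst' hr]
      · intro k _ hk
        rw [pderiv_X_of_ne (by simpa using hk), mul_zero]
      · simp
    have h2 : ∀ k, pderiv ℂ j (l k) = C (w j k) := by
      intro k
      simp only [l, map_sum, Derivation.leibniz, smul_eq_mul, pderiv_C, mul_zero, add_zero]
      rw [Finset.sum_eq_single j]
      · rw [pderiv_X_self, mul_one]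
      · intro m _ hm
        rw [pderiv_X_of_ne hm, mul_zero]
      · simp
    rw [h1, pderiv_subst hl, map_sum]
    simp only [h2, map_mul, constantCoeff_subst' hl, constantCoeff_C]
    rw [hw, Pi.single_apply]
  obtain ⟨η, hη, hFη, -⟩ := exists_implicit hF hF'
  have hX := (noConst_X (σ := κ')).sumElim hη
  have h3 : ∀ i, subst η (subst l (θ i)) = X i := by
    intro i
    have := hFη i
    simp only [F] at this
    rw [subst_sub hX.hasSubst, subst_rename _ hX, subst_X' hX, sub_eq_zero] at this
    exact this
  have h4 := congrArg (fun p => subst η (subst l p)) hf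
  simp only [subst_zero' hl, subst_zero' hη] at h4
  rw [subst_subst hθ hl, subst_subst (hθ.subst hl) hη] at h4
  simp only [h3, subst_X_self] at h4
  exact h4

theorem VF.app_add {N : ℕ} (Y : VF N) (f g : Ser N) : VF.app Y (f + g) = VF.app Y f + VF.app Y g := by
  simp [VF.app, mul_add, Finset.sum_add_distrib]

theorem VF.app_C_mul {N : ℕ} (Y : VF N) (a : ℂ) (f : Ser N) :
    VF.app Y (C a * f) = C a * VF.app Y f := by
  simp only [VF.app, Derivation.leibniz, pderiv_C, smul_eq_mul, mul_zero, add_zero, Finset.mul_sum]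
  exact Finset.sum_congr rfl fun i _ => by ring

theorem VF.app_sum_C_mul {N : ℕ} (Y : VF N) {q : Type*} (s : Finset q) (a : q → ℂ) (f : q → Ser N) :
    VF.app Y (∑ k ∈ s, C (a k) * f k) = ∑ k ∈ s, C (a k) * VF.app Y (f k) := by
  classical
  induction s using Finset.induction_on with
  | empty => simp [VF.app]
  | insert x s hx ih => rw [Finset.sum_insert hx, Finset.sum_insert hx, VF.app_add, ih, VF.app_C_mul]

theorem multiApp_sum_C_mul {N n : ℕ} (L : Fin n → VF N) (α : Fin n → ℕ) {q : Type*} (s : Finset q)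
    (a : q → ℂ) (f : q → Ser N) :
    multiApp L α (∑ k ∈ s, C (a k) * f k) = ∑ k ∈ s, C (a k) * multiApp L α (f k) := by
  have hit : ∀ (Y : VF N) (m : ℕ) (g : q → Ser N),
      (VF.app Y)^[m] (∑ k ∈ s, C (a k) * g k) = ∑ k ∈ s, C (a k) * (VF.app Y)^[m] (g k) := by
    intro Y m
    induction m with
    | zero => intro g; rfl
    | succ m ih =>
      intro g
      simp only [Function.iterate_succ_apply, VF.app_sum_C_mul, ih]
  unfold multiApp
  induction List.finRange n with
  | nil => rfl
  | cons i l ih => simp only [List.foldr_cons, ih, hit]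

theorem multiApp_induction {N n : ℕ} {P : Ser N → Prop} {L : Fin n → VF N}
    (hP : ∀ i f, P f → P (VF.app (L i) f)) (α : Fin n → ℕ) {f : Ser N} (hf : P f) :
    P (multiApp L α f) := by
  unfold multiApp
  induction List.finRange n with
  | nil => exact hf
  | cons i l ih =>
    rw [List.foldr_cons]
    generalize List.foldr (fun i g => (VF.app (L i))^[α i] g) f l = g at ih ⊢
    induction α i generalizing g with
    | zero => exact ih
    | succ m hm =>
      rw [Function.iterate_succ_apply]
      exact hm _ (hP i g ih)

/-- The parametrization of the Segre variety of the origin. -/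
def segre {N d : ℕ} (Θ : Fin N → MvPowerSeries (Fin N ⊕ (Fin d ⊕ κ)) ℂ) (i : Fin N) :
    MvPowerSeries κ ℂ := subst (Sum.elim 0 (Sum.elim 0 X)) (Θ i)

theorem noConst_segreArg {N d : ℕ} : NoConst (Sum.elim 0 (Sum.elim 0 X) :
    Fin N ⊕ (Fin d ⊕ κ) → MvPowerSeries κ ℂ) := noConst_zero.sumElim (noConst_zero.sumElim noConst_X)

section

variable {N d : ℕ} [Fintype κ] {ρ : Fin d → Ser N} {c : κ → Fin N}
  {Θ : Fin N → MvPowerSeries (Fin N ⊕ (Fin d ⊕ κ)) ℂ}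

theorem IsStraight.noConst_segre (h : IsStraight ρ c Θ) : NoConst (segre Θ) :=
  h.noConst.subst noConst_segreArg

theorem IsStraight.noConst_segrePt (h : IsStraight ρ c Θ) :
    NoConst (Sum.elim 0 (segre Θ) : Fin N ⊕ Fin N → MvPowerSeries κ ℂ) :=
  noConst_zero.sumElim h.noConst_segre

theorem IsStraight.segre_mem (h : IsStraight ρ c Θ) (j : Fin d) :
    subst (Sum.elim 0 (segre Θ)) (ρ j) = 0 := by
  have h1 := congrArg (subst (Sum.elim 0 (Sum.elim 0 X) :
    Fin N ⊕ (Fin d ⊕ κ) → MvPowerSeries κ ℂ)) (h.eq_def j)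
  rw [subst_subst ((noConst_X_comp _).sumElim h.noConst) noConst_segreArg,
    subst_X' noConst_segreArg] at h1
  simp only [Sum.elim_inl, Sum.elim_inr, Pi.zero_apply] at h1
  rw [← h1]
  congr 1
  funext x
  rcases x with x | x
  · simp only [Sum.elim_inl]
    rw [subst_X' noConst_segreArg]
    rfl
  · rfl

theorem IsStraight.segre_coord (h : IsStraight ρ c Θ) (k : κ) : segre Θ (c k) = X k := by
  rw [segre, h.eq_coord, subst_X' noConst_segreArg]
  rfl

omit [Fintype κ] in
theorem pderiv_segre [Fintype κ] (i : Fin N) (k : κ) : pderiv ℂ k (segre Θ i) =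
    subst (Sum.elim 0 (Sum.elim 0 X)) (pderiv ℂ (Sum.inr (Sum.inr k)) (Θ i)) := by
  rw [segre, pderiv_subst noConst_segreArg, Finset.sum_eq_single (Sum.inr (Sum.inr k))]
  · simp [pderiv_X_self]
  · rintro (x | x | x) _ hx
    · simp
    · simp
    · simp only [Sum.elim_inr]
      rw [pderiv_X_of_ne (by simpa using hx), mul_zero]
  · simp

/-- Tangent `(0,1)` fields preserve the series vanishing on the Segre variety of the origin. -/
theorem IsStraight.app_segre (h : IsStraight ρ c Θ) {Y : VF N} (hY : VF.IsType01 Y)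
    (hYt : VF.IsTangent ρ Y) {f : Ser N} (hf : subst (Sum.elim 0 (segre Θ)) f = 0) :
    subst (Sum.elim 0 (segre Θ)) (VF.app Y f) = 0 := by
  have hT := h.noConst_segrePt
  have hexp := h.tangent_expand hY hYt hT h.segre_mem
  have harg : (Sum.elim (fun x => (Sum.elim 0 (segre Θ) : Fin N ⊕ Fin N → MvPowerSeries κ ℂ)
      (Sum.inl x)) (Sum.elim 0 fun k => (Sum.elim 0 (segre Θ) : Fin N ⊕ Fin N → MvPowerSeries κ ℂ)
      (Sum.inr (c k)))) = (Sum.elim 0 (Sum.elim 0 X) :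
      Fin N ⊕ (Fin d ⊕ κ) → MvPowerSeries κ ℂ) := by
    funext q
    rcases q with x | x | x
    · rfl
    · rfl
    · exact h.segre_coord x
  rw [harg] at hexp
  simp only [← pderiv_segre] at hexp
  -- Since `f` vanishes on the Segre variety, so do its derivatives along the parametrization; by
  -- `hexp` the field is a combination of these directions.
  have hd : ∀ k, ∑ i, subst (Sum.elim 0 (segre Θ)) (pderiv ℂ (Sum.inr i) f) *
      pderiv ℂ k (segre Θ i) = 0 := by
    intro k
    have h1 := congrArg (pderiv ℂ k) hf
    rw [pderiv_subst hT, Fintype.sum_sum_type, map_zero] at h1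
    simpa using h1
  rw [VF.app, subst_sum' hT, Fintype.sum_sum_type, Finset.sum_eq_zero, zero_add]
  · rw [Finset.sum_congr rfl fun i _ => by rw [subst_mul hT.hasSubst, hexp i, Finset.sum_mul],
      Finset.sum_comm]
    refine Finset.sum_eq_zero fun k _ => ?_
    rw [← mul_zero (subst (Sum.elim 0 (segre Θ)) (Y (Sum.inr (c k)))), ← hd k, Finset.mul_sum]
    exact Finset.sum_congr rfl fun i _ => by ring
  · intro i _
    rw [hY, zero_mul, subst_zero' hT]

end

/-- Suppose a functional f annihilates all jets. Then the combinations Σ_k f_k ∂ρ'_j/∂Z_k vanish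
along H̄ restricted to the Segre variety of 0 in M. CR submersivity makes this restriction a
submersion onto the Segre variety in M', so they vanish on all of it. Tangent (0,1) fields preserve
that vanishing, hence f kills every L^α(∂ρ'_j/∂Z)(0), and finite nondegeneracy forces f = 0. -/
theorem span_segreJet_eq_top {N d N' d' : ℕ} [Fintype κ] [Fintype κ'] {ρ : Fin d → Ser N}
    {c : κ → Fin N} {Θ : Fin N → MvPowerSeries (Fin N ⊕ (Fin d ⊕ κ)) ℂ} (hΘ : IsStraight ρ c Θ)
    {ρ' : Fin d' → Ser N'} {c' : κ' → Fin N'}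
    {Θ' : Fin N' → MvPowerSeries (Fin N' ⊕ (Fin d' ⊕ κ')) ℂ} (hΘ' : IsStraight ρ' c' Θ')
    (hρ : IsFormalGeneric ρ) (hρ' : IsFormalGeneric ρ')
    {H : Fin N' → MvPowerSeries (Fin N) ℂ} (hH : MapsInto ρ ρ' H) (hsub : CRSubmersive ρ ρ' H)
    (hnd : FinitelyNondegenerate ρ') :
    Submodule.span ℂ (Set.range (segreJet Θ ρ' fun k => conj (H k))) = ⊤ := by
  classical
  have hH0 : NoConst H := hH.1
  have hσ := hΘ.noConst_segre
  have hT' := hΘ'.noConst_segrePt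
  let Hσ : Fin N' → MvPowerSeries κ ℂ := fun i => subst (segre Θ) (conj (H i))
  have hHσ : NoConst Hσ := hH0.conj.subst hσ
  let θ : κ' → MvPowerSeries κ ℂ := fun k => Hσ (c' k)
  have hθ : NoConst θ := hHσ.comp c'
  have hq : NoConst (Sum.elim 0 Hσ : Fin N' ⊕ Fin N' → MvPowerSeries κ ℂ) :=
    noConst_zero.sumElim hHσ
  have hqρ' : ∀ j, subst (Sum.elim 0 Hσ) (ρ' j) = 0 := by
    intro j
    obtain ⟨a, ha⟩ := hH.2
    have h1 := congrArg (subst (Sum.elim 0 (segre Θ))) (ha j)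
    have hcx : NoConst (complexify H) := (hH0.rename _).sumElim (hH0.conj.rename _)
    rw [subst_subst hcx hΘ.noConst_segrePt, subst_sum' hΘ.noConst_segrePt, Finset.sum_eq_zero] at h1
    · rw [← h1]
      congr 1
      funext x
      rcases x with x | x
      · simp only [complexify, Sum.elim_inl]
        rw [subst_rename _ hΘ.noConst_segrePt]
        simp only [Sum.elim_inl]
        exact (subst_zero_of_constantCoeff_zero (hH0 x)).symm
      · simp only [complexify, Sum.elim_inr]
        rw [subst_rename _ hΘ.noConst_segrePt]
        rfl
    · intro k _
      rw [subst_mul hΘ.noConst_segrePt.hasSubst, hΘ.segre_mem, mul_zero]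
  -- A point over Z = 0 on the target manifold is determined by its free coordinates, here θ.
  have hθσ : ∀ i, subst θ (segre Θ' i) = Hσ i := by
    intro i
    have h1 := congrArg (subst (Sum.elim 0 Hσ)) (hΘ'.subst_coord i)
    rw [subst_subst hΘ'.noConst_coord hq, subst_X' hq] at h1
    rw [segre, subst_subst noConst_segreArg hθ]
    simp only [Sum.elim_inr] at h1
    rw [← h1]
    congr 1
    funext x
    rcases x with x | x | x
    · simp only [straightCoord, Sum.elim_inl]
      rw [subst_X' hq]
      exact subst_zero' hθ
    · simp only [straightCoord, Sum.elim_inr, Sum.elim_inl]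
      rw [hqρ']
      exact subst_zero' hθ
    · simp only [straightCoord, Sum.elim_inr]
      rw [subst_X' hq, subst_X' hθ]
      rfl
  have hθsub : ∀ e : κ' → ℂ, ∃ w : κ → ℂ, ∀ k',
      ∑ k, constantCoeff (pderiv ℂ k (θ k')) * w k = e k' := by
    intro e
    -- The (0,1) tangent vector of the target with free coordinates `e`; lifting it by CR
    -- submersivity shows that dθ(0) is onto.
    let v' : Fin N' ⊕ Fin N' → ℂ := Sum.elim 0 fun i =>
      ∑ k, constantCoeff (pderiv ℂ (Sum.inr (Sum.inr k)) (Θ' i)) * e k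
    have hv' : v' ∈ crModuleAt ρ' := by
      rw [mem_crModuleAt_iff hρ' hΘ'.convergent_def]
      refine ⟨fun j => by simp [v'], fun j => ?_⟩
      simp only [v', Sum.elim_inr, Finset.mul_sum]
      rw [Finset.sum_comm]
      refine Finset.sum_eq_zero fun k _ => ?_
      simp only [← mul_assoc]
      rw [← Finset.sum_mul, hΘ'.pderiv_def_zero, zero_mul]
    rw [← hsub] at hv'
    obtain ⟨v, hv, hvv'⟩ := hv'
    have hvk := ((mem_crModuleAt_iff hρ hΘ.convergent_def).1 hv).2
    have hvi := hΘ.eq_sum_of_ker hvk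
    refine ⟨fun k => v (Sum.inr (c k)), fun k' => ?_⟩
    have h1 := congrFun hvv' (Sum.inr (c' k'))
    have h2 : v' (Sum.inr (c' k')) = e k' := by
      simp only [v', Sum.elim_inr, hΘ'.eq_coord]
      rw [Finset.sum_eq_single k']
      · rw [pderiv_X_self, map_one, one_mul]
      · intro k _ hk
        rw [pderiv_X_of_ne (by simpa using hk.symm), map_zero, zero_mul]
      · simp
    rw [h2, tangentMap, Matrix.mulVecLin_apply, Matrix.mulVec, dotProduct,
      Fintype.sum_sum_type] at h1
    simp only [Matrix.of_apply, complexify, Sum.elim_inr] at h1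
    have h3 : ∀ i : Fin N ⊕ Fin N, constantCoeff (pderiv ℂ i (rename Sum.inr (conj (H (c' k'))) :
        Ser N)) = Sum.elim (0 : Fin N → ℂ)
        (fun l => constantCoeff (pderiv ℂ l (conj (H (c' k'))))) i := by
      intro i
      rw [rename_eq_subst', pderiv_subst (noConst_X_comp _), map_sum]
      simp only [map_mul, constantCoeff_subst' (noConst_X_comp _)]
      rcases i with i | i
      · exact Finset.sum_eq_zero fun x _ => by rw [pderiv_X_of_ne (by simp), map_zero, mul_zero]
      · rw [Finset.sum_eq_single i]
        · rw [pderiv_X_self, map_one, mul_one]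
          rfl
        · intro x _ hx
          rw [pderiv_X_of_ne (by simpa using hx), map_zero, mul_zero]
        · simp
    simp only [h3, Sum.elim_inl, Sum.elim_inr, Pi.zero_apply, zero_mul, Finset.sum_const_zero,
      zero_add] at h1
    rw [← h1]
    have h4 : ∀ k, constantCoeff (pderiv ℂ k (θ k')) =
        ∑ i, constantCoeff (pderiv ℂ i (conj (H (c' k')))) *
          constantCoeff (pderiv ℂ (Sum.inr (Sum.inr k)) (Θ i)) := by
      intro k
      simp only [θ, Hσ]
      rw [pderiv_subst hσ, map_sum]
      refine Finset.sum_congr rfl fun i _ => ?_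
      rw [map_mul, constantCoeff_subst' hσ, pderiv_segre, constantCoeff_subst' noConst_segreArg]
    simp only [h4, Finset.sum_mul]
    rw [Finset.sum_comm]
    refine Finset.sum_congr rfl fun i _ => ?_
    rw [hvi i, Finset.mul_sum]
    exact Finset.sum_congr rfl fun k _ => by ring
  by_contra hne
  obtain ⟨f, hf0, hf⟩ := Submodule.exists_le_ker_of_lt_top _ (lt_top_iff_ne_top.2 hne)
  obtain ⟨n, L, hL, ℓ, hspan⟩ := hnd
  have hfv : ∀ v : Fin N' → ℂ, f v = ∑ k, f (Pi.single k 1) * v k := by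
    intro v
    conv_lhs => rw [← Finset.univ_sum_single v]
    rw [map_sum]
    refine Finset.sum_congr rfl fun k _ => ?_
    have : (Pi.single k (v k) : Fin N' → ℂ) = v k • Pi.single k 1 := by
      rw [← Pi.single_smul, smul_eq_mul, mul_one]
    rw [this, map_smul, smul_eq_mul, mul_comm]
  let g : Fin d' → Ser N' := fun j =>
    ∑ k, C (f (Pi.single k 1)) * pderiv ℂ (Sum.inl k) (ρ' j)
  have hg1 : ∀ j, subst (Sum.elim 0 Hσ) (g j) = 0 := by
    intro j
    ext α
    have h1 : segreJet Θ ρ' (fun k => conj (H k)) (j, α) ∈ LinearMap.ker f :=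
      hf (Submodule.subset_span ⟨_, rfl⟩)
    rw [LinearMap.mem_ker, hfv] at h1
    simp only [g]
    rw [subst_sum' hq, map_sum, coeff_zero, ← h1]
    refine Finset.sum_congr rfl fun k _ => ?_
    rw [subst_mul hq.hasSubst, subst_C, coeff_C_mul]
    rfl
  have hg2 : ∀ j, subst (Sum.elim 0 (segre Θ')) (g j) = 0 := by
    intro j
    refine eq_zero_of_subst_submersion hθ hθsub ?_
    rw [subst_subst hT' hθ, ← hg1 j]
    congr 1
    funext x
    rcases x with x | x
    · exact subst_zero' hθ
    · exact hθσ x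
  apply hf0
  rw [← LinearMap.ker_eq_top, eq_top_iff, ← hspan, Submodule.span_le]
  rintro _ ⟨j, α, -, rfl⟩
  rw [SetLike.mem_coe, LinearMap.mem_ker, hfv]
  have h5 : subst (Sum.elim 0 (segre Θ')) (multiApp L α (g j)) = 0 :=
    multiApp_induction (P := fun p => subst (Sum.elim 0 (segre Θ')) p = 0)
      (fun i p hp => hΘ'.app_segre (hL.type01 i) (hL.tangent i) hp) α (hg2 j)
  have h6 := congrArg constantCoeff h5
  rw [constantCoeff_subst' hT', map_zero, multiApp_sum_C_mul, map_sum] at h6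
  simpa using h6

/-! ### Orbits of families of flows -/

/-- A convergent family of maps `Y ↦ Φ(Y, a)` with `Φ(Y, 0) = Y` and
`Φ(Φ(Y, a), -a) = Y`. -/
structure IsFlow (Φ : σ → MvPowerSeries (σ ⊕ κ) ℂ) : Prop where
  noConst : NoConst Φ
  convergent : ∀ i, Convergent (Φ i)
  zero : ∀ i, subst (Sum.elim X 0) (Φ i) = (X i : MvPowerSeries σ ℂ)
  inv : ∀ i, subst (Sum.elim Φ fun k => -X (Sum.inr k)) (Φ i) = X (Sum.inl i)

/-- The tuples obtained from `0` by finitely many flows with convergent parameters. -/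
inductive Reach (Φ : ε → σ → MvPowerSeries (σ ⊕ κ) ℂ) (τ : Type) :
    (σ → MvPowerSeries τ ℂ) → Prop
  | zero : Reach Φ τ 0
  | step (e : ε) {V : σ → MvPowerSeries τ ℂ} {a : κ → MvPowerSeries τ ℂ} (hV : Reach Φ τ V)
      (ha : NoConst a) (hac : ∀ k, Convergent (a k)) :
      Reach Φ τ fun i => subst (Sum.elim V a) (Φ e i)

section Flow

variable [Finite σ] [Finite κ] {Φ : ε → σ → MvPowerSeries (σ ⊕ κ) ℂ}

theorem Reach.noConst (hΦ : ∀ e, IsFlow (Φ e)) {V : σ → MvPowerSeries τ ℂ} (hV : Reach Φ τ V) :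
    NoConst V := by
  induction hV with
  | zero => exact noConst_zero
  | step e _ ha _ ih => exact (hΦ e).noConst.subst (ih.sumElim ha)

theorem Reach.convergent (hΦ : ∀ e, IsFlow (Φ e)) {V : σ → MvPowerSeries τ ℂ} (hV : Reach Φ τ V)
    (i : σ) : Convergent (V i) := by
  induction hV generalizing i with
  | zero => exact convergent_zero
  | step e hV ha hac ih =>
    exact ((hΦ e).convergent i).subst ((hV.noConst hΦ).sumElim ha) (Convergent.sumElim ih hac)

theorem Reach.subst [Finite τ] (hΦ : ∀ e, IsFlow (Φ e)) {V : σ → MvPowerSeries τ ℂ}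
    (hV : Reach Φ τ V) {b : τ → MvPowerSeries υ ℂ} (hb : NoConst b) (hbc : ∀ i, Convergent (b i)) :
    Reach Φ υ fun i => MvPowerSeries.subst b (V i) := by
  induction hV with
  | zero =>
    convert Reach.zero (Φ := Φ) (τ := υ) using 1
    funext i
    exact subst_zero' hb
  | step e hV ha hac ih =>
    rename_i V a
    convert ih.step e (ha.subst hb) (fun k => (hac k).subst hb hbc) using 1
    funext i
    rw [subst_subst ((hV.noConst hΦ).sumElim ha) hb]
    congr 1
    funext x
    cases x <;> rfl

/-- A tuple `V(x)` reached from `0` can be brought back to `0` by a family of flows `Γ(x, Y)`. -/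
theorem Reach.exists_undo [Finite τ] (hΦ : ∀ e, IsFlow (Φ e)) {V : σ → MvPowerSeries τ ℂ}
    (hV : Reach Φ τ V) :
    ∃ Γ : σ → MvPowerSeries (τ ⊕ σ) ℂ, NoConst Γ ∧
      (∀ i, MvPowerSeries.subst (Sum.elim X V) (Γ i) = 0) ∧
      (∀ i, MvPowerSeries.subst (Sum.elim 0 X) (Γ i) = (X i : MvPowerSeries σ ℂ)) ∧
      ∀ {υ : Type} {b : τ → MvPowerSeries υ ℂ} {B : σ → MvPowerSeries υ ℂ}, NoConst b →
        (∀ i, Convergent (b i)) → Reach Φ υ B →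
        Reach Φ υ fun i => MvPowerSeries.subst (Sum.elim b B) (Γ i) := by
  induction hV with
  | zero =>
    refine ⟨fun i => X (Sum.inr i), noConst_X_comp _, fun i => ?_, fun i => ?_, ?_⟩
    · rw [subst_X' (noConst_X.sumElim noConst_zero)]
      rfl
    · rw [subst_X' (noConst_zero.sumElim noConst_X)]
      rfl
    · intro υ b B hb hbc hB
      have : (fun i => MvPowerSeries.subst (Sum.elim b B) (X (Sum.inr i) : MvPowerSeries (τ ⊕ σ) ℂ))
          = B := by
        funext i
        rw [subst_X' (hb.sumElim (hB.noConst hΦ))]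
        rfl
      rw [this]
      exact hB
  | step e hV ha hac ih =>
    rename_i V a
    obtain ⟨Γ, hΓ, h1, h2, h3⟩ := ih
    have hV0 := hV.noConst hΦ
    have hVa := hV0.sumElim ha
    let na : κ → MvPowerSeries (τ ⊕ σ) ℂ := fun k => -rename Sum.inl (a k)
    have hna : NoConst na := fun k => by
      rw [map_neg, ha.rename Sum.inl k, neg_zero]
    have hin : NoConst (Sum.elim (fun i => X (Sum.inr i)) na :
        σ ⊕ κ → MvPowerSeries (τ ⊕ σ) ℂ) := (noConst_X_comp _).sumElim hna
    -- The last step is undone by the flow with parameter `-a`, after which the inductive Γ undoes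
    -- the earlier ones. Since all parameters vanish at x = 0, the total map is the identity there.
    let Y : σ → MvPowerSeries (τ ⊕ σ) ℂ := fun i =>
      MvPowerSeries.subst (Sum.elim (fun i => X (Sum.inr i)) na) (Φ e i)
    have hY : NoConst Y := (hΦ e).noConst.subst hin
    have hg : NoConst (Sum.elim (fun x => X (Sum.inl x)) Y : τ ⊕ σ → MvPowerSeries (τ ⊕ σ) ℂ) :=
      (noConst_X_comp _).sumElim hY
    have key : ∀ {υ : Type} {b : τ → MvPowerSeries υ ℂ} {B : σ → MvPowerSeries υ ℂ}, NoConst b →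
        NoConst B → ∀ i, MvPowerSeries.subst (Sum.elim b B)
          (MvPowerSeries.subst (Sum.elim (fun x => X (Sum.inl x)) Y) (Γ i)) =
        MvPowerSeries.subst (Sum.elim b fun i => MvPowerSeries.subst
          (Sum.elim B fun k => -MvPowerSeries.subst b (a k)) (Φ e i)) (Γ i) := by
      intro υ b B hb hB i
      have hbB := hb.sumElim hB
      rw [subst_subst hg hbB]
      congr 1
      funext x
      rcases x with x | x
      · simp only [Sum.elim_inl]
        rw [subst_X' hbB]
        rfl
      · simp only [Sum.elim_inr, Y]
        rw [subst_subst hin hbB]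
        congr 1
        funext z
        rcases z with z | z
        · simp only [Sum.elim_inl]
          rw [subst_X' hbB]
          rfl
        · simp only [Sum.elim_inr, na]
          rw [subst_neg' hbB, subst_rename _ hbB]
          rfl
    refine ⟨fun i => MvPowerSeries.subst (Sum.elim (fun x => X (Sum.inl x)) Y) (Γ i),
      hΓ.subst hg, fun i => ?_, fun i => ?_, ?_⟩
    · rw [key noConst_X ((hΦ e).noConst.subst hVa), ← h1 i]
      congr 2
      funext l
      have h4 := congrArg (MvPowerSeries.subst (Sum.elim V a)) ((hΦ e).inv l)
      have hΦn : NoConst (Sum.elim (Φ e) fun k => -X (Sum.inr k) :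
          σ ⊕ κ → MvPowerSeries (σ ⊕ κ) ℂ) := (hΦ e).noConst.sumElim fun k => by simp
      rw [subst_subst hΦn hVa, subst_X' hVa] at h4
      simp only [Sum.elim_inl] at h4
      rw [← h4]
      congr 1
      funext z
      rcases z with z | z
      · rfl
      · simp only [Sum.elim_inr]
        rw [subst_neg' hVa, subst_X' hVa, subst_X_self]
        rfl
    · rw [key noConst_zero noConst_X, ← h2 i]
      congr 2
      funext l
      rw [← (hΦ e).zero l]
      congr 2
      funext k
      rw [show MvPowerSeries.subst (0 : τ → MvPowerSeries σ ℂ) (a k) = 0 from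
        subst_zero_of_constantCoeff_zero (ha k), neg_zero]
      rfl
    · intro υ b B hb hbc hB
      simp only [key hb (hB.noConst hΦ)]
      refine h3 hb hbc (hB.step e (fun k => ?_) fun k => ((hac k).subst hb hbc).neg)
      rw [map_neg, ha.subst hb k, neg_zero]

end Flow

/-! ### Generic rank of the reached families -/

/-- Some `r × r` minor of the Jacobian of `V` does not vanish. -/
def HasMinor (V : σ → MvPowerSeries τ ℂ) (r : ℕ) : Prop :=
  ∃ (f : Fin r → σ) (g : Fin r → τ), (Matrix.of fun a b => pderiv ℂ (g b) (V (f a))).det ≠ 0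

theorem HasMinor.le_card [Fintype σ] {V : σ → MvPowerSeries τ ℂ} {r : ℕ} (h : HasMinor V r) :
    r ≤ Fintype.card σ := by
  obtain ⟨f, g, hfg⟩ := h
  have hf : Function.Injective f := by
    intro a b hab
    by_contra hne
    refine hfg (Matrix.det_zero_of_row_eq hne ?_)
    funext k
    simp [hab]
  simpa using Fintype.card_le_of_injective f hf

/-- A nonzero minor has no repeated row, so its size is bounded by the number of components,
whatever the parameter space. Hence the rank has a maximum over all reached families at once. -/
theorem exists_reach_hasMinor_maximal [Fintype σ] (Φ : ε → σ → MvPowerSeries (σ ⊕ κ) ℂ) :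
    ∃ (r : ℕ) (τ : Type) (_ : Fintype τ) (V : σ → MvPowerSeries τ ℂ), Reach Φ τ V ∧ HasMinor V r ∧
      ∀ (υ : Type) [Fintype υ] (W : σ → MvPowerSeries υ ℂ), Reach Φ υ W → ¬ HasMinor W (r + 1) := by
  by_contra! hcon
  have h : ∀ r : ℕ, ∃ (τ : Type) (_ : Fintype τ) (V : σ → MvPowerSeries τ ℂ),
      Reach Φ τ V ∧ HasMinor V r := by
    intro r
    induction r with
    | zero => exact ⟨Empty, inferInstance, 0, Reach.zero, Fin.elim0, Fin.elim0, by simp⟩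
    | succ r ih =>
      obtain ⟨τ, _, V, hV, hVr⟩ := ih
      obtain ⟨υ, i, W, hW, hWr⟩ := hcon r τ inferInstance V hV hVr
      exact ⟨υ, i, W, hW, hWr⟩
  obtain ⟨τ, _, V, -, hV⟩ := h (Fintype.card σ + 1)
  exact absurd hV.le_card (by simp)

/-- If a bordered determinant vanishes, the last row is expressed by the others. -/
theorem det_mul_eq_of_bordered {R : Type} [CommRing R] [NoZeroDivisors R] {r : ℕ}
    {A : Matrix (Fin r) (Fin r) R} (hA : A.det ≠ 0) {c w : Fin r → R} {d : R}
    (h : (Matrix.fromBlocks A (Matrix.of fun a (_ : Unit) => c a) (Matrix.of fun (_ : Unit) b => w b)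
      (Matrix.of fun (_ _ : Unit) => d)).det = 0) :
    A.det * d = ∑ b, (∑ a, A.adjugate b a * c a) * w b := by
  -- Row elimination with the adjugate in place of the inverse, so that no fractions occur; the
  -- resulting power of `A.det` is cancelled at the end.
  let L : Matrix (Fin r ⊕ Unit) (Fin r ⊕ Unit) R := Matrix.fromBlocks A.adjugate 0
    (-((Matrix.of fun (_ : Unit) b => w b) * A.adjugate)) (Matrix.of fun (_ _ : Unit) => A.det)
  have h1 := congrArg (fun x => L.det * x) h
  simp only [mul_zero] at h1
  rw [← Matrix.det_mul, Matrix.fromBlocks_multiply, Matrix.adjugate_mul] at h1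
  have h2 : -((Matrix.of fun (_ : Unit) b => w b) * A.adjugate) * A +
      (Matrix.of fun (_ _ : Unit) => A.det) * (Matrix.of fun (_ : Unit) b => w b) = 0 := by
    rw [Matrix.neg_mul, Matrix.mul_assoc, Matrix.adjugate_mul]
    ext i j
    simp [Matrix.mul_apply]
  rw [h2, Matrix.det_fromBlocks_zero₂₁, Matrix.zero_mul, add_zero, Matrix.det_smul,
    Matrix.det_one] at h1
  rcases mul_eq_zero.1 h1 with h3 | h3
  · exact absurd h3 (by simpa using pow_ne_zero _ hA)
  · rw [Matrix.neg_mul, Matrix.mul_assoc, Matrix.det_unique] at h3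
    simp only [Matrix.add_apply, Matrix.neg_apply, Matrix.mul_apply, Matrix.of_apply, Finset.univ_unique, Finset.sum_singleton] at h3
    rw [neg_add_eq_zero] at h3
    rw [← h3]
    exact Finset.sum_congr rfl fun b _ => mul_comm _ _

/-- A nonzero multiple of `w` is a combination of the partial derivatives of `V`. -/
def IsAlong [Fintype τ] (V w : σ → MvPowerSeries τ ℂ) : Prop :=
  ∃ (q : MvPowerSeries τ ℂ) (ξ : τ → MvPowerSeries τ ℂ), q ≠ 0 ∧
    ∀ i, q * w i = ∑ k, ξ k * pderiv ℂ k (V i)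

section Along

variable [Fintype τ] {V : σ → MvPowerSeries τ ℂ}

theorem IsAlong.zero : IsAlong V 0 := ⟨1, 0, one_ne_zero, fun i => by simp⟩

theorem IsAlong.add {w w' : σ → MvPowerSeries τ ℂ} (h : IsAlong V w) (h' : IsAlong V w') :
    IsAlong V fun i => w i + w' i := by
  obtain ⟨q, ξ, hq, hw⟩ := h
  obtain ⟨q', ξ', hq', hw'⟩ := h'
  refine ⟨q * q', fun k => q' * ξ k + q * ξ' k, mul_ne_zero hq hq', fun i => ?_⟩
  simp only [add_mul, Finset.sum_add_distrib, mul_assoc, ← Finset.mul_sum, ← hw i, ← hw' i]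
  ring

theorem IsAlong.mul {w : σ → MvPowerSeries τ ℂ} (h : IsAlong V w) (f : MvPowerSeries τ ℂ) :
    IsAlong V fun i => f * w i := by
  obtain ⟨q, ξ, hq, hw⟩ := h
  refine ⟨q, fun k => f * ξ k, hq, fun i => ?_⟩
  simp only [mul_assoc, ← Finset.mul_sum, ← hw i]
  ring

theorem IsAlong.sum {s : Finset ι} {w : ι → σ → MvPowerSeries τ ℂ} (h : ∀ l, IsAlong V (w l)) :
    IsAlong V fun i => ∑ l ∈ s, w l i := by
  classical
  induction s using Finset.induction_on with
  | empty =>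
    simp only [Finset.sum_empty]
    exact IsAlong.zero
  | insert a s ha ih =>
    simp only [Finset.sum_insert ha]
    exact (h a).add ih

end Along

theorem pderiv_comm (i j : τ) (f : MvPowerSeries τ ℂ) :
    pderiv ℂ i (pderiv ℂ j f) = pderiv ℂ j (pderiv ℂ i f) := by
  classical
  by_cases h : i = j
  · rw [h]
  · ext n
    simp only [coeff_pderiv, Finsupp.add_apply, Finsupp.single_apply, h, Ne.symm h, if_false,
      add_zero, add_right_comm n]
    ring

/-- Along a point set of maximal rank the flow derivatives are tangential. -/
theorem isAlong_flow [Fintype σ] [Fintype κ] [Fintype τ] {Φ : ε → σ → MvPowerSeries (σ ⊕ κ) ℂ}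
    (hΦ : ∀ e, IsFlow (Φ e)) {V : σ → MvPowerSeries τ ℂ} (hV : Reach Φ τ V) {r : ℕ}
    (hr : HasMinor V r) (hmax : ∀ (υ : Type) [Fintype υ] (W : σ → MvPowerSeries υ ℂ),
      Reach Φ υ W → ¬ HasMinor W (r + 1)) (e : ε) (k : κ) :
    IsAlong V fun i => subst (Sum.elim V 0) (pderiv ℂ (Sum.inr k) (Φ e i)) := by
  classical
  have hV0 := hV.noConst hΦ
  let b : τ → MvPowerSeries (τ ⊕ κ) ℂ := fun x => X (Sum.inl x)
  have hb : NoConst b := noConst_X_comp _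
  let a : κ → MvPowerSeries (τ ⊕ κ) ℂ := fun x => X (Sum.inr x)
  have ha : NoConst a := noConst_X_comp _
  have hVb := (hV.subst hΦ hb fun _ => convergent_X _)
  -- One more flow step with fresh parameters u. At u = 0 it returns V, and its u-derivative there
  -- is the flow direction in question.
  let W : σ → MvPowerSeries (τ ⊕ κ) ℂ := fun i =>
    subst (Sum.elim (fun i => subst b (V i)) a) (Φ e i)
  have hW : Reach Φ _ W := hVb.step e ha fun _ => convergent_X _
  have hVa : NoConst (Sum.elim (fun i => subst b (V i)) a) := (hV0.subst hb).sumElim ha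
  have hX0 : NoConst (Sum.elim X 0 : τ ⊕ κ → MvPowerSeries τ ℂ) := noConst_X.sumElim noConst_zero
  have hVsub : ∀ f : MvPowerSeries τ ℂ, subst (Sum.elim X 0 : τ ⊕ κ → MvPowerSeries τ ℂ)
      (subst b f) = f := by
    intro f
    rw [subst_subst hb hX0]
    simp only [b, subst_X' hX0, Sum.elim_inl]
    exact subst_X_self f
  have harg : (fun x => subst (Sum.elim X 0 : τ ⊕ κ → MvPowerSeries τ ℂ)
      (Sum.elim (fun i => subst b (V i)) a x)) = Sum.elim V 0 := by
    funext x
    rcases x with x | x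
    · exact hVsub _
    · exact subst_X' hX0 _
  have hdk : ∀ i, subst (Sum.elim X 0 : τ ⊕ κ → MvPowerSeries τ ℂ) (pderiv ℂ (Sum.inr k) (W i)) =
      subst (Sum.elim V 0) (pderiv ℂ (Sum.inr k) (Φ e i)) := by
    intro i
    rw [pderiv_subst hVa, subst_sum' hX0, Finset.sum_eq_single (Sum.inr k)]
    · rw [subst_mul hX0.hasSubst, subst_subst hVa hX0, harg]
      simp [a, subst_one' hX0]
    · rintro (x | x) _ hx
      · simp only [Sum.elim_inl]
        rw [pderiv_subst hb, Finset.sum_eq_zero, mul_zero, subst_zero' hX0]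
        intro y _
        rw [pderiv_X_of_ne (by simp), mul_zero]
      · simp only [Sum.elim_inr, a]
        rw [pderiv_X_of_ne (by simpa using hx), mul_zero, subst_zero' hX0]
    · simp
  have hWV : ∀ i, subst (Sum.elim X 0 : τ ⊕ κ → MvPowerSeries τ ℂ) (W i) = V i := by
    intro i
    rw [subst_subst hVa hX0, harg]
    have h1 := congrArg (subst V) ((hΦ e).zero i)
    rw [subst_subst (noConst_X.sumElim noConst_zero) hV0, subst_X' hV0] at h1
    rw [← h1]
    congr 1
    funext x
    rcases x with x | x
    · exact (subst_X' hV0 _).symm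
    · exact (subst_zero' hV0).symm
  have hdl : ∀ i l, subst (Sum.elim X 0 : τ ⊕ κ → MvPowerSeries τ ℂ)
      (pderiv ℂ (Sum.inl l) (W i)) = pderiv ℂ l (V i) := by
    intro i l
    have h1 := congrArg (pderiv ℂ l) (hWV i)
    rw [pderiv_subst hX0, Finset.sum_eq_single (Sum.inl l)] at h1
    · simpa using h1
    · rintro (x | x) _ hx
      · simp only [Sum.elim_inl]
        rw [pderiv_X_of_ne (by simpa using hx), mul_zero]
      · simp
    · simp
  obtain ⟨f, g, hfg⟩ := hr
  let A : Matrix (Fin r) (Fin r) (MvPowerSeries τ ℂ) := Matrix.of fun a b => pderiv ℂ (g b) (V (f a))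
  let S : Fin r → MvPowerSeries τ ℂ := fun b => ∑ a, A.adjugate b a *
    subst (Sum.elim V 0) (pderiv ℂ (Sum.inr k) (Φ e (f a)))
  refine ⟨A.det, fun t => ∑ b, if g b = t then S b else 0, hfg, fun i => ?_⟩
  -- By maximality the nonzero minor of V bordered by row `i` and the u_k column vanishes for W.
  -- Restricted to u = 0, this puts the flow direction in the span of the derivatives of V after
  -- multiplication by `A.det`.
  have hdet : (Matrix.of fun p q => pderiv ℂ (Sum.elim (fun b => Sum.inl (g b))
      (fun _ => Sum.inr k) q : τ ⊕ κ) (W (Sum.elim f (fun _ => i) p)) :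
      Matrix (Fin r ⊕ Unit) (Fin r ⊕ Unit) (MvPowerSeries (τ ⊕ κ) ℂ)).det = 0 := by
    by_contra hne
    let eqv : Fin (r + 1) ≃ Fin r ⊕ Unit := (Fintype.equivFinOfCardEq (by simp)).symm
    refine hmax (τ ⊕ κ) W hW ⟨fun p => Sum.elim f (fun _ => i) (eqv p),
      fun q => Sum.elim (fun b => Sum.inl (g b)) (fun _ => Sum.inr k) (eqv q), ?_⟩
    rwa [← Matrix.det_submatrix_equiv_self eqv] at hne
  have hdet' := congrArg (substAlgHom (R := ℂ) hX0.hasSubst) hdet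
  rw [map_zero, AlgHom.map_det] at hdet'
  have hmat : (substAlgHom (R := ℂ) hX0.hasSubst).mapMatrix
      (Matrix.of fun p q => pderiv ℂ (Sum.elim (fun b => Sum.inl (g b))
      (fun _ => Sum.inr k) q : τ ⊕ κ) (W (Sum.elim f (fun _ => i) p)) :
      Matrix (Fin r ⊕ Unit) (Fin r ⊕ Unit) (MvPowerSeries (τ ⊕ κ) ℂ)) =
      Matrix.fromBlocks A
        (Matrix.of fun a (_ : Unit) => subst (Sum.elim V 0) (pderiv ℂ (Sum.inr k) (Φ e (f a))))
        (Matrix.of fun (_ : Unit) b => pderiv ℂ (g b) (V i))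
        (Matrix.of fun (_ _ : Unit) => subst (Sum.elim V 0) (pderiv ℂ (Sum.inr k) (Φ e i))) := by
    ext1 p q
    rw [AlgHom.mapMatrix_apply, Matrix.map_apply, Matrix.of_apply, coe_substAlgHom]
    rcases p with p | p <;> rcases q with q | q
    · exact hdl _ _
    · exact hdk _
    · exact hdl _ _
    · exact hdk _
  rw [hmat] at hdet'
  refine (det_mul_eq_of_bordered hfg hdet').trans ?_
  have hS : ∀ t, (∑ b, if g b = t then S b else 0) * pderiv ℂ t (V i) =
      ∑ b, if g b = t then S b * pderiv ℂ t (V i) else 0 := fun t => by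
    rw [Finset.sum_mul]
    exact Finset.sum_congr rfl fun b _ => by rw [ite_mul, zero_mul]
  rw [Finset.sum_congr rfl fun t _ => hS t, Finset.sum_comm]
  refine Finset.sum_congr rfl fun b _ => ?_
  rw [Finset.sum_ite_eq, if_pos (Finset.mem_univ _)]

/-! ### Tangential vector fields -/

/-- Up to the denominators q and p, the fields Y and Z are V-related to the parameter fields ξ/q and
η/p; their bracket is then V-related to [ξ/q, η/p]. -/
theorem IsAlong.bracket {N : ℕ} [Fintype τ] {V : Fin N ⊕ Fin N → MvPowerSeries τ ℂ}
    (hV : NoConst V) {Y Z : VF N} (hY : IsAlong V fun i => subst V (Y i))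
    (hZ : IsAlong V fun i => subst V (Z i)) :
    IsAlong V fun i => subst V (VF.bracket Y Z i) := by
  obtain ⟨q, ξ, hq, hξ⟩ := hY
  obtain ⟨p, η, hp, hη⟩ := hZ
  let D : (τ → MvPowerSeries τ ℂ) → Derivation ℂ (MvPowerSeries τ ℂ) (MvPowerSeries τ ℂ) :=
    fun ξ => ∑ k, ξ k • pderiv ℂ k
  have hD : ∀ ξ f, D ξ f = ∑ k, ξ k * pderiv ℂ k f := by
    intro ξ f
    have h : ⇑(D ξ) = ∑ k, ⇑(ξ k • pderiv ℂ k) := map_sum Derivation.coeFnAddMonoidHom _ _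
    simp only [h, Finset.sum_apply, Derivation.smul_apply, smul_eq_mul]
  have happ : ∀ {q : MvPowerSeries τ ℂ} {ξ : τ → MvPowerSeries τ ℂ} {Y : VF N},
      (∀ i, q * subst V (Y i) = ∑ k, ξ k * pderiv ℂ k (V i)) →
      ∀ f, q * subst V (VF.app Y f) = D ξ (subst V f) := by
    intro q ξ Y h f
    rw [hD, VF.app, subst_sum' hV, Finset.mul_sum]
    simp only [pderiv_subst hV, Finset.mul_sum]
    rw [Finset.sum_comm]
    refine Finset.sum_congr rfl fun i _ => ?_
    rw [subst_mul hV.hasSubst, ← mul_assoc, h i, Finset.sum_mul]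
    exact Finset.sum_congr rfl fun k _ => by ring
  have hcomm : ∀ f, D ξ (D η f) - D η (D ξ f) = D (fun k => D ξ (η k) - D η (ξ k)) f := by
    intro f
    have h1 : ∀ ξ η, D ξ (D η f) = ∑ k, D ξ (η k) * pderiv ℂ k f +
        ∑ k, ∑ l, η k * ξ l * pderiv ℂ l (pderiv ℂ k f) := by
      intro ξ η
      rw [hD η f, map_sum, ← Finset.sum_add_distrib]
      refine Finset.sum_congr rfl fun k _ => ?_
      rw [Derivation.leibniz, smul_eq_mul, smul_eq_mul, hD ξ (pderiv ℂ k f), Finset.mul_sum,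
        add_comm, mul_comm (pderiv ℂ k f)]
      simp only [mul_assoc]
    have h2 : ∑ k, ∑ l, η k * ξ l * pderiv ℂ l (pderiv ℂ k f) =
        ∑ k, ∑ l, ξ k * η l * pderiv ℂ l (pderiv ℂ k f) := by
      rw [Finset.sum_comm]
      refine Finset.sum_congr rfl fun k _ => Finset.sum_congr rfl fun l _ => ?_
      rw [pderiv_comm, mul_comm (η l)]
    rw [h1, h1, h2, hD (fun k => D ξ (η k) - D η (ξ k)) f]
    simp only [sub_mul, Finset.sum_sub_distrib]
    ring
  -- This is [ξ/q, η/p] with the denominators cleared by p²q².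
  refine ⟨p ^ 2 * q ^ 2, fun k => p * q * (D ξ (η k) - D η (ξ k)) - q * D ξ p * η k +
    p * D η q * ξ k, mul_ne_zero (pow_ne_zero _ hp) (pow_ne_zero _ hq), fun i => ?_⟩
  have e1 := happ hξ (Z i)
  have e2 := happ hη (Y i)
  have e3 := congrArg (D ξ) (hη i)
  have e4 := congrArg (D η) (hξ i)
  rw [Derivation.leibniz, smul_eq_mul, smul_eq_mul, ← hD η (V i)] at e3
  rw [Derivation.leibniz, smul_eq_mul, smul_eq_mul, ← hD ξ (V i)] at e4
  have e5 := hcomm (V i)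
  have e6 := hη i
  have e7 := hξ i
  rw [← hD] at e6 e7
  have e8 : ∑ k, (p * q * (D ξ (η k) - D η (ξ k)) - q * D ξ p * η k + p * D η q * ξ k) *
      pderiv ℂ k (V i) = p * q * D (fun k => D ξ (η k) - D η (ξ k)) (V i) -
        q * D ξ p * D η (V i) + p * D η q * D ξ (V i) := by
    simp only [hD _ (V i), Finset.mul_sum, ← Finset.sum_sub_distrib, ← Finset.sum_add_distrib]
    exact Finset.sum_congr rfl fun k _ => by ring
  rw [e8, ← e5]
  simp only [VF.bracket]
  rw [subst_sub hV.hasSubst]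
  linear_combination (p ^ 2 * q) * e1 - (q ^ 2 * p) * e2 + p * q * e3 - p * q * e4 -
    q * D ξ p * e6 + p * D η q * e7

/-- By multilinearity of the determinant in the columns, det(AB) is a combination of the n-column
minors of A, as in the Cauchy–Binet formula. -/
theorem exists_submatrix_det_ne_zero {R : Type} [CommRing R] [Fintype τ] {n : ℕ}
    {A : Matrix (Fin n) τ R} {B : Matrix τ (Fin n) R} (h : (A * B).det ≠ 0) :
    ∃ f : Fin n → τ, (A.submatrix id f).det ≠ 0 := by
  classical
  by_contra! hcon
  apply h
  have h1 : (A * B).transpose = fun l => ∑ k, B k l • A.transpose k := by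
    funext l
    ext m
    simp [Matrix.mul_apply, mul_comm]
  rw [← Matrix.det_transpose, h1]
  change Matrix.detRowAlternating.toMultilinearMap (fun l => ∑ k, B k l • A.transpose k) = 0
  rw [MultilinearMap.map_sum]
  refine Finset.sum_eq_zero fun f _ => ?_
  rw [MultilinearMap.map_smul_univ]
  have h2 := hcon f
  rw [← Matrix.det_transpose] at h2
  have h3 : (Matrix.detRowAlternating.toMultilinearMap fun i => A.transpose (f i)) = 0 := h2
  rw [h3, smul_zero]

/-- Follow V to the parameter x + y and return with the chain belonging to x. The composite sends y
= 0 to the origin, and its y-derivative at y = 0 is dV followed by a matrix that is the identity at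
x = 0. Since the directions `w l` lie along V and are independent at the origin in the components
`p`, the derivative has generic rank n there. -/
theorem exists_reach_submersion [Fintype σ] [Fintype κ] [Fintype τ]
    {Φ : ε → σ → MvPowerSeries (σ ⊕ κ) ℂ} (hΦ : ∀ e, IsFlow (Φ e)) {V : σ → MvPowerSeries τ ℂ}
    (hV : Reach Φ τ V) {n : ℕ} {w : Fin n → σ → MvPowerSeries τ ℂ} (hw : ∀ l, IsAlong V (w l))
    (p : Fin n → σ) (hp : ∀ l m, constantCoeff (w l (p m)) = if m = l then 1 else 0) :
    ∃ W : σ → MvPowerSeries (τ ⊕ Fin n) ℂ, Reach Φ (τ ⊕ Fin n) W ∧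
      (∀ i, subst (Sum.elim X 0 : τ ⊕ Fin n → MvPowerSeries τ ℂ) (W i) = 0) ∧
      (Matrix.of fun m l => subst (Sum.elim X 0 : τ ⊕ Fin n → MvPowerSeries τ ℂ)
        (pderiv ℂ (Sum.inr l) (W (p m)))).det ≠ 0 := by
  classical
  have hV0 := hV.noConst hΦ
  obtain ⟨Γ, hΓ, hΓV, hΓ0, hΓr⟩ := hV.exists_undo hΦ
  let xy : τ → MvPowerSeries (τ ⊕ τ) ℂ := fun k => X (Sum.inl k) + X (Sum.inr k)
  have hxy : NoConst xy := (noConst_X_comp Sum.inl).add (noConst_X_comp Sum.inr)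
  let b : τ → MvPowerSeries (τ ⊕ τ) ℂ := fun k => X (Sum.inl k)
  have hb : NoConst b := noConst_X_comp _
  have hVxy : NoConst (fun i => subst xy (V i)) := hV0.subst hxy
  have hbV := hb.sumElim hVxy
  -- U(x, y) = Γ(x, V(x + y)), so U(x, 0) = 0.
  let U : σ → MvPowerSeries (τ ⊕ τ) ℂ := fun i => subst (Sum.elim b fun i => subst xy (V i)) (Γ i)
  have hU : Reach Φ _ U := hΓr hb (fun _ => convergent_X _)
    (hV.subst hΦ hxy fun _ => (convergent_X _).add (convergent_X _))
  have hX0 : NoConst (Sum.elim X 0 : τ ⊕ τ → MvPowerSeries τ ℂ) := noConst_X.sumElim noConst_zero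
  have hXV : NoConst (Sum.elim X V : τ ⊕ σ → MvPowerSeries τ ℂ) := noConst_X.sumElim hV0
  have hsxy : ∀ f, subst (Sum.elim X 0 : τ ⊕ τ → MvPowerSeries τ ℂ) (subst xy f) = f := by
    intro f
    rw [subst_subst hxy hX0]
    conv_rhs => rw [← subst_X_self f]
    congr 1
    funext k
    simp only [xy]
    rw [subst_add hX0.hasSubst, subst_X' hX0, subst_X' hX0]
    simp
  have harg : (fun x => subst (Sum.elim X 0 : τ ⊕ τ → MvPowerSeries τ ℂ)
      (Sum.elim b (fun i => subst xy (V i)) x)) = Sum.elim X V := by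
    funext x
    rcases x with x | x
    · exact subst_X' hX0 _
    · exact hsxy _
  have hU0 : ∀ i, subst (Sum.elim X 0 : τ ⊕ τ → MvPowerSeries τ ℂ) (U i) = 0 := by
    intro i
    rw [subst_subst hbV hX0, harg, hΓV]
  let M : σ → σ → MvPowerSeries τ ℂ := fun i j => subst (Sum.elim X V) (pderiv ℂ (Sum.inr j) (Γ i))
  have hM : ∀ i j, constantCoeff (M i j) = if i = j then 1 else 0 := by
    intro i j
    have h0X : NoConst (Sum.elim 0 X : τ ⊕ σ → MvPowerSeries σ ℂ) := noConst_zero.sumElim noConst_X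
    have h1 := congrArg (fun f => constantCoeff (pderiv ℂ j f)) (hΓ0 i)
    simp only [pderiv_subst h0X, Fintype.sum_sum_type, Sum.elim_inl, Sum.elim_inr, Pi.zero_apply,
      map_zero, mul_zero, Finset.sum_const_zero, zero_add] at h1
    rw [Finset.sum_eq_single j, pderiv_X_self, mul_one, constantCoeff_subst' h0X] at h1
    · simp only [M]
      rw [constantCoeff_subst' hXV, h1]
      split_ifs with hij
      · rw [hij, pderiv_X_self, map_one]
      · rw [pderiv_X_of_ne hij, map_zero]
    · intro x _ hx
      rw [pderiv_X_of_ne hx, mul_zero]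
    · simp
  have hUd : ∀ i k, subst (Sum.elim X 0 : τ ⊕ τ → MvPowerSeries τ ℂ) (pderiv ℂ (Sum.inr k) (U i)) =
      ∑ j, M i j * pderiv ℂ k (V j) := by
    intro i k
    rw [pderiv_subst hbV, subst_sum' hX0, Fintype.sum_sum_type, Finset.sum_eq_zero, zero_add]
    · refine Finset.sum_congr rfl fun j _ => ?_
      rw [subst_mul hX0.hasSubst, subst_subst hbV hX0, harg]
      congr 1
      simp only [Sum.elim_inr]
      rw [pderiv_subst hxy, Finset.sum_eq_single k, subst_mul hX0.hasSubst, hsxy]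
      · simp only [xy]
        rw [map_add, pderiv_X_self, pderiv_X_of_ne (by simp), zero_add, subst_one' hX0, mul_one]
      · intro l _ hl
        simp only [xy]
        rw [map_add, pderiv_X_of_ne (by simp), pderiv_X_of_ne (by simpa using hl), add_zero,
          mul_zero]
      · simp
    · intro x _
      simp only [Sum.elim_inl, b]
      rw [pderiv_X_of_ne (by simp), mul_zero, subst_zero' hX0]
  choose q ξ hq hξ using hw
  let P : Matrix (Fin n) τ (MvPowerSeries τ ℂ) := Matrix.of fun m k =>
    subst (Sum.elim X 0 : τ ⊕ τ → MvPowerSeries τ ℂ) (pderiv ℂ (Sum.inr k) (U (p m)))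
  let B : Matrix (Fin n) (Fin n) (MvPowerSeries τ ℂ) := Matrix.of fun m l =>
    ∑ j, M (p m) j * w l j
  have hB : B.det ≠ 0 := by
    intro h0
    have h1 := congrArg constantCoeff h0
    rw [RingHom.map_det, map_zero] at h1
    have h2 : (constantCoeff (R := ℂ)).mapMatrix B = 1 := by
      ext m l
      rw [RingHom.mapMatrix_apply, Matrix.map_apply, Matrix.one_apply]
      simp only [B, Matrix.of_apply, map_sum, map_mul, hM, ite_mul, one_mul, zero_mul]
      rw [Finset.sum_ite_eq, if_pos (Finset.mem_univ _), hp]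
    rw [h2, Matrix.det_one] at h1
    exact one_ne_zero h1
  -- The derivative matrix, applied to the coefficients witnessing that `w l` lies along V, gives
  -- `B` with columns scaled by the nonzero `q l`; and `B` is the identity at the origin.
  have hPξ : P * (Matrix.of fun k l => ξ l k) = Matrix.of fun m l => q l * B m l := by
    ext1 m l
    simp only [Matrix.mul_apply, P, B, Matrix.of_apply, hUd, Finset.sum_mul, Finset.mul_sum]
    rw [Finset.sum_comm]
    refine Finset.sum_congr rfl fun j _ => ?_
    rw [mul_left_comm, hξ, Finset.mul_sum]
    exact Finset.sum_congr rfl fun k _ => by ring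
  have hdet : (P * (Matrix.of fun k l => ξ l k)).det ≠ 0 := by
    rw [hPξ, Matrix.det_mul_row]
    exact mul_ne_zero (Finset.prod_ne_zero_iff.2 fun l _ => hq l) hB
  obtain ⟨f, hf⟩ := exists_submatrix_det_ne_zero hdet
  -- Only the n directions of a nonvanishing minor are kept among the y variables, making the family
  -- square in the chosen components.
  let s : τ ⊕ τ → MvPowerSeries (τ ⊕ Fin n) ℂ :=
    Sum.elim (fun k => X (Sum.inl k)) fun k => ∑ l, if f l = k then X (Sum.inr l) else 0
  have hs : NoConst s := (noConst_X_comp _).sumElim fun k => by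
    rw [map_sum]
    refine Finset.sum_eq_zero fun l _ => ?_
    split_ifs
    · exact constantCoeff_X _
    · exact map_zero _
  have hsc : ∀ i, Convergent (s i) := Convergent.sumElim (fun _ => convergent_X _) fun k =>
    Convergent.sum fun l _ => by
      split_ifs
      · exact convergent_X _
      · exact convergent_zero
  have hX0' : NoConst (Sum.elim X 0 : τ ⊕ Fin n → MvPowerSeries τ ℂ) :=
    noConst_X.sumElim noConst_zero
  have hs0 : (fun x => subst (Sum.elim X 0 : τ ⊕ Fin n → MvPowerSeries τ ℂ) (s x)) =
      Sum.elim X 0 := by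
    funext x
    rcases x with x | x
    · exact subst_X' hX0' _
    · simp only [s, Sum.elim_inr]
      rw [subst_sum' hX0']
      refine Finset.sum_eq_zero fun l _ => ?_
      split_ifs
      · exact subst_X' hX0' _
      · exact subst_zero' hX0'
  refine ⟨fun i => subst s (U i), hU.subst hΦ hs hsc, fun i => ?_, ?_⟩
  · rw [subst_subst hs hX0', hs0, hU0]
  · convert hf using 2
    ext1 m l
    simp only [Matrix.of_apply, Matrix.submatrix_apply, id, P]
    rw [pderiv_subst hs, subst_sum' hX0', Finset.sum_eq_single (Sum.inr (f l))]
    · rw [subst_mul hX0'.hasSubst, subst_subst hs hX0', hs0]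
      simp only [s, Sum.elim_inr]
      rw [map_sum, Finset.sum_eq_single l, if_pos rfl, pderiv_X_self, subst_one' hX0', mul_one]
      · intro y _ hy
        split_ifs
        · exact pderiv_X_of_ne (by simpa using hy)
        · exact map_zero _
      · simp
    · rintro (x | x) _ hx
      · simp only [s, Sum.elim_inl]
        rw [pderiv_X_of_ne (by simp), mul_zero, subst_zero' hX0']
      · simp only [s, Sum.elim_inr]
        rw [map_sum, Finset.sum_eq_zero, mul_zero, subst_zero' hX0']
        intro y _
        split_ifs with h
        · refine pderiv_X_of_ne ?_
          rintro hyl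
          simp only [Sum.inr.injEq] at hyl
          exact hx (by rw [← h, hyl])
        · exact map_zero _
    · simp

/-! ### The flows of the tangent `(1,0)` and `(0,1)` directions -/

/-- Relabelling the variables preserves the flow laws; with the exchange of blocks this produces the
(1,0) flow. -/
theorem IsFlow.conjugate [Finite σ] [Finite κ] {Φ : σ → MvPowerSeries (σ ⊕ κ) ℂ} (h : IsFlow Φ)
    (e : σ ≃ σ) : IsFlow fun i => rename (Sum.map e id) (Φ (e.symm i)) where
  noConst := (h.noConst.rename _).comp e.symm
  convergent i := (h.convergent _).rename _
  zero i := by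
    have hX0 : NoConst (Sum.elim X 0 : σ ⊕ κ → MvPowerSeries σ ℂ) := noConst_X.sumElim noConst_zero
    have h1 := congrArg (rename e) (h.zero (e.symm i))
    rw [rename_subst hX0, rename_X, Equiv.apply_symm_apply] at h1
    rw [subst_rename _ hX0, ← h1]
    congr 1
    funext x
    rcases x with x | x
    · simp
    · simp
  inv i := by
    have hin : NoConst (Sum.elim Φ fun k => -X (Sum.inr k) : σ ⊕ κ → MvPowerSeries (σ ⊕ κ) ℂ) :=
      h.noConst.sumElim fun k => by simp
    have h1 := congrArg (rename (Sum.map e id)) (h.inv (e.symm i))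
    rw [rename_subst hin, rename_X] at h1
    simp only [Sum.map_inl, Equiv.apply_symm_apply] at h1
    rw [subst_rename]
    · rw [← h1]
      congr 1
      funext x
      rcases x with x | x
      · simp
      · simp
    · exact ((h.noConst.rename _).comp e.symm).sumElim fun k => by simp

section Flow

variable {N d : ℕ} [Fintype κ] {ρ : Fin d → Ser N} {c : κ → Fin N}
  {Θ : Fin N → MvPowerSeries (Fin N ⊕ (Fin d ⊕ κ)) ℂ}

/-- The argument `(Z, ρ(Z, ζ), ζ_c + a)`. -/
def flowArg (ρ : Fin d → Ser N) (c : κ → Fin N) :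
    Fin N ⊕ (Fin d ⊕ κ) → MvPowerSeries ((Fin N ⊕ Fin N) ⊕ κ) ℂ :=
  Sum.elim (fun x => X (Sum.inl (Sum.inl x))) (Sum.elim (fun j => rename Sum.inl (ρ j))
    fun k => X (Sum.inl (Sum.inr (c k))) + X (Sum.inr k))

/-- The flow `(Z, ζ) ↦ (Z, Θ(Z, ρ(Z, ζ), ζ_c + a))` along the tangent `(0,1)` directions. -/
def flow01 (ρ : Fin d → Ser N) (c : κ → Fin N)
    (Θ : Fin N → MvPowerSeries (Fin N ⊕ (Fin d ⊕ κ)) ℂ) :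
    Fin N ⊕ Fin N → MvPowerSeries ((Fin N ⊕ Fin N) ⊕ κ) ℂ :=
  Sum.elim (fun i => X (Sum.inl (Sum.inl i))) fun i => subst (flowArg ρ c) (Θ i)

omit [Fintype κ] in
theorem noConst_flowArg (h : NoConst ρ) : NoConst (flowArg ρ c) :=
  (noConst_X_comp _).sumElim ((h.rename _).sumElim
    ((noConst_X_comp fun k => Sum.inl (Sum.inr (c k))).add (noConst_X_comp Sum.inr)))

theorem IsStraight.noConst_flow01 (h : IsStraight ρ c Θ) : NoConst (flow01 ρ c Θ) :=
  (noConst_X_comp _).sumElim (h.noConst.subst (noConst_flowArg h.noConst_def))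

omit [Fintype κ] in
/-- Evaluation of the argument of the flow at `(V, a)`. -/
theorem subst_flowArg [Finite κ] {V : Fin N ⊕ Fin N → MvPowerSeries τ ℂ}
    {a : κ → MvPowerSeries τ ℂ} (hV : NoConst V) (ha : NoConst a) :
    (fun x => subst (Sum.elim V a) (flowArg ρ c x)) = Sum.elim (fun x => V (Sum.inl x))
      (Sum.elim (fun j => subst V (ρ j)) fun k => V (Sum.inr (c k)) + a k) := by
  have hVa := hV.sumElim ha
  funext x
  rcases x with x | x | x
  · exact subst_X' hVa _
  · simp only [flowArg, Sum.elim_inr, Sum.elim_inl]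
    rw [subst_rename _ hVa]
    rfl
  · simp only [flowArg, Sum.elim_inr]
    rw [subst_add hVa.hasSubst, subst_X' hVa, subst_X' hVa]
    rfl

theorem IsStraight.subst_flow01 (h : IsStraight ρ c Θ) {V : Fin N ⊕ Fin N → MvPowerSeries τ ℂ}
    {a : κ → MvPowerSeries τ ℂ} (hV : NoConst V) (ha : NoConst a) :
    (fun i => subst (Sum.elim V a) (flow01 ρ c Θ i)) = Sum.elim (fun x => V (Sum.inl x))
      fun i => subst (Sum.elim (fun x => V (Sum.inl x))
      (Sum.elim (fun j => subst V (ρ j)) fun k => V (Sum.inr (c k)) + a k)) (Θ i) := by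
  have hVa := hV.sumElim ha
  funext x
  rcases x with x | x
  · exact subst_X' hVa _
  · simp only [flow01, Sum.elim_inr]
    rw [subst_subst (noConst_flowArg h.noConst_def) hVa, subst_flowArg hV ha]

theorem IsStraight.subst_inv (h : IsStraight ρ c Θ) {V : Fin N ⊕ Fin N → MvPowerSeries τ ℂ}
    (hV : NoConst V) (i : Fin N) : subst (Sum.elim (fun x => V (Sum.inl x))
      (Sum.elim (fun j => subst V (ρ j)) fun k => V (Sum.inr (c k)))) (Θ i) = V (Sum.inr i) := by
  have h1 := congrArg (subst V) (h.subst_coord i)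
  rw [subst_subst h.noConst_coord hV, subst_X' hV] at h1
  rw [← h1]
  congr 1
  funext x
  rcases x with x | x | x
  · exact (subst_X' hV _).symm
  · rfl
  · exact (subst_X' hV _).symm

theorem IsStraight.subst_def (h : IsStraight ρ c Θ) {z : Fin N → MvPowerSeries τ ℂ}
    {r : Fin d → MvPowerSeries τ ℂ} {a : κ → MvPowerSeries τ ℂ} (hz : NoConst z) (hr : NoConst r)
    (ha : NoConst a) (j : Fin d) :
    subst (Sum.elim z fun i => subst (Sum.elim z (Sum.elim r a)) (Θ i)) (ρ j) = r j := by
  have hza := hz.sumElim (hr.sumElim ha)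
  have h1 := congrArg (subst (Sum.elim z (Sum.elim r a))) (h.eq_def j)
  rw [subst_subst ((noConst_X_comp _).sumElim h.noConst) hza, subst_X' hza] at h1
  simp only [Sum.elim_inr, Sum.elim_inl] at h1
  rw [← h1]
  congr 1
  funext x
  rcases x with x | x
  · exact (subst_X' hza (Sum.inl x)).symm
  · rfl

/-- The flow keeps the value r = ρ(Z, ζ) instead of setting r = 0. Thus ρ is a first integral, and
the flow is invertible on the ambient space, not only on the manifold. -/
theorem IsStraight.flow01_def (h : IsStraight ρ c Θ) (j : Fin d) :
    subst (flow01 ρ c Θ) (ρ j) = rename Sum.inl (ρ j) := by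
  have := h.subst_def (noConst_X_comp fun x => Sum.inl (Sum.inl x)) (h.noConst_def.rename Sum.inl)
    ((noConst_X_comp fun k => Sum.inl (Sum.inr (c k))).add (noConst_X_comp (Sum.inr : κ → _))) j
  exact this

theorem IsStraight.isFlow (h : IsStraight ρ c Θ) : IsFlow (flow01 ρ c Θ) where
  noConst := h.noConst_flow01
  convergent := by
    refine Convergent.sumElim (fun _ => convergent_X _) fun i => (h.convergent i).subst
      (noConst_flowArg h.noConst_def) ?_
    exact Convergent.sumElim (fun _ => convergent_X _) (Convergent.sumElim
      (fun j => (h.convergent_def j).rename _) fun _ => (convergent_X _).add (convergent_X _))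
  zero i := by
    have h1 := congrFun (h.subst_flow01 (τ := Fin N ⊕ Fin N) noConst_X
      (noConst_zero (σ := κ))) i
    rw [h1]
    rcases i with i | i
    · rfl
    · simp only [Sum.elim_inr, Pi.zero_apply, add_zero]
      exact h.subst_inv noConst_X i
  inv i := by
    have hna : NoConst (fun k : κ => (-X (Sum.inr k) : MvPowerSeries ((Fin N ⊕ Fin N) ⊕ κ) ℂ)) :=
      fun k => by simp
    have h1 := congrFun (h.subst_flow01 h.noConst_flow01 hna) i
    rw [h1]
    rcases i with i | i
    · rfl
    · have hr : (fun j => subst (flow01 ρ c Θ) (ρ j)) =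
          fun j => subst (fun x => (X (Sum.inl x) : MvPowerSeries ((Fin N ⊕ Fin N) ⊕ κ) ℂ)) (ρ j) := by
        funext j
        rw [h.flow01_def, rename_eq_subst']
      have hk : (fun k => flow01 ρ c Θ (Sum.inr (c k)) + -X (Sum.inr k)) =
          fun k => (X (Sum.inl (Sum.inr (c k))) : MvPowerSeries ((Fin N ⊕ Fin N) ⊕ κ) ℂ) := by
        funext k
        simp only [flow01, Sum.elim_inr]
        rw [h.eq_coord, subst_X' (noConst_flowArg h.noConst_def)]
        simp [flowArg]
      simp only [Sum.elim_inr]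
      rw [hr, hk]
      exact h.subst_inv (noConst_X_comp (Sum.inl : Fin N ⊕ Fin N → (Fin N ⊕ Fin N) ⊕ κ)) i

/-- Derivative of the flow along a map into the manifold. -/
theorem IsStraight.pderiv_flow01 (h : IsStraight ρ c Θ) {V : Fin N ⊕ Fin N → MvPowerSeries τ ℂ}
    (hV : NoConst V) (hVρ : ∀ j, subst V (ρ j) = 0) (k : κ) (i : Fin N) :
    subst (Sum.elim V 0) (pderiv ℂ (Sum.inr k) (flow01 ρ c Θ (Sum.inr i))) =
      subst (Sum.elim (fun x => V (Sum.inl x)) (Sum.elim 0 fun k => V (Sum.inr (c k))))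
        (pderiv ℂ (Sum.inr (Sum.inr k)) (Θ i)) := by
  have hV0 : NoConst (Sum.elim V 0 : _ ⊕ κ → MvPowerSeries τ ℂ) := hV.sumElim noConst_zero
  have hA := noConst_flowArg (c := c) h.noConst_def
  simp only [flow01, Sum.elim_inr]
  rw [pderiv_subst hA, Finset.sum_eq_single (Sum.inr (Sum.inr k))]
  · simp only [flowArg, Sum.elim_inr]
    rw [map_add, pderiv_X_self, pderiv_X_of_ne (by simp), zero_add, mul_one]
    change subst _ (subst (flowArg ρ c) _) = _
    rw [subst_subst hA hV0, subst_flowArg hV noConst_zero]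
    simp only [hVρ, Pi.zero_apply, add_zero]
    rfl
  · rintro (x | x | x) _ hx
    · simp only [flowArg, Sum.elim_inl]
      rw [pderiv_X_of_ne (by simp), mul_zero]
    · simp only [flowArg, Sum.elim_inl, Sum.elim_inr]
      rw [rename_eq_subst', pderiv_subst (noConst_X_comp _), Finset.sum_eq_zero, mul_zero]
      intro y _
      rw [pderiv_X_of_ne (by simp), mul_zero]
    · simp only [flowArg, Sum.elim_inr]
      rw [map_add, pderiv_X_of_ne (by simp), pderiv_X_of_ne (by simpa using hx), add_zero, mul_zero]
  · simp

/-- The flows along the `(0,1)` and the `(1,0)` directions. -/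
def crFlow (ρ : Fin d → Ser N) (c : κ → Fin N)
    (Θ : Fin N → MvPowerSeries (Fin N ⊕ (Fin d ⊕ κ)) ℂ) :
    Bool → Fin N ⊕ Fin N → MvPowerSeries ((Fin N ⊕ Fin N) ⊕ κ) ℂ
  | false => flow01 ρ c Θ
  | true => fun i => rename (Sum.map (Equiv.sumComm _ _) id)
      (flow01 (fun j => conj (ρ j)) c (fun i => conj (Θ i)) ((Equiv.sumComm _ _).symm i))

theorem IsStraight.isFlow_crFlow (h : IsStraight ρ c Θ) : ∀ e, IsFlow (crFlow ρ c Θ e)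
  | false => h.isFlow
  | true => h.conj.isFlow.conjugate _

theorem subst_comp_swap_conj (hρ : IsFormalGeneric ρ) {V : Fin N ⊕ Fin N → MvPowerSeries τ ℂ}
    (hV : NoConst V) (j : Fin d) :
    subst (fun i => V (Sum.swap i)) (conj (ρ j)) = subst V (ρ j) := by
  rw [hρ.conj_eq, subst_rename _ (hV.comp _)]
  simp

/-- A step along the `(1,0)` directions, seen after exchange of the two blocks. -/
theorem subst_crFlow_true
    {V : Fin N ⊕ Fin N → MvPowerSeries τ ℂ} {a : κ → MvPowerSeries τ ℂ} (hV : NoConst V)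
    (ha : NoConst a) (i : Fin N ⊕ Fin N) :
    subst (Sum.elim V a) (crFlow ρ c Θ true (Sum.swap i)) =
      subst (Sum.elim (fun i => V (Sum.swap i)) a)
        (flow01 (fun j => conj (ρ j)) c (fun i => conj (Θ i)) i) := by
  simp only [crFlow, Equiv.sumComm_symm, Equiv.sumComm_apply, Sum.swap_swap]
  rw [subst_rename _ (hV.sumElim ha)]
  congr 1
  funext x
  rcases x with x | x <;> rfl

/-- The chain starts at 0, where ρ vanishes, and both kinds of flow preserve ρ. The (1,0) case
reduces to the (0,1) case of the conjugate data by exchanging the blocks. -/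
theorem IsStraight.reach_mem (h : IsStraight ρ c Θ) (hρ : IsFormalGeneric ρ)
    {V : Fin N ⊕ Fin N → MvPowerSeries τ ℂ} (hV : Reach (crFlow ρ c Θ) τ V) (j : Fin d) :
    subst V (ρ j) = 0 := by
  induction hV generalizing j with
  | zero => exact subst_zero_of_constantCoeff_zero (h.noConst_def j)
  | step e hV ha hac ih =>
    rename_i V a
    have hV0 := hV.noConst h.isFlow_crFlow
    have key : ∀ {ρ : Fin d → Ser N} {Θ : Fin N → MvPowerSeries (Fin N ⊕ (Fin d ⊕ κ)) ℂ}
        (_ : IsStraight ρ c Θ) {V : Fin N ⊕ Fin N → MvPowerSeries τ ℂ} (_ : NoConst V) (j : Fin d),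
        subst (fun i => subst (Sum.elim V a) (flow01 ρ c Θ i)) (ρ j) = subst V (ρ j) := by
      intro ρ Θ h V hV j
      have h1 := congrArg (subst (Sum.elim V a)) (h.flow01_def j)
      rw [subst_subst h.noConst_flow01 (hV.sumElim ha), subst_rename _ (hV.sumElim ha)] at h1
      exact h1
    cases e
    · exact (key h hV0 j).trans (ih j)
    · rw [← subst_comp_swap_conj hρ (((h.isFlow_crFlow true).noConst.subst (hV0.sumElim ha)))]
      simp only [subst_crFlow_true hV0 ha]
      rw [key h.conj (hV0.comp _), subst_comp_swap_conj hρ hV0, ih j]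

end Flow

/-! ### Iterated reflection -/

theorem convergent_coe (p : MvPolynomial σ ℂ) : Convergent (p : MvPowerSeries σ ℂ) := by
  induction p using MvPolynomial.induction_on with
  | C a =>
    rw [MvPolynomial.coe_C]
    exact convergent_C a
  | add p q hp hq =>
    rw [MvPolynomial.coe_add]
    exact hp.add hq
  | mul_X p i hp =>
    rw [MvPolynomial.coe_mul, MvPolynomial.coe_X]
    exact hp.mul (convergent_X i)

theorem jetConv_one [Finite σ] (f : MvPowerSeries σ ℂ) : JetConv (fun _ => 1) f := fun k =>
  ⟨_, convergent_coe (truncTotal k f), sub_truncTotal_mem_ordIdeal k f⟩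

/-- The start of the iteration: at the origin the jets of an arbitrary formal series are
polynomials, so they converge for free. -/
theorem jetConv_shift_zero [Fintype τ] [Finite ι] (f : MvPowerSeries ι ℂ) :
    JetConv (jetWeight τ ι) (subst (shift (0 : ι → MvPowerSeries τ ℂ)) f) := by
  refine (jetConv_one f).subst (noConst_shift noConst_zero) (fun i => ?_) fun i => ?_
  · simp only [shift, Pi.zero_apply, map_zero, zero_add]
    exact (convergent_X _).jetConv _
  · simp only [shift, Pi.zero_apply, map_zero, zero_add]
    exact X_mem_ordIdeal (jetWeight τ ι) (Sum.inr i)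

theorem conj_sum {s : Finset ι} (f : ι → MvPowerSeries σ ℂ) :
    conj (∑ i ∈ s, f i) = ∑ i ∈ s, conj (f i) := map_sum (MvPowerSeries.map _) _ _

theorem conj_mul (f g : MvPowerSeries σ ℂ) : conj (f * g) = conj f * conj g :=
  map_mul (MvPowerSeries.map _) _ _

theorem segreJet_conj {N d N' d' : ℕ} [Finite κ] {Θ : Fin N → MvPowerSeries (Fin N ⊕ (Fin d ⊕ κ)) ℂ}
    (hΘ : NoConst Θ) (ρ' : Fin d' → Ser N') {G : Fin N' → MvPowerSeries (Fin N) ℂ} (hG : NoConst G)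
    (q : Fin d' × (κ →₀ ℕ)) (k : Fin N') :
    segreJet (fun i => conj (Θ i)) (fun j => conj (ρ' j)) (fun k => conj (G k)) q k =
      (starRingEnd ℂ) (segreJet Θ ρ' G q k) := by
  have hA : NoConst (Sum.elim 0 (Sum.elim 0 X) : Fin N ⊕ (Fin d ⊕ κ) → MvPowerSeries κ ℂ) :=
    noConst_zero.sumElim (noConst_zero.sumElim noConst_X)
  have hAc : (fun x => conj ((Sum.elim 0 (Sum.elim 0 X) :
      Fin N ⊕ (Fin d ⊕ κ) → MvPowerSeries κ ℂ) x)) =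
      (Sum.elim 0 (Sum.elim 0 X) : Fin N ⊕ (Fin d ⊕ κ) → MvPowerSeries κ ℂ) := by
    funext x
    rcases x with x | x | x
    · exact conj_zero
    · exact conj_zero
    · exact conj_X _
  have hGA : NoConst (fun k => subst (fun i => subst (Sum.elim 0 (Sum.elim 0 X)) (Θ i)) (G k) :
      Fin N' → MvPowerSeries κ ℂ) := hG.subst (hΘ.subst hA)
  simp only [segreJet]
  rw [← coeff_conj, conj_subst (noConst_zero.sumElim hGA), pderiv_conj]
  congr 2
  funext x
  rcases x with x | x
  · exact conj_zero.symm
  · simp only [Sum.elim_inr]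
    rw [conj_subst (hΘ.subst hA)]
    simp only [conj_subst hA, hAc]

section Reflect

variable {N d N' d' : ℕ} [Fintype κ] {ρ : Fin d → Ser N} {c : κ → Fin N}
  {Θ : Fin N → MvPowerSeries (Fin N ⊕ (Fin d ⊕ κ)) ℂ} {ρ' : Fin d' → Ser N'}
  {H : Fin N' → MvPowerSeries (Fin N) ℂ}

theorem MapsInto.mem (h : MapsInto ρ ρ' H) (j : Fin d') :
    subst (complexify H) (ρ' j) ∈ defIdeal ρ := by
  obtain ⟨a, ha⟩ := h.2
  rw [ha]
  exact Ideal.sum_mem _ fun k _ => Ideal.mul_mem_left _ _ (Ideal.subset_span ⟨k, rfl⟩)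

theorem MapsInto.conj_mem (h : MapsInto ρ ρ' H) (j : Fin d') :
    subst (Sum.elim (fun k => rename Sum.inl (conj (H k))) (fun k => rename Sum.inr (H k)))
      (conj (ρ' j)) ∈ defIdeal fun j => conj (ρ j) := by
  obtain ⟨hH, a, ha⟩ := h
  have hH0 : NoConst H := hH
  have h1 := congrArg conj (ha j)
  have hcx : NoConst (complexify H) := (hH0.rename _).sumElim (hH0.conj.rename _)
  rw [conj_subst hcx, conj_sum] at h1
  have h2 : (fun x => conj (complexify H x)) =
      Sum.elim (fun k => rename Sum.inl (conj (H k))) (fun k => rename Sum.inr (H k)) := by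
    funext x
    rcases x with x | x
    · exact conj_rename _ _
    · simp only [complexify, Sum.elim_inr, conj_rename, conj_conj]
  rw [← h2, h1]
  refine Ideal.sum_mem _ fun k _ => ?_
  rw [conj_mul]
  exact Ideal.mul_mem_left _ _ (Ideal.subset_span ⟨k, rfl⟩)

/-- Along the orbits of the flows all jets of `H` are convergent. -/
theorem IsStraight.reach_jetConv (h : IsStraight ρ c Θ) (hρ : IsFormalGeneric ρ)
    (hρ'c : ∀ j, Convergent (ρ' j)) (hH : MapsInto ρ ρ' H)
    (hspan : Submodule.span ℂ (Set.range (segreJet Θ ρ' fun k => FormalCR.conj (H k))) = ⊤)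
    [Fintype τ] {V : Fin N ⊕ Fin N → MvPowerSeries τ ℂ} (hV : Reach (crFlow ρ c Θ) τ V) :
    (∀ k, JetConv (jetWeight τ (Fin N)) (subst (shift fun i => V (Sum.inl i)) (H k))) ∧
    (∀ k, JetConv (jetWeight τ (Fin N))
      (subst (shift fun i => V (Sum.inr i)) (FormalCR.conj (H k)))) := by
  have hH0 : NoConst H := hH.1
  have hspan' : Submodule.span ℂ (Set.range (segreJet (fun i => FormalCR.conj (Θ i))
      (fun j => FormalCR.conj (ρ' j)) H)) = ⊤ := by
    have h1 := span_range_conj hspan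
    have h2 := segreJet_conj h.noConst ρ' hH0.conj
    simp only [conj_conj] at h2
    rw [← h1]
    congr 2
    funext q k
    exact h2 q k
  induction hV with
  | zero => exact ⟨fun k => jetConv_shift_zero _, fun k => jetConv_shift_zero _⟩
  | step e hV ha hac ih =>
    rename_i V a
    have hV0 := hV.noConst h.isFlow_crFlow
    have hW := hV.step e ha hac
    have hWρ := h.reach_mem hρ hW
    have hW0 := hW.noConst h.isFlow_crFlow
    have hWc := hW.convergent h.isFlow_crFlow
    have hVa := hV0.sumElim ha
    cases e
    -- A (0,1) step does not move Z, so the jets of H are inherited. Those of H̄ at the new ζ follow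
    -- by reflection with conjugated data and exchanged blocks. The (1,0) step is symmetric.
    · have hZ : ∀ i, subst (Sum.elim V a) (crFlow ρ c Θ false (Sum.inl i)) = V (Sum.inl i) :=
        fun i => subst_X' hVa _
      have h1 : ∀ k, JetConv (jetWeight τ (Fin N)) (subst (shift fun i =>
          subst (Sum.elim V a) (crFlow ρ c Θ false (Sum.inl i))) (H k)) := by
        simpa only [hZ] using ih.1
      refine ⟨h1, ?_⟩
      exact jetConv_reflection (V := fun i => subst (Sum.elim V a) (crFlow ρ c Θ false (Sum.swap i)))
        h.conj (fun j => (hρ'c j).conj) hH0.conj hH0 hH.conj_mem hspan' (hW0.comp _)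
        (fun i => hWc _) (fun j => (subst_comp_swap_conj hρ hW0 j).trans (hWρ j)) h1
    · have hζ : ∀ i, subst (Sum.elim V a) (crFlow ρ c Θ true (Sum.inr i)) = V (Sum.inr i) :=
        fun i => (subst_crFlow_true hV0 ha (Sum.inl i)).trans
          (subst_X' ((hV0.comp _).sumElim ha) _)
      have h1 : ∀ k, JetConv (jetWeight τ (Fin N)) (subst (shift fun i =>
          subst (Sum.elim V a) (crFlow ρ c Θ true (Sum.inr i))) (FormalCR.conj (H k))) := by
        simpa only [hζ] using ih.2
      refine ⟨?_, h1⟩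
      exact jetConv_reflection (V := fun i => subst (Sum.elim V a) (crFlow ρ c Θ true i)) (F := H)
        (G := fun k => FormalCR.conj (H k)) h hρ'c hH0 hH0.conj hH.mem hspan hW0 hWc hWρ h1

/-- The jet of order zero: setting s = 0 removes all positive weights, and what remains agrees
exactly with a convergent series. -/
theorem IsStraight.reach_convergent (h : IsStraight ρ c Θ) (hρ : IsFormalGeneric ρ)
    (hρ'c : ∀ j, Convergent (ρ' j)) (hH : MapsInto ρ ρ' H)
    (hspan : Submodule.span ℂ (Set.range (segreJet Θ ρ' fun k => FormalCR.conj (H k))) = ⊤)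
    [Fintype τ] {V : Fin N ⊕ Fin N → MvPowerSeries τ ℂ} (hV : Reach (crFlow ρ c Θ) τ V)
    (k : Fin N') : Convergent (subst (fun i => V (Sum.inl i)) (H k)) := by
  have hV0 := hV.noConst h.isFlow_crFlow
  have hX0 : NoConst (Sum.elim X 0 : τ ⊕ Fin N → MvPowerSeries τ ℂ) :=
    noConst_X.sumElim noConst_zero
  have h1 := ((h.reach_jetConv hρ hρ'c hH hspan hV).1 k).subst (w' := fun _ => 0) hX0
    (Sum.rec (fun i => (convergent_X i).jetConv _) fun i => convergent_zero.jetConv _)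
    (Sum.rec (fun i => mem_ordIdeal_zero _) fun i => Ideal.zero_mem _)
  rw [subst_subst (noConst_shift (hV0.comp _)) hX0] at h1
  have h2 : (fun i => subst (Sum.elim X 0 : τ ⊕ Fin N → MvPowerSeries τ ℂ)
      (shift (fun i => V (Sum.inl i)) i)) = fun i => V (Sum.inl i) := by
    funext i
    rw [shift, subst_add hX0.hasSubst, subst_rename _ hX0, subst_X' hX0]
    simp only [Sum.elim_inl, Sum.elim_inr, Pi.zero_apply, add_zero]
    exact subst_X_self _
  rw [h2] at h1
  exact h1.convergent

end Reflect

/-! ### Finite type -/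

section FiniteType

variable {N d : ℕ} [Fintype κ] {ρ : Fin d → Ser N} {c : κ → Fin N}
  {Θ : Fin N → MvPowerSeries (Fin N ⊕ (Fin d ⊕ κ)) ℂ}

theorem IsStraight.isAlong_type01 (h : IsStraight ρ c Θ) {Y : VF N} (hY : VF.IsType01 Y)
    (hYt : VF.IsTangent ρ Y) [Fintype τ] {V : Fin N ⊕ Fin N → MvPowerSeries τ ℂ} (hV : NoConst V)
    (hVρ : ∀ j, subst V (ρ j) = 0) {V' : Fin N ⊕ Fin N → MvPowerSeries τ ℂ}
    (hfl : ∀ k, IsAlong V' fun i => subst (Sum.elim V 0)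
      (pderiv ℂ (Sum.inr k) (flow01 ρ c Θ i))) :
    IsAlong V' fun i => subst V (Y i) := by
  have h1 : (fun i => subst V (Y i)) = fun i => ∑ k, subst V (Y (Sum.inr (c k))) *
      subst (Sum.elim V 0) (pderiv ℂ (Sum.inr k) (flow01 ρ c Θ i)) := by
    funext i
    rcases i with i | i
    · rw [hY, subst_zero' hV, Finset.sum_eq_zero]
      intro k _
      simp only [flow01, Sum.elim_inl]
      rw [pderiv_X_of_ne (by simp), subst_zero' (hV.sumElim noConst_zero), mul_zero]
    · rw [h.tangent_expand hY hYt hV hVρ]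
      exact Finset.sum_congr rfl fun k _ => by rw [h.pderiv_flow01 hV hVρ]
  rw [h1]
  exact IsAlong.sum fun k => (hfl k).mul _

theorem IsAlong.comp_equiv [Fintype τ] {V w : σ → MvPowerSeries τ ℂ} (e : ι → σ)
    (h : IsAlong V w) : IsAlong (fun i => V (e i)) fun i => w (e i) := by
  obtain ⟨q, ξ, hq, hw⟩ := h
  exact ⟨q, ξ, hq, fun i => hw (e i)⟩

/-- The fields tangential along V form a complex subspace closed under brackets. It contains 𝒟_M,
since tangent fields of either type are, along V, combinations of flow directions, which are
tangential by maximality of the rank. -/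
theorem IsStraight.isAlong_crLie (h : IsStraight ρ c Θ) (hρ : IsFormalGeneric ρ) [Fintype τ]
    {V : Fin N ⊕ Fin N → MvPowerSeries τ ℂ} (hV : Reach (crFlow ρ c Θ) τ V) {r : ℕ}
    (hr : HasMinor V r) (hmax : ∀ (υ : Type) [Fintype υ] (W : Fin N ⊕ Fin N → MvPowerSeries υ ℂ),
      Reach (crFlow ρ c Θ) υ W → ¬ HasMinor W (r + 1)) {Y : VF N} (hY : Y ∈ crLie ρ) :
    IsAlong V fun i => subst V (Y i) := by
  have hV0 := hV.noConst h.isFlow_crFlow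
  have hVρ := h.reach_mem hρ hV
  have hfl := isAlong_flow h.isFlow_crFlow hV hr hmax
  let S : Submodule ℂ (VF N) :=
    { carrier := {Y | IsAlong V fun i => subst V (Y i)}
      add_mem' := by
        intro Y Z hY hZ
        have := IsAlong.add hY hZ
        simp only [← subst_add hV0.hasSubst] at this
        exact this
      zero_mem' := by
        simp only [Set.mem_ofPred_eq, Pi.zero_apply, subst_zero' hV0]
        exact IsAlong.zero
      smul_mem' := by
        intro a Y hY
        have := IsAlong.mul hY (C a)
        simp only [Set.mem_ofPred_eq, Pi.smul_apply, smul_eq_C_mul, subst_mul hV0.hasSubst, subst_C]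
        exact this }
  have hS : crLie ρ ≤ S := by
    refine sInf_le ⟨?_, fun Y hY Z hZ => IsAlong.bracket hV0 hY hZ⟩
    intro Y hY
    change IsAlong V fun i => subst V (Y i)
    refine Submodule.span_induction (p := fun Y _ => IsAlong V fun i => subst V (Y i))
      ?_ ?_ ?_ ?_ hY
    · rintro Y ⟨hYt, hY | hY⟩
      · have h1 := hYt.swap
        have h2 : IsAlong (fun i => V (Sum.swap i)) fun i =>
            subst (fun i => V (Sum.swap i)) (swapVF Y i) := by
          refine h.conj.isAlong_type01 (fun j => ?_) (by simpa only [hρ.conj_eq] using h1)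
            (hV0.comp _) (fun j => (subst_comp_swap_conj hρ hV0 j).trans (hVρ j)) fun k => ?_
          · simp [swapVF, hY j]
          · have h3 := (hfl true k).comp_equiv (Sum.swap : Fin N ⊕ Fin N → Fin N ⊕ Fin N)
            convert h3 using 2
            rename_i i
            simp only [crFlow, Equiv.sumComm_symm, Equiv.sumComm_apply, Sum.swap_swap]
            have h4 := pderiv_rename_equiv (Equiv.sumCongr (Equiv.sumComm (Fin N) (Fin N))
              (Equiv.refl κ)) (flow01 (fun j => FormalCR.conj (ρ j)) c
                (fun i => FormalCR.conj (Θ i)) i) (Sum.inr k)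
            have h5 : (pderiv ℂ (Sum.inr k)) (rename (Sum.map Sum.swap id)
              (flow01 (fun j => FormalCR.conj (ρ j)) c (fun i => FormalCR.conj (Θ i)) i)) =
              rename (Sum.map Sum.swap id) (pderiv ℂ (Sum.inr k)
                (flow01 (fun j => FormalCR.conj (ρ j)) c (fun i => FormalCR.conj (Θ i)) i)) := h4
            rw [h5, subst_rename _ (hV0.sumElim noConst_zero)]
            congr 1
            funext x
            rcases x with x | x <;> rfl
        have h3 := h2.comp_equiv (Sum.swap : Fin N ⊕ Fin N → Fin N ⊕ Fin N)
        simp only [swapVF, Sum.swap_swap] at h3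
        convert h3 using 2
        rw [subst_rename _ (hV0.comp _)]
        simp only [Sum.swap_swap]
      · exact h.isAlong_type01 hY hYt hV0 hVρ (hfl false)
    · simp only [Pi.zero_apply, subst_zero' hV0]
      exact IsAlong.zero
    · intro Y Z _ _ hY hZ
      simp only [Pi.add_apply, subst_add hV0.hasSubst]
      exact hY.add hZ
    · intro f Y _ hY
      simp only [Pi.smul_apply, smul_eq_mul, subst_mul hV0.hasSubst]
      exact hY.mul _
  exact hS hY

end FiniteType

section FiniteType

variable {N d : ℕ} [Fintype κ] {ρ : Fin d → Ser N} {c : κ → Fin N}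
  {Θ : Fin N → MvPowerSeries (Fin N ⊕ (Fin d ⊕ κ)) ℂ}

omit [Fintype κ] in
/-- The tangent space at `0` contains a vector with given `Z` component. -/
theorem IsStraight.pderiv_def_inl (h : IsStraight ρ c Θ) (j : Fin d) (l : Fin N) :
    constantCoeff (pderiv ℂ (Sum.inl l) (ρ j)) + ∑ i, constantCoeff (pderiv ℂ (Sum.inr i) (ρ j)) *
      constantCoeff (pderiv ℂ (Sum.inl l) (Θ i)) = 0 := by
  have hXΘ : NoConst (Sum.elim (fun x => X (Sum.inl x)) Θ :
    Fin N ⊕ Fin N → MvPowerSeries (Fin N ⊕ (Fin d ⊕ κ)) ℂ) := (noConst_X_comp _).sumElim h.noConst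
  have h1 := congrArg (fun f => constantCoeff (pderiv ℂ (Sum.inl l) f)) (h.eq_def j)
  simp only [pderiv_subst hXΘ, Fintype.sum_sum_type, map_add, map_sum, map_mul,
    constantCoeff_subst' hXΘ, Sum.elim_inl, Sum.elim_inr] at h1
  rw [Finset.sum_eq_single l, pderiv_X_self, map_one, mul_one, pderiv_X_of_ne (by simp),
    map_zero] at h1
  · exact h1
  · intro x _ hx
    rw [pderiv_X_of_ne (by simpa using hx), map_zero, mul_zero]
  · simp

/-- If f∘V = 0, the chain rule kills every derivative of f along V, and the nonzero factor cancels.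
With f = ρ_j this places 𝔤_M(0) inside the kernel of dρ(0). -/
theorem constantCoeff_app_eq_zero [Fintype τ] {V : Fin N ⊕ Fin N → MvPowerSeries τ ℂ}
    (hV : NoConst V) {f : Ser N} (hf : subst V f = 0) {Y : VF N}
    (hY : IsAlong V fun i => subst V (Y i)) : constantCoeff (VF.app Y f) = 0 := by
  obtain ⟨q, ξ, hq, hξ⟩ := hY
  have h1 : q * subst V (VF.app Y f) = 0 := by
    rw [VF.app, subst_sum' hV, Finset.mul_sum]
    have h2 : ∀ k, ∑ i, subst V (pderiv ℂ i f) * pderiv ℂ k (V i) = 0 := by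
      intro k
      rw [← pderiv_subst hV, hf, map_zero]
    have h3 : ∀ i, q * subst V (Y i * pderiv ℂ i f) =
        ∑ k, ξ k * (subst V (pderiv ℂ i f) * pderiv ℂ k (V i)) := by
      intro i
      rw [subst_mul hV.hasSubst, ← mul_assoc, hξ i, Finset.sum_mul]
      exact Finset.sum_congr rfl fun k _ => by ring
    rw [Finset.sum_congr rfl fun i _ => h3 i, Finset.sum_comm]
    refine Finset.sum_eq_zero fun k _ => ?_
    rw [← Finset.mul_sum, h2, mul_zero]
  have h2 := (mul_eq_zero.1 h1).resolve_left hq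
  rw [← constantCoeff_subst' hV, h2, map_zero]

omit [Fintype κ] in
-- 𝔤_M(0) lies in the kernel of dρ(0), which has dimension 2N − d by genericity, so finite type
-- gives equality. That kernel contains the vectors (e_l, ∂Θ/∂Z_l(0)) and hence projects onto the Z
-- space.
theorem IsStraight.exists_crLie (h : IsStraight ρ c Θ) (hρ : IsFormalGeneric ρ)
    (hfin : FiniteType ρ) [Fintype τ] {V : Fin N ⊕ Fin N → MvPowerSeries τ ℂ} (hV : NoConst V)
    (hVρ : ∀ j, subst V (ρ j) = 0) (hal : ∀ Y ∈ crLie ρ, IsAlong V fun i => subst V (Y i))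
    (l : Fin N) :
    ∃ Y ∈ crLie ρ, ∀ m, constantCoeff (Y (Sum.inl m)) = if m = l then 1 else 0 := by
  classical
  let J : Matrix (Fin d) (Fin N ⊕ Fin N) ℂ := Matrix.of fun j i => constantCoeff (pderiv ℂ i (ρ j))
  have hJ : ∀ v j, J.mulVec v j = ∑ i, constantCoeff (pderiv ℂ i (ρ j)) * v i := fun v j => rfl
  have hle : crLieAt ρ ≤ LinearMap.ker J.mulVecLin := by
    rintro _ ⟨Y, hY, rfl⟩
    rw [LinearMap.mem_ker]
    funext j
    rw [Matrix.mulVecLin_apply, hJ]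
    have h1 := constantCoeff_app_eq_zero hV (hVρ j) (hal Y hY)
    rw [VF.app, map_sum] at h1
    rw [Pi.zero_apply, ← h1]
    exact Finset.sum_congr rfl fun i _ => by rw [map_mul, mul_comm]; rfl
  have hrank : J.rank = d := by
    have : LinearIndependent ℂ J.row := by
      refine LinearIndependent.of_comp (LinearMap.funLeft ℂ ℂ Sum.inl) ?_
      exact hρ.generic
    simpa using this.rank_matrix
  have heq : crLieAt ρ = LinearMap.ker J.mulVecLin := by
    refine Submodule.eq_of_le_of_finrank_eq hle ?_
    have h1 := LinearMap.finrank_range_add_finrank_ker J.mulVecLin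
    have h2 : Module.finrank ℂ (LinearMap.range J.mulVecLin) = d := hrank
    have h3 : Module.finrank ℂ (crLieAt ρ) + d = 2 * N := hfin
    simp only [Module.finrank_fintype_fun_eq_card, Fintype.card_sum, Fintype.card_fin] at h1
    omega
  have hv : (Sum.elim (Pi.single l 1) fun i => constantCoeff (pderiv ℂ (Sum.inl l) (Θ i)) :
      Fin N ⊕ Fin N → ℂ) ∈ crLieAt ρ := by
    rw [heq, LinearMap.mem_ker]
    funext j
    rw [Matrix.mulVecLin_apply, hJ, Fintype.sum_sum_type, Pi.zero_apply, ← h.pderiv_def_inl j l]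
    simp [Pi.single_apply]
  obtain ⟨Y, hY, hYv⟩ := hv
  refine ⟨Y, hY, fun m => ?_⟩
  have h1 := congrFun hYv (Sum.inl m)
  simp only [Sum.elim_inl, Pi.single_apply] at h1
  exact h1

/-- At a point of finite type the orbit of the flows covers the space of the `Z` variables. -/
theorem IsStraight.exists_reach (h : IsStraight ρ c Θ) (hρ : IsFormalGeneric ρ)
    (hfin : FiniteType ρ) :
    ∃ (τ : Type) (_ : Fintype τ) (W : Fin N ⊕ Fin N → MvPowerSeries (τ ⊕ Fin N) ℂ),
      Reach (crFlow ρ c Θ) (τ ⊕ Fin N) W ∧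
      (∀ i, subst (Sum.elim X 0 : τ ⊕ Fin N → MvPowerSeries τ ℂ) (W i) = 0) ∧
      (Matrix.of fun m l => subst (Sum.elim X 0 : τ ⊕ Fin N → MvPowerSeries τ ℂ)
        (pderiv ℂ (Sum.inr l) (W (Sum.inl m)))).det ≠ 0 := by
  obtain ⟨r, τ, _, V, hV, hr, hmax⟩ := exists_reach_hasMinor_maximal (crFlow ρ c Θ)
  have hV0 := hV.noConst h.isFlow_crFlow
  have hal := fun Y (hY : Y ∈ crLie ρ) => h.isAlong_crLie hρ hV hr hmax hY
  choose Y hY hYl using h.exists_crLie hρ hfin hV0 (h.reach_mem hρ hV) hal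
  obtain ⟨W, hW⟩ := exists_reach_submersion h.isFlow_crFlow hV (fun l => hal _ (hY l)) Sum.inl
    fun l m => by rw [constantCoeff_subst' hV0, hYl]
  exact ⟨τ, inferInstance, W, hW⟩

end FiniteType

/-! ### Sums of convergent power series -/

theorem summable_of_tsum_enorm_ne_top {f : ι → ℂ} (h : ∑' i, ‖f i‖ₑ ≠ ⊤) : Summable f := by
  refine Summable.of_norm ?_
  have h1 : Summable fun i => ‖f i‖₊ := ENNReal.tsum_coe_ne_top_iff_summable.1 h
  exact (NNReal.summable_coe (f := fun i => ‖f i‖₊)).2 h1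

theorem enorm_tsum_le (f : ι → ℂ) : ‖∑' i, f i‖ₑ ≤ ∑' i, ‖f i‖ₑ := by
  by_cases h : ∑' i, ‖f i‖ₑ = ⊤
  · rw [h]
    exact le_top
  · have h1 : Summable fun i => ‖f i‖₊ := ENNReal.tsum_coe_ne_top_iff_summable.1 h
    have h2 : (∑' i, ‖f i‖ₑ) = ((∑' i, ‖f i‖₊ : ℝ≥0) : ℝ≥0∞) := (ENNReal.coe_tsum h1).symm
    rw [h2, enorm_eq_nnnorm, ENNReal.coe_le_coe]
    exact nnnorm_tsum_le h1

/-- The radii of a point. -/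
def radii (x : σ → ℂ) (i : σ) : ℝ≥0∞ := ‖x i‖ₑ

section Value

variable [Fintype σ]

theorem term_eq (f : MvPowerSeries σ ℂ) (x : σ → ℂ) (n : σ →₀ ℕ) :
    term f x n = coeff n f * n.prod fun i k => x i ^ k := by
  rw [term, Finsupp.prod_fintype _ _ fun i => pow_zero _]

theorem enorm_term (f : MvPowerSeries σ ℂ) (x : σ → ℂ) (n : σ →₀ ℕ) :
    ‖term f x n‖ₑ = ‖coeff n f‖ₑ * mon (radii x) n := by
  have h : ∀ s : Finset σ, ‖∏ i ∈ s, x i ^ n i‖ₑ = ∏ i ∈ s, radii x i ^ n i := by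
    classical
    intro s
    induction s using Finset.induction_on with
    | empty => simp
    | insert a s ha ih => rw [Finset.prod_insert ha, Finset.prod_insert ha, enorm_mul, ih, enorm_pow,
        radii]
  rw [term_eq, enorm_mul, mon, Finsupp.prod, Finsupp.prod, h]

theorem summable_term {f : MvPowerSeries σ ℂ} {x : σ → ℂ} (h : wnorm (radii x) f ≠ ⊤) :
    Summable (term f x) := by
  refine summable_of_tsum_enorm_ne_top ?_
  simp only [enorm_term]
  exact h

theorem hasSum_value {f : MvPowerSeries σ ℂ} {x : σ → ℂ} (h : wnorm (radii x) f ≠ ⊤) :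
    HasSum (term f x) (value f x) := (summable_term h).hasSum

theorem enorm_value_le (f : MvPowerSeries σ ℂ) (x : σ → ℂ) : ‖value f x‖ₑ ≤ wnorm (radii x) f := by
  refine (enorm_tsum_le _).trans ?_
  simp only [enorm_term]
  exact le_rfl

theorem value_add {f g : MvPowerSeries σ ℂ} {x : σ → ℂ} (hf : wnorm (radii x) f ≠ ⊤)
    (hg : wnorm (radii x) g ≠ ⊤) : value (f + g) x = value f x + value g x := by
  rw [value, value, value, ← (summable_term hf).tsum_add (summable_term hg)]
  simp only [term, map_add, add_mul]

theorem value_neg (f : MvPowerSeries σ ℂ) (x : σ → ℂ) : value (-f) x = -value f x := by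
  rw [value, value, ← tsum_neg]
  simp only [term, map_neg, neg_mul]

theorem value_monomial (n : σ →₀ ℕ) (a : ℂ) (x : σ → ℂ) :
    value (monomial n a) x = a * n.prod fun i k => x i ^ k := by
  classical
  rw [value, tsum_eq_single n]
  · rw [term_eq, coeff_monomial_same]
  · intro m hm
    rw [term, coeff_monomial, if_neg hm, zero_mul]

theorem value_C (a : ℂ) (x : σ → ℂ) : value (C a : MvPowerSeries σ ℂ) x = a := by
  rw [← monomial_zero_eq_C_apply, value_monomial]
  simp

theorem value_X (i : σ) (x : σ → ℂ) : value (X i : MvPowerSeries σ ℂ) x = x i := by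
  rw [X, value_monomial]
  simp

theorem value_zero (x : σ → ℂ) : value (0 : MvPowerSeries σ ℂ) x = 0 := by
  simp [value, term]

theorem value_mul {f g : MvPowerSeries σ ℂ} {x : σ → ℂ} (hf : wnorm (radii x) f ≠ ⊤)
    (hg : wnorm (radii x) g ≠ ⊤) : value (f * g) x = value f x * value g x := by
  classical
  have hs : Summable fun p : (σ →₀ ℕ) × (σ →₀ ℕ) => term f x p.1 * term g x p.2 :=
    summable_mul_of_summable_norm (summable_term hf).norm (summable_term hg).norm
  rw [value, value, value, (summable_term hf).tsum_mul_tsum_eq_tsum_sum_antidiagonal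
    (summable_term hg) hs]
  refine tsum_congr fun n => ?_
  rw [term_eq, coeff_mul, Finset.sum_mul]
  refine Finset.sum_congr rfl fun p hp => ?_
  rw [← Finset.HasAntidiagonal.mem_antidiagonal.1 hp, term_eq, term_eq,
    Finsupp.prod_add_index' (fun i => pow_zero _) fun i k l => pow_add _ _ _]
  ring

omit [Fintype σ] in
theorem wnorm_pow_ne_top {r : σ → ℝ≥0∞} {f : MvPowerSeries σ ℂ} (hf : wnorm r f ≠ ⊤) (k : ℕ) :
    wnorm r (f ^ k) ≠ ⊤ := ne_top_of_le_ne_top (ENNReal.pow_ne_top hf) (wnorm_pow_le _ _ _)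

theorem value_pow {f : MvPowerSeries σ ℂ} {x : σ → ℂ} (hf : wnorm (radii x) f ≠ ⊤) (k : ℕ) :
    value (f ^ k) x = value f x ^ k := by
  induction k with
  | zero => rw [pow_zero, pow_zero, ← map_one C, value_C]
  | succ k ih => rw [pow_succ, pow_succ, value_mul (wnorm_pow_ne_top hf k) hf, ih]

theorem value_prod {s : Finset ι} {f : ι → MvPowerSeries σ ℂ} {x : σ → ℂ}
    (hf : ∀ i ∈ s, wnorm (radii x) (f i) ≠ ⊤) :
    value (∏ i ∈ s, f i) x = ∏ i ∈ s, value (f i) x := by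
  classical
  induction s using Finset.induction_on with
  | empty => rw [Finset.prod_empty, Finset.prod_empty, ← map_one C, value_C]
  | insert a s ha ih =>
    rw [Finset.prod_insert ha, Finset.prod_insert ha, value_mul (hf a (Finset.mem_insert_self _ _)),
      ih fun i hi => hf i (Finset.mem_insert_of_mem hi)]
    exact ne_top_of_le_ne_top (ENNReal.prod_ne_top fun i hi => hf i (Finset.mem_insert_of_mem hi))
      (wnorm_prod_le _ _ _)

omit [Fintype σ] in
theorem value_prod_pow [Fintype τ] {g : σ → MvPowerSeries τ ℂ} {x : τ → ℂ}
    (hg : ∀ i, wnorm (radii x) (g i) ≠ ⊤) (d : σ →₀ ℕ) :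
    value (d.prod fun s k => g s ^ k) x = d.prod fun s k => value (g s) x ^ k := by
  rw [Finsupp.prod, Finsupp.prod, value_prod fun i _ => wnorm_pow_ne_top (hg i) _]
  exact Finset.prod_congr rfl fun i _ => value_pow (hg i) _

/-- The double family of terms is absolutely summable by the majorant bound, so it may be summed in
either order. -/
theorem value_subst [Fintype τ] {g : σ → MvPowerSeries τ ℂ} (h0 : NoConst g) {x : τ → ℂ}
    (hg : ∀ i, wnorm (radii x) (g i) ≠ ⊤) {f : MvPowerSeries σ ℂ}
    (hf : wnorm (fun i => wnorm (radii x) (g i)) f ≠ ⊤) :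
    value (subst g f) x = value f fun i => value (g i) x := by
  let F : (σ →₀ ℕ) → (τ →₀ ℕ) → ℂ := fun d e =>
    coeff d f * term (d.prod fun s k => g s ^ k) x e
  have hF : Summable (Function.uncurry F) := by
    refine summable_of_tsum_enorm_ne_top (ne_top_of_le_ne_top hf ?_)
    refine (ENNReal.tsum_prod (f := fun d e => ‖F d e‖ₑ)).trans_le ?_
    refine ENNReal.tsum_le_tsum fun d => ?_
    simp only [F, enorm_mul, ENNReal.tsum_mul_left, enorm_term]
    exact mul_le_mul_right (wnorm_prod_pow_le _ g d) _
  have h1 : ∀ d, ∑' e, F d e = term f (fun i => value (g i) x) d := by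
    intro d
    simp only [F]
    rw [tsum_mul_left, term_eq, ← value_prod_pow hg]
    rfl
  have h2 : ∀ e, ∑' d, F d e = term (subst g f) x e := by
    intro e
    simp only [F, term]
    rw [coeff_subst h0.hasSubst, ← tsum_eq_finsum (L := SummationFilter.unconditional _) (coeff_subst_finite h0.hasSubst f e),
      ← tsum_mul_right]
    exact tsum_congr fun d => by rw [smul_eq_mul, mul_assoc]
  have h3 := hF.tsum_comm
  simp only [h1, h2] at h3
  exact h3

theorem value_conj (f : MvPowerSeries σ ℂ) (x : σ → ℂ) :
    value (conj f) (fun i => (starRingEnd ℂ) (x i)) = (starRingEnd ℂ) (value f x) := by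
  rw [value, value, Complex.conj_tsum]
  refine tsum_congr fun n => ?_
  rw [term, term, coeff_conj, map_mul, map_prod]
  simp only [map_pow]

theorem value_zero_right (f : MvPowerSeries σ ℂ) : value f 0 = constantCoeff f := by
  classical
  rw [value, tsum_eq_single 0]
  · simp [term]
  · intro n hn
    obtain ⟨i, hi⟩ := Finsupp.ne_iff.1 hn
    rw [term, Finset.prod_eq_zero (Finset.mem_univ i), mul_zero]
    exact zero_pow hi

end Value

/-! ### Behaviour near the origin -/

section Near

variable [Fintype σ] [Fintype τ]

theorem eventually_radii_le {ε : ℝ≥0∞} (hε : ε ≠ 0) :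
    ∀ᶠ x : σ → ℂ in 𝓝 0, radii x ≤ fun _ => ε := by
  simp only [Pi.le_def]
  rw [eventually_all]
  intro i
  have h1 : Tendsto (fun x : σ → ℂ => ‖x i‖ₑ) (𝓝 0) (𝓝 0) := by
    have : Continuous fun x : σ → ℂ => ‖x i‖ₑ := by fun_prop
    simpa using this.tendsto 0
  exact (h1.eventually_lt_const (pos_iff_ne_zero.2 hε)).mono fun x hx => hx.le

theorem Convergent.eventually_ne_top {f : MvPowerSeries σ ℂ} (hf : Convergent f) :
    ∀ᶠ x : σ → ℂ in 𝓝 0, wnorm (radii x) f ≠ ⊤ := by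
  obtain ⟨ε, hε, h⟩ := convergent_iff.1 hf
  exact (eventually_radii_le hε).mono fun x hx => ne_top_of_le_ne_top h (wnorm_mono hx f)

theorem Convergent.eventually_value_subst {f : MvPowerSeries σ ℂ} (hf : Convergent f)
    {g : σ → MvPowerSeries τ ℂ} (h0 : NoConst g) (hg : ∀ i, Convergent (g i)) :
    ∀ᶠ x : τ → ℂ in 𝓝 0, value (MvPowerSeries.subst g f) x = value f fun i => value (g i) x := by
  obtain ⟨η, hη, h⟩ := convergent_iff.1 hf
  obtain ⟨ε, hε, -, hle⟩ := Convergent.exists_wnorm_le hg h0 hη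
  have h1 : ∀ᶠ x : τ → ℂ in 𝓝 0, ∀ i, wnorm (radii x) (g i) ≠ ⊤ :=
    eventually_all.2 fun i => (hg i).eventually_ne_top
  filter_upwards [h1, eventually_radii_le hε] with x hx hxε
  exact value_subst h0 hx (ne_top_of_le_ne_top h
    (wnorm_mono (fun i => (wnorm_mono hxε _).trans (hle i)) f))

theorem Convergent.eventually_value_add {f g : MvPowerSeries σ ℂ} (hf : Convergent f)
    (hg : Convergent g) : ∀ᶠ x : σ → ℂ in 𝓝 0, value (f + g) x = value f x + value g x := by
  filter_upwards [hf.eventually_ne_top, hg.eventually_ne_top] with x h1 h2 using value_add h1 h2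

theorem Convergent.tendsto_value {f : MvPowerSeries σ ℂ} (hf : Convergent f)
    (h0 : constantCoeff f = 0) : Tendsto (value f) (𝓝 0) (𝓝 0) := by
  rw [tendsto_zero_iff_enorm_tendsto_zero, ENNReal.tendsto_nhds_zero]
  intro η hη
  obtain ⟨ε, hε, -, hle⟩ := Convergent.exists_wnorm_le (υ := Unit) (f := fun _ => f)
    (fun _ => hf) (fun _ => h0) hη.ne'
  filter_upwards [eventually_radii_le hε] with x hx
  exact (enorm_value_le f x).trans ((wnorm_mono hx f).trans (hle ()))

omit [Fintype σ] in
theorem tendsto_value_tuple {g : σ → MvPowerSeries τ ℂ} (h0 : NoConst g)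
    (hg : ∀ i, Convergent (g i)) : Tendsto (fun x i => value (g i) x) (𝓝 0) (𝓝 (0 : σ → ℂ)) :=
  tendsto_pi_nhds.2 fun i => (hg i).tendsto_value (h0 i)

end Near

/-! ### Convergent series and analytic functions -/

theorem exists_word [Fintype σ] (n : ℕ) (α : σ →₀ ℕ) (h : α.degree = n) :
    ∃ w : Fin n → σ, ∀ y : σ → ℂ, ∏ k, y (w k) = ∏ i, y i ^ α i := by
  classical
  induction n generalizing α with
  | zero =>
    rw [Finsupp.degree_eq_zero_iff] at h
    exact ⟨Fin.elim0, fun y => by simp [h]⟩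
  | succ n ih =>
    have hα : α ≠ 0 := by
      rintro rfl
      simp at h
    obtain ⟨i, hi⟩ := Finsupp.ne_iff.1 hα
    have hsum : α - Finsupp.single i 1 + Finsupp.single i 1 = α :=
      tsub_add_cancel_of_le (by simpa [Finsupp.single_le_iff, Nat.one_le_iff_ne_zero] using hi)
    have hdeg : (α - Finsupp.single i 1).degree = n := by
      have := congrArg Finsupp.degree hsum
      rw [map_add, Finsupp.degree_single, h] at this
      omega
    obtain ⟨w, hw⟩ := ih _ hdeg
    refine ⟨Fin.cons i w, fun y => ?_⟩
    rw [Fin.prod_univ_succ]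
    simp only [Fin.cons_zero, Fin.cons_succ, hw]
    conv_rhs => rw [← hsum]
    simp only [Finsupp.add_apply, pow_add, Finset.prod_mul_distrib]
    rw [mul_comm, Finset.prod_eq_single i (f := fun x => y x ^ (Finsupp.single i 1 x))]
    · simp
    · intro j _ hj
      rw [Finsupp.single_eq_of_ne hj, pow_zero]
    · simp

/-- A product of n coordinate functionals, each of norm at most 1 for the sup norm. In the wrong
degree the zero form serves as a default value. -/
theorem exists_multilinear [Fintype σ] (n : ℕ) (α : σ →₀ ℕ) :
    ∃ m : ContinuousMultilinearMap ℂ (fun _ : Fin n => σ → ℂ) ℂ, ‖m‖ ≤ 1 ∧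
      (α.degree = n → ∀ y : σ → ℂ, (m fun _ => y) = ∏ i, y i ^ α i) := by
  by_cases h : α.degree = n
  · obtain ⟨w, hw⟩ := exists_word n α h
    refine ⟨(ContinuousMultilinearMap.mkPiAlgebra ℂ (Fin n) ℂ).compContinuousLinearMap
      fun k => ContinuousLinearMap.proj (w k), ?_, fun _ y => ?_⟩
    · refine ContinuousMultilinearMap.opNorm_le_bound zero_le_one fun v => ?_
      simp only [ContinuousMultilinearMap.compContinuousLinearMap_apply,
        ContinuousMultilinearMap.mkPiAlgebra_apply, ContinuousLinearMap.proj_apply, norm_prod,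
        one_mul]
      exact Finset.prod_le_prod (fun _ _ => norm_nonneg _) fun k _ => norm_le_pi_norm _ _
    · simp [hw]
  · exact ⟨0, by simp, fun h' => absurd h' h⟩

open Classical in
/-- The exponents of degree `n`. -/
def degreeFinset (σ : Type) [Fintype σ] (n : ℕ) : Finset (σ →₀ ℕ) :=
  Finset.finsuppAntidiag Finset.univ n

theorem mem_degreeFinset [Fintype σ] {n : ℕ} {α : σ →₀ ℕ} :
    α ∈ degreeFinset σ n ↔ α.degree = n := by
  classical
  rw [degreeFinset, Finset.mem_finsuppAntidiag, Finsupp.degree_eq_sum]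
  simp

theorem HasSum.degreewise [Fintype σ] {E : Type} [NormedAddCommGroup E] [CompleteSpace E] {a : (σ →₀ ℕ) → E} {s : E}
    (h : HasSum a s) : HasSum (fun n => ∑ α ∈ degreeFinset σ n, a α) s := by
  have h1 := h.tsum_fiberwise (fun α : σ →₀ ℕ => α.degree)
  convert h1 using 2
  rename_i n
  have h2 : (fun α : σ →₀ ℕ => α.degree) ⁻¹' {n} = (degreeFinset σ n : Set (σ →₀ ℕ)) := by
    ext α
    simp [mem_degreeFinset]
  rw [h2, Finset.tsum_subtype']

theorem Convergent.exists_hasFPowerSeriesAt [Fintype σ] {f : MvPowerSeries σ ℂ}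
    (hf : Convergent f) :
    ∃ p : FormalMultilinearSeries ℂ (σ → ℂ) ℂ, HasFPowerSeriesAt (value f) p 0 ∧
      ∀ n y, (p n fun _ => y) = ∑ α ∈ degreeFinset σ n, term f y α := by
  choose m hm1 hm2 using exists_multilinear (σ := σ)
  let p : FormalMultilinearSeries ℂ (σ → ℂ) ℂ := fun n =>
    ∑ α ∈ degreeFinset σ n, coeff α f • m n α
  have hp : ∀ n y, (p n fun _ => y) = ∑ α ∈ degreeFinset σ n, term f y α := by
    intro n y
    simp only [p, sum_apply, smul_apply]
    refine Finset.sum_congr rfl fun α hα => ?_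
    rw [hm2 n α (mem_degreeFinset.1 hα), term, smul_eq_mul]
  refine ⟨p, ?_, hp⟩
  obtain ⟨r, hr, hsum⟩ := hf
  have hsn := (HasSum.degreewise hsum.hasSum).summable
  refine ⟨ENNReal.ofReal r, ?_, by simpa using hr, fun {y} hy => ?_⟩
  · refine p.le_radius_of_summable (r := r.toNNReal) ?_
    refine Summable.of_nonneg_of_le (fun n => by positivity) (fun n => ?_) hsn
    rw [Real.coe_toNNReal _ hr.le, Finset.sum_congr rfl fun α hα => by
      rw [mem_degreeFinset.1 hα], ← Finset.sum_mul]
    refine mul_le_mul_of_nonneg_right ((norm_sum_le _ _).trans (Finset.sum_le_sum fun α _ => ?_))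
      (by positivity)
    rw [norm_smul]
    exact mul_le_of_le_one_right (norm_nonneg _) (hm1 n α)
  · rw [zero_add]
    simp only [hp]
    refine HasSum.degreewise (Summable.hasSum (Summable.of_norm_bounded hsum fun α => ?_))
    have hyr : ‖y‖ < r := by
      rw [Metric.mem_eball, edist_zero_right, ← ofReal_norm] at hy
      exact (ENNReal.ofReal_lt_ofReal_iff hr).1 hy
    rw [term, norm_mul, norm_prod, Finsupp.degree_eq_sum, ← Finset.prod_pow_eq_pow_sum]
    refine mul_le_mul_of_nonneg_left (Finset.prod_le_prod (fun _ _ => norm_nonneg _) fun i _ => ?_)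
      (norm_nonneg _)
    rw [norm_pow]
    exact pow_le_pow_left₀ (norm_nonneg _) ((norm_le_pi_norm y i).trans hyr.le) _

theorem Convergent.analyticAt_value [Fintype σ] {f : MvPowerSeries σ ℂ} (hf : Convergent f) :
    AnalyticAt ℂ (value f) 0 := by
  obtain ⟨p, hp, -⟩ := hf.exists_hasFPowerSeriesAt
  exact ⟨p, hp⟩

/-- A convergent series whose sum vanishes at the real points near `0` is zero. -/
theorem Convergent.eq_zero_of_real [Fintype σ] {f : MvPowerSeries σ ℂ} (hf : Convergent f)
    (h : ∀ᶠ t : σ → ℝ in 𝓝 0, value f (fun i => (t i : ℂ)) = 0) : f = 0 := by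
  obtain ⟨p, hp, hpv⟩ := hf.exists_hasFPowerSeriesAt
  let u : (σ → ℝ) →L[ℝ] (σ → ℂ) :=
    ContinuousLinearMap.pi fun i => Complex.ofRealCLM.comp (ContinuousLinearMap.proj i)
  have hu : ∀ t i, u t i = (t i : ℂ) := fun t i => rfl
  have hp' : HasFPowerSeriesAt (value f) (p.restrictScalars ℝ) (u 0) := by
    rw [map_zero]
    exact hp.restrictScalars
  have h1 := hp'.compContinuousLinearMap
  have h2 : (value f ∘ u) =ᶠ[𝓝 0] 0 := h
  have h3 := (h1.congr h2).apply_eq_zero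
  have h4 : ∀ n (t : σ → ℝ), ∑ α ∈ degreeFinset σ n, term f (u t) α = 0 := by
    intro n t
    rw [← hpv]
    exact h3 n t
  ext α
  -- Each homogeneous part vanishes at all real points by uniqueness of the real power series, and a
  -- polynomial vanishing on a product of infinite sets is zero.
  let P : MvPolynomial σ ℂ := ∑ β ∈ degreeFinset σ α.degree, MvPolynomial.monomial β (coeff β f)
  have hP : P = 0 := by
    refine MvPolynomial.funext_set (fun _ => Set.range ((↑) : ℝ → ℂ))
      (fun _ => Set.infinite_range_of_injective Complex.ofReal_injective) fun x hx => ?_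
    choose t ht using fun i => hx i (Set.mem_univ i)
    rw [map_zero, map_sum, ← h4 α.degree t]
    refine Finset.sum_congr rfl fun β _ => ?_
    rw [MvPolynomial.eval_monomial, term_eq]
    congr 2
    funext i k
    rw [hu, ht]
  have h5 := congrArg (MvPolynomial.coeff α) hP
  classical
  simp only [P, MvPolynomial.coeff_sum, MvPolynomial.coeff_monomial, MvPolynomial.coeff_zero] at h5
  rw [Finset.sum_ite_eq', if_pos (mem_degreeFinset.2 rfl)] at h5
  rw [h5, map_zero]

theorem Convergent.eq_zero_of_value [Fintype σ] {f : MvPowerSeries σ ℂ} (hf : Convergent f)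
    (h : ∀ᶠ x : σ → ℂ in 𝓝 0, value f x = 0) : f = 0 := by
  refine hf.eq_zero_of_real ?_
  have hc : Continuous fun (t : σ → ℝ) (i : σ) => (t i : ℂ) := by fun_prop
  have h1 : Tendsto (fun (t : σ → ℝ) (i : σ) => (t i : ℂ)) (𝓝 0) (𝓝 0) := by
    have := hc.tendsto 0
    simp only [Pi.zero_apply, Complex.ofReal_zero] at this
    exact this
  exact h1.eventually h

/-! ### Power series of analytic functions -/

/-- The exponent of a word of variables. -/
def wordContent {σ : Type} (b : Σ n, Fin n → σ) : σ →₀ ℕ := ∑ k, Finsupp.single (b.2 k) 1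

theorem degree_wordContent (b : Σ n, Fin n → σ) : (wordContent b).degree = b.1 := by
  simp [wordContent]

theorem prod_wordContent [Fintype σ] (b : Σ n, Fin n → σ) (y : σ → ℂ) :
    ∏ i, y i ^ wordContent b i = ∏ k, y (b.2 k) := by
  classical
  simp only [wordContent, Finsupp.coe_finsetSum, Finset.sum_apply]
  simp only [← Finset.prod_pow_eq_pow_sum]
  rw [Finset.prod_comm]
  refine Finset.prod_congr rfl fun k _ => ?_
  rw [Finset.prod_eq_single (b.2 k)]
  · simp
  · intro j _ hj
    rw [Finsupp.single_eq_of_ne hj, pow_zero]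
  · simp

/-- An analytic function is the sum of a convergent power series. -/
theorem exists_convergent_of_analyticAt [Fintype σ] {F : (σ → ℂ) → ℂ} {x : σ → ℂ}
    (hF : AnalyticAt ℂ F x) :
    ∃ f : MvPowerSeries σ ℂ, Convergent f ∧ ∀ᶠ y in 𝓝 0, HasSum (term f y) (F (x + y)) := by
  classical
  obtain ⟨p, r, hp⟩ := hF
  -- The multilinear coefficients are evaluated on words of basis vectors; `f` gathers the words
  -- having the same content.
  let a : (Σ n, Fin n → σ) → ℂ := fun b => p b.1 fun k => Pi.single (b.2 k) 1
  let f : MvPowerSeries σ ℂ := fun α => ∑' b : wordContent ⁻¹' {α}, a b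
  have hcoeff : ∀ α, coeff α f = ∑' b : wordContent ⁻¹' {α}, a b := fun α => rfl
  have ha : ∀ b, ‖a b‖ ≤ ‖p b.1‖ := by
    intro b
    refine ((p b.1).le_opNorm _).trans (mul_le_of_le_one_right (norm_nonneg _) ?_)
    refine Finset.prod_le_one (fun _ _ => norm_nonneg _) fun k _ => ?_
    rw [Pi.norm_single, norm_one]
  obtain ⟨r₁, hr₁, hr₁r⟩ := ENNReal.lt_iff_exists_nnreal_btwn.1 hp.r_pos
  have hr₁0 : 0 < r₁ := by exact_mod_cast hr₁
  have hps : Summable fun n => ‖p n‖₊ * r₁ ^ n :=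
    p.summable_nnnorm_mul_pow (lt_of_lt_of_le hr₁r hp.r_le)
  -- There are `card σ ^ n` words of length n, so the radius is divided accordingly; the `+ 1`
  -- covers an empty set of variables.
  let δ : ℝ≥0 := r₁ / (Fintype.card σ + 1)
  have hδ : 0 < δ := by positivity
  have hcδ : (Fintype.card σ : ℝ≥0) * δ ≤ r₁ := by
    rw [mul_div_assoc', div_le_iff₀ (by positivity), mul_comm]
    gcongr
    exact le_self_add
  have hδr : δ ≤ r₁ := div_le_self r₁.2 (by simp)
  have hsum : ∑' b, ‖a b‖ₑ * (δ : ℝ≥0∞) ^ b.1 ≠ ⊤ := by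
    refine ne_top_of_le_ne_top (ENNReal.tsum_coe_ne_top_iff_summable.2 hps) ?_
    rw [ENNReal.tsum_sigma']
    refine ENNReal.tsum_le_tsum fun n => ?_
    rw [tsum_fintype]
    calc ∑ w : Fin n → σ, ‖a ⟨n, w⟩‖ₑ * (δ : ℝ≥0∞) ^ n
        ≤ ∑ w : Fin n → σ, (‖p n‖₊ : ℝ≥0∞) * (δ : ℝ≥0∞) ^ n := by
          refine Finset.sum_le_sum fun w _ => mul_le_mul_left ?_ _
          rw [enorm_eq_nnnorm, ENNReal.coe_le_coe]
          exact ha ⟨n, w⟩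
      _ = (((‖p n‖₊ * ((Fintype.card σ : ℝ≥0) * δ) ^ n : ℝ≥0)) : ℝ≥0∞) := by
          rw [Finset.sum_const, Finset.card_univ, Fintype.card_fun, Fintype.card_fin, nsmul_eq_mul]
          push_cast
          ring
      _ ≤ _ := by
          rw [ENNReal.coe_le_coe]
          gcongr
  have hfc : Convergent f := by
    refine convergent_iff.2 ⟨δ, by simpa using hδ.ne', ne_top_of_le_ne_top hsum ?_⟩
    rw [← ENNReal.tsum_fiberwise _ wordContent]
    refine ENNReal.tsum_le_tsum fun α => ?_
    rw [hcoeff, mon_const]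
    refine (mul_le_mul_left (enorm_tsum_le _) _).trans ?_
    rw [← ENNReal.tsum_mul_right]
    refine ENNReal.tsum_le_tsum fun b => ?_
    rw [← degree_wordContent b.1, show wordContent b.1 = α from b.2]
  refine ⟨f, hfc, ?_⟩
  filter_upwards [eventually_radii_le (σ := σ) (ε := δ) (by simpa using hδ.ne')] with y hy
  have hyb : ∀ b : Σ n, Fin n → σ, ‖∏ k, y (b.2 k)‖ₑ ≤ (δ : ℝ≥0∞) ^ b.1 := by
    intro b
    rw [enorm_eq_nnnorm, nnnorm_prod, ENNReal.ofNNReal_finsetProd]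
    refine (Finset.prod_le_prod' fun k _ => hy (b.2 k)).trans ?_
    simp
  have hyball : y ∈ Metric.eball (0 : σ → ℂ) r := by
    rw [Metric.mem_eball, edist_zero_right]
    refine lt_of_le_of_lt ?_ hr₁r
    rw [enorm_eq_nnnorm, ENNReal.coe_le_coe]
    refine (pi_nnnorm_le_iff.2 fun i => ?_).trans hδr
    have := hy i
    rwa [radii, enorm_eq_nnnorm, ENNReal.coe_le_coe] at this
  have hs : Summable fun b => a b * ∏ k, y (b.2 k) := by
    refine summable_of_tsum_enorm_ne_top (ne_top_of_le_ne_top hsum (ENNReal.tsum_le_tsum fun b => ?_))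
    rw [enorm_mul]
    exact mul_le_mul_right (hyb b) _
  have h1 : HasSum (fun b => a b * ∏ k, y (b.2 k)) (F (x + y)) := by
    refine HasSum.sigma_of_hasSum (hp.hasSum hyball) (fun n => ?_) hs
    have h2 : (p n fun _ => y) = ∑ w : Fin n → σ, a ⟨n, w⟩ * ∏ k, y (w k) := by
      have h3 : (fun _ : Fin n => y) = fun _ : Fin n => ∑ i, y i • (Pi.single i 1 : σ → ℂ) := by
        funext k
        conv_lhs => rw [← Finset.univ_sum_single y]
        refine Finset.sum_congr rfl fun i _ => ?_
        rw [← Pi.single_smul, smul_eq_mul, mul_one]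
      rw [h3, ContinuousMultilinearMap.map_sum]
      refine Finset.sum_congr rfl fun w _ => ?_
      rw [ContinuousMultilinearMap.map_smul_univ, smul_eq_mul, mul_comm]
    rw [h2]
    exact hasSum_fintype _
  have h4 := h1.tsum_fiberwise wordContent
  have h5 : term f y = fun α => ∑' b : wordContent ⁻¹' {α}, a b * ∏ k, y (b.1.2 k) := by
    funext α
    rw [term, hcoeff, ← tsum_mul_right]
    refine tsum_congr fun b => ?_
    rw [← prod_wordContent, show wordContent b.1 = α from b.2]
  rw [h5]
  exact h4

/-! ### Convergence from convergence along a submersion -/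

/-- The map that sets the variable `s` to zero. -/
def kill [DecidableEq σ] (s : σ) (q : σ) : MvPowerSeries σ ℂ := if q = s then 0 else X q

theorem noConst_kill [DecidableEq σ] (s : σ) : NoConst (kill s) := fun q => by
  rw [kill]
  split_ifs
  · exact map_zero _
  · exact constantCoeff_X _

theorem exists_eq_X_mul [Fintype σ] [DecidableEq σ] {s : σ} {g : MvPowerSeries σ ℂ}
    (hg : subst (kill s) g = 0) : ∃ M, g = X s * M := by
  have h1 : g ∈ ordIdeal (fun i => if i = s then 1 else 0) 1 :=
    mem_ordIdeal_one_of_subst_eq_zero (g := kill s)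
      (fun i hi => if_neg fun h => by simp [h] at hi)
      (fun i hi => if_pos (by_contra fun h => by simp [h] at hi)) hg
  obtain ⟨M, hM, hM0⟩ := exists_eq_sum_X_mul h1
  refine ⟨M s, ?_⟩
  rw [hM, Finset.sum_eq_single s]
  · intro i _ hi
    rw [hM0 i (if_neg hi), mul_zero]
  · simp

theorem exists_eq_X_mul_X_mul [Fintype σ] [DecidableEq σ] {s : σ} {g : MvPowerSeries σ ℂ}
    (hg : subst (kill s) g = 0) (hg' : subst (kill s) (pderiv ℂ s g) = 0) :
    ∃ M, g = X s * (X s * M) := by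
  obtain ⟨M, rfl⟩ := exists_eq_X_mul hg
  have hk := noConst_kill s
  rw [Derivation.leibniz, pderiv_X_self, smul_eq_mul, smul_eq_mul, mul_one,
    subst_add hk.hasSubst, subst_mul hk.hasSubst, subst_X' hk, kill, if_pos rfl, zero_mul,
    zero_add] at hg'
  obtain ⟨M', rfl⟩ := exists_eq_X_mul hg'
  exact ⟨M', rfl⟩

theorem coeff_subst_smul [Fintype τ] [Fintype ι] (η : MvPowerSeries τ ℂ) (F : MvPowerSeries ι ℂ)
    (m : τ →₀ ℕ) (α : ι →₀ ℕ) :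
    coeff (m.sumElim α) (subst (fun i => rename Sum.inl η * X (Sum.inr i) :
      ι → MvPowerSeries (τ ⊕ ι) ℂ) F) = coeff α F * coeff m (η ^ α.degree) := by
  classical
  have hg : NoConst (fun i => rename Sum.inl η * X (Sum.inr i) : ι → MvPowerSeries (τ ⊕ ι) ℂ) :=
    fun i => by rw [map_mul, constantCoeff_X, mul_zero]
  have hprod : ∀ d : ι →₀ ℕ, (d.prod fun i k => (rename Sum.inl η * X (Sum.inr i) :
      MvPowerSeries (τ ⊕ ι) ℂ) ^ k) =
      rename Sum.inl (η ^ d.degree) * monomial ((0 : τ →₀ ℕ).sumElim d) 1 := by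
    intro d
    simp only [mul_pow, Finsupp.prod, Finset.prod_mul_distrib]
    rw [Finset.prod_pow_eq_pow_sum, map_pow, ← Finsupp.degree_apply]
    congr 1
    have h1 : (0 : τ →₀ ℕ).sumElim d = ∑ i ∈ d.support, Finsupp.single (Sum.inr i) (d i) := by
      ext x
      rw [Finsupp.finsetSum_apply]
      rcases x with x | x
      · simp
      · simp only [Finsupp.sumElim_inr, Finsupp.single_apply, Sum.inr.injEq]
        rw [Finset.sum_ite_eq']
        split_ifs with h
        · rfl
        · simpa using h
    rw [h1]
    simp only [X_pow_eq]
    rw [prod_monomial]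
    simp
  rw [coeff_subst hg.hasSubst, finsum_eq_single _ α]
  · rw [hprod, smul_eq_mul]
    congr 1
    have h2 : m.sumElim α = m.sumElim 0 + (0 : τ →₀ ℕ).sumElim α := sumElim_eq_add m α
    rw [h2, coeff_add_mul_monomial, mul_one, coeff_rename_inl, if_pos rfl]
  · intro d hd
    rw [hprod, coeff_mul_monomial, smul_eq_mul]
    split_ifs with hle
    · have hdα : d ≤ α := fun i => by simpa using hle (Sum.inr i)
      have h3 : m.sumElim α - (0 : τ →₀ ℕ).sumElim d = m.sumElim (α - d) := by
        ext x
        rcases x with x | x <;> simp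
      rw [h3, coeff_rename_inl, if_neg, zero_mul, mul_zero]
      intro h0
      exact hd (le_antisymm hdα (tsub_eq_zero_iff_le.1 h0))
    · rw [mul_zero]

/-- If `F(η(x) v)` converges for some `η ≠ 0`, then `F` converges. -/
theorem convergent_of_subst_smul [Fintype τ] [Fintype ι] {η : MvPowerSeries τ ℂ}
    (hη : Convergent η) (h0 : η ≠ 0) {F : MvPowerSeries ι ℂ}
    (hF : Convergent (subst (fun i => rename Sum.inl η * X (Sum.inr i) :
      ι → MvPowerSeries (τ ⊕ ι) ℂ) F)) : Convergent F := by
  obtain ⟨e, he, hFe⟩ := convergent_iff.1 hF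
  -- A nonzero convergent η is nonzero at some point of any small polydisc. Freezing x there, F
  -- converges at radius |η(x)| e, because |η(x)|^k is at most the norm of η^k.
  obtain ⟨x, hx0, hxe, hxt⟩ : ∃ x : τ → ℂ, value η x ≠ 0 ∧ (radii x ≤ fun _ => e) ∧
      wnorm (radii x) η ≠ ⊤ := by
    by_contra! hcon
    refine h0 (hη.eq_zero_of_value ?_)
    filter_upwards [eventually_radii_le he, hη.eventually_ne_top] with x h1 h2
    by_contra h3
    exact h2 (hcon x h3 h1)
  refine convergent_iff.2 ⟨‖value η x‖ₑ * e, mul_ne_zero (by simpa using hx0) he,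
    ne_top_of_le_ne_top hFe ?_⟩
  calc wnorm (fun _ => ‖value η x‖ₑ * e) F
      ≤ ∑' α, ∑' m, ‖coeff ((m : τ →₀ ℕ).sumElim α) (subst (fun i => rename Sum.inl η * X (Sum.inr i) :
          ι → MvPowerSeries (τ ⊕ ι) ℂ) F)‖ₑ * mon (fun _ => e) (m.sumElim α) := by
        refine ENNReal.tsum_le_tsum fun α => ?_
        simp only [coeff_subst_smul, mon_sumElim, enorm_mul]
        have h1 : ∀ m : τ →₀ ℕ, ‖coeff α F‖ₑ * ‖coeff m (η ^ α.degree)‖ₑ *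
            (mon (fun _ => e) m * mon (fun _ => e) α) = ‖coeff α F‖ₑ * mon (fun _ => e) α *
            (‖coeff m (η ^ α.degree)‖ₑ * mon (fun _ => e) m) := fun m => by ring
        simp only [h1, ENNReal.tsum_mul_left]
        rw [mon_const, mon_const, mul_pow, mul_assoc, mul_comm (e ^ _)]
        refine mul_le_mul_right (mul_le_mul_left ?_ _) _
        rw [← enorm_pow, ← value_pow hxt]
        exact (enorm_value_le _ _).trans (wnorm_mono hxe _)
    _ = ∑' p : (ι →₀ ℕ) × (τ →₀ ℕ), ‖coeff (p.2.sumElim p.1) (subst (fun i =>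
          rename Sum.inl η * X (Sum.inr i) : ι → MvPowerSeries (τ ⊕ ι) ℂ) F)‖ₑ *
          mon (fun _ => e) (p.2.sumElim p.1) := by
        rw [ENNReal.tsum_prod (f := fun α m => ‖coeff ((m : τ →₀ ℕ).sumElim α) (subst (fun i =>
          rename Sum.inl η * X (Sum.inr i) : ι → MvPowerSeries (τ ⊕ ι) ℂ) F)‖ₑ *
          mon (fun _ => e) (m.sumElim α))]
    _ ≤ _ := by
        refine ENNReal.tsum_comp_le_tsum_of_injective
          (f := fun p : (ι →₀ ℕ) × (τ →₀ ℕ) => p.2.sumElim p.1) ?_ _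
        rintro ⟨α, m⟩ ⟨α', m'⟩ h
        have h1 : ∀ i, α i = α' i := fun i => by simpa using DFunLike.congr_fun h (Sum.inr i)
        have h2 : ∀ i, m i = m' i := fun i => by simpa using DFunLike.congr_fun h (Sum.inl i)
        exact Prod.ext (Finsupp.ext h1) (Finsupp.ext h2)

theorem subst_elim_X_zero [Finite τ] [Finite ι] (i : τ → υ) (f : MvPowerSeries (τ ⊕ ι) ℂ) :
    subst (Sum.elim (fun x => X (i x)) 0 : τ ⊕ ι → MvPowerSeries υ ℂ) f =
      rename i (subst (Sum.elim X 0 : τ ⊕ ι → MvPowerSeries τ ℂ) f) := by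
  rw [rename_subst (noConst_X.sumElim noConst_zero)]
  congr 1
  funext x
  rcases x with x | x <;> simp

theorem subst_kill_rename [Finite τ] [Finite σ] [DecidableEq σ] {s : σ} {i : τ → σ}
    (hi : ∀ x, i x ≠ s) (f : MvPowerSeries τ ℂ) :
    subst (kill s) (rename i f) = rename i f := by
  rw [subst_rename _ (noConst_kill s), rename_eq_subst']
  congr 1
  funext x
  rw [kill, if_neg (hi x)]

/-- If `A(x) = ∂_y w(x, 0)` is invertible, then
`w(x, ε adj(A) z) = ε det(A) z + ε² E(x, ε, z)`. -/
theorem exists_expansion [Fintype τ] [Fintype ι] [DecidableEq ι]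
    {w : ι → MvPowerSeries (τ ⊕ ι) ℂ} (hwc : ∀ l, Convergent (w l))
    (hw0 : ∀ l, subst (Sum.elim X 0 : τ ⊕ ι → MvPowerSeries τ ℂ) (w l) = 0)
    {A : Matrix ι ι (MvPowerSeries τ ℂ)}
    (hA : ∀ l k, A l k = subst (Sum.elim X 0 : τ ⊕ ι → MvPowerSeries τ ℂ)
      (pderiv ℂ (Sum.inr k) (w l))) (hAc : ∀ l k, Convergent (A.adjugate l k))
    (hdc : Convergent A.det) (l : ι) :
    ∃ E : MvPowerSeries ((τ ⊕ Unit) ⊕ ι) ℂ, Convergent E ∧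
      subst (Sum.elim (fun x => X (Sum.inl (Sum.inl x))) fun k => X (Sum.inl (Sum.inr ())) *
        ∑ j, rename (fun x => Sum.inl (Sum.inl x)) (A.adjugate k j) * X (Sum.inr j) :
        τ ⊕ ι → MvPowerSeries ((τ ⊕ Unit) ⊕ ι) ℂ) (w l) =
      X (Sum.inl (Sum.inr ())) * (rename (fun x => Sum.inl (Sum.inl x)) A.det * X (Sum.inr l)) +
        X (Sum.inl (Sum.inr ())) * (X (Sum.inl (Sum.inr ())) * E) := by
  classical
  let s : (τ ⊕ Unit) ⊕ ι := Sum.inl (Sum.inr ())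
  let i : τ → (τ ⊕ Unit) ⊕ ι := fun x => Sum.inl (Sum.inl x)
  have hi : ∀ x, i x ≠ s := fun x => by simp [i, s]
  let S : ι → MvPowerSeries ((τ ⊕ Unit) ⊕ ι) ℂ := fun k =>
    ∑ j, rename i (A.adjugate k j) * X (Sum.inr j)
  let D : MvPowerSeries ((τ ⊕ Unit) ⊕ ι) ℂ := rename i A.det * X (Sum.inr l)
  let arg : τ ⊕ ι → MvPowerSeries ((τ ⊕ Unit) ⊕ ι) ℂ :=
    Sum.elim (fun x => X (i x)) fun k => X s * S k
  have harg : NoConst arg := (noConst_X_comp i).sumElim fun k => by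
    rw [map_mul, constantCoeff_X, zero_mul]
  have hk := noConst_kill s
  have hkX : ∀ j, subst (kill s) (X (Sum.inr j) : MvPowerSeries ((τ ⊕ Unit) ⊕ ι) ℂ) =
      X (Sum.inr j) := fun j => by rw [subst_X' hk, kill, if_neg (by simp [s])]
  have hks : subst (kill s) (X s : MvPowerSeries ((τ ⊕ Unit) ⊕ ι) ℂ) = 0 := by
    rw [subst_X' hk, kill, if_pos rfl]
  have hkS : ∀ k, subst (kill s) (S k) = S k := by
    intro k
    simp only [S]
    rw [subst_sum' hk]
    exact Finset.sum_congr rfl fun j _ => by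
      rw [subst_mul hk.hasSubst, subst_kill_rename hi, hkX]
  have hkD : subst (kill s) D = D := by
    simp only [D]
    rw [subst_mul hk.hasSubst, subst_kill_rename hi, hkX]
  have hkarg : (fun x => subst (kill s) (arg x)) = Sum.elim (fun x => X (i x)) 0 := by
    funext x
    rcases x with x | x
    · simp only [arg, Sum.elim_inl]
      rw [subst_X' hk, kill, if_neg (hi x)]
    · simp only [arg, Sum.elim_inr]
      rw [subst_mul hk.hasSubst, hks, zero_mul]
      rfl
  have hder : ∀ f : MvPowerSeries ((τ ⊕ Unit) ⊕ ι) ℂ,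
      subst (kill s) (pderiv ℂ s (X s * f)) = subst (kill s) f := by
    intro f
    rw [Derivation.leibniz, pderiv_X_self, smul_eq_mul, smul_eq_mul, mul_one,
      subst_add hk.hasSubst, subst_mul hk.hasSubst, hks, zero_mul, zero_add]
  have hg : subst (kill s) (subst arg (w l) - X s * D) = 0 := by
    rw [subst_sub hk.hasSubst, subst_mul hk.hasSubst, hks, zero_mul, sub_zero,
      subst_subst harg hk, hkarg, subst_elim_X_zero, hw0, map_zero]
  -- The first-order terms in ε also agree, because A · adj(A) = det(A). A vanishing value and
  -- derivative at ε = 0 leave a remainder divisible by ε².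
  have hg' : subst (kill s) (pderiv ℂ s (subst arg (w l) - X s * D)) = 0 := by
    rw [map_sub, subst_sub hk.hasSubst, hder, hkD, pderiv_subst harg, subst_sum' hk,
      Fintype.sum_sum_type, Finset.sum_eq_zero, zero_add]
    · have h1 : ∀ k, subst (kill s) (subst arg (pderiv ℂ (Sum.inr k) (w l)) *
          pderiv ℂ s (arg (Sum.inr k))) = ∑ j, rename i (A l k * A.adjugate k j) * X (Sum.inr j) := by
        intro k
        simp only [arg, Sum.elim_inr]
        rw [subst_mul hk.hasSubst, hder, hkS]
        change subst (kill s) (subst arg _) * _ = _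
        rw [subst_subst harg hk, hkarg, subst_elim_X_zero, ← hA, Finset.mul_sum]
        exact Finset.sum_congr rfl fun j _ => by rw [map_mul, mul_assoc]
      rw [Finset.sum_congr rfl fun k _ => h1 k, Finset.sum_comm, sub_eq_zero]
      simp only [← Finset.sum_mul, ← map_sum]
      have h2 : ∀ j, ∑ k, A l k * A.adjugate k j = if l = j then A.det else 0 := by
        intro j
        have := congrFun (congrFun (Matrix.mul_adjugate A) l) j
        rw [Matrix.mul_apply] at this
        rw [this, Matrix.smul_apply, Matrix.one_apply, smul_eq_mul, mul_ite, mul_one, mul_zero]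
      rw [Finset.sum_eq_single l]
      · rw [h2, if_pos rfl]
      · intro j _ hj
        rw [h2, if_neg (Ne.symm hj), map_zero, zero_mul]
      · simp
    · intro x _
      simp only [arg, Sum.elim_inl]
      rw [pderiv_X_of_ne (hi x), mul_zero, subst_zero' hk]
  obtain ⟨E, hE⟩ := exists_eq_X_mul_X_mul hg hg'
  have hargc : ∀ x, Convergent (arg x) := Convergent.sumElim (fun _ => convergent_X _) fun k =>
    (convergent_X _).mul (Convergent.sum fun j _ => ((hAc k j).rename _).mul (convergent_X _))
  have hgc : Convergent (subst arg (w l) - X s * D) :=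
    ((hwc l).subst harg hargc).sub ((convergent_X _).mul ((hdc.rename _).mul (convergent_X _)))
  rw [hE] at hgc
  exact ⟨E, hgc.of_X_mul.of_X_mul, sub_eq_iff_eq_add'.1 hE⟩

theorem convergent_det [Fintype ι] [DecidableEq ι] {A : Matrix ι ι (MvPowerSeries τ ℂ)}
    (hA : ∀ i j, Convergent (A i j)) : Convergent A.det := by
  rw [Matrix.det_apply]
  refine Convergent.sum fun p _ => ?_
  rcases Int.units_eq_one_or (Equiv.Perm.sign p) with h | h
  · rw [h, one_smul]
    exact Convergent.prod fun i _ => hA _ _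
  · rw [h, Units.neg_smul, one_smul]
    exact (Convergent.prod fun i _ => hA _ _).neg

theorem convergent_adjugate [Fintype ι] [DecidableEq ι] {A : Matrix ι ι (MvPowerSeries τ ℂ)}
    (hA : ∀ i j, Convergent (A i j)) (i j : ι) : Convergent (A.adjugate i j) := by
  rw [Matrix.adjugate_apply]
  refine convergent_det fun k l => ?_
  rw [Matrix.updateRow_apply]
  split_ifs
  · rw [Pi.single_apply]
    split_ifs
    · exact convergent_one
    · exact convergent_zero
  · exact hA _ _

/-- A series that converges along a family of generically submersive maps converges. -/
theorem convergent_of_subst [Fintype τ] [Fintype ι] [DecidableEq ι]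
    {w : ι → MvPowerSeries (τ ⊕ ι) ℂ} (hw : NoConst w) (hwc : ∀ l, Convergent (w l))
    (hw0 : ∀ l, subst (Sum.elim X 0 : τ ⊕ ι → MvPowerSeries τ ℂ) (w l) = 0)
    (hdet : (Matrix.of fun l k => subst (Sum.elim X 0 : τ ⊕ ι → MvPowerSeries τ ℂ)
      (pderiv ℂ (Sum.inr k) (w l))).det ≠ 0)
    {F : MvPowerSeries ι ℂ} (hF : Convergent (subst w F)) : Convergent F := by
  classical
  have hX0 : NoConst (Sum.elim X 0 : τ ⊕ ι → MvPowerSeries τ ℂ) := noConst_X.sumElim noConst_zero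
  let A : Matrix ι ι (MvPowerSeries τ ℂ) := Matrix.of fun l k =>
    subst (Sum.elim X 0 : τ ⊕ ι → MvPowerSeries τ ℂ) (pderiv ℂ (Sum.inr k) (w l))
  have hAc : ∀ l k, Convergent (A l k) := fun l k => ((hwc l).pderiv _).subst hX0
    (Convergent.sumElim (fun _ => convergent_X _) fun _ => convergent_zero)
  have hdc := convergent_det hAc
  choose E hEc hE using exists_expansion hwc hw0 (A := A) (fun _ _ => rfl)
    (convergent_adjugate hAc) hdc
  -- `x`, `s` parameters; `v` target; `z` unknown
  let T : Type := (τ ⊕ Unit) ⊕ ι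
  let s' : T := Sum.inl (Sum.inr ())
  let δ : MvPowerSeries T ℂ := rename (fun x => Sum.inl (Sum.inl x)) A.det
  have hδc : Convergent δ := hdc.rename _
  let e : (ζ : ι → MvPowerSeries T ℂ) → (τ ⊕ Unit) ⊕ ι → MvPowerSeries T ℂ := fun ζ =>
    Sum.elim (Sum.elim (fun x => X (Sum.inl (Sum.inl x))) fun _ => X s' * δ) ζ
  have he : ∀ {ζ}, NoConst ζ → NoConst (e ζ) := fun hζ =>
    (NoConst.sumElim (noConst_X_comp _) fun _ => by
      rw [map_mul, constantCoeff_X, zero_mul]).sumElim hζ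
  have hec : ∀ {ζ}, (∀ i, Convergent (ζ i)) → ∀ i, Convergent (e ζ i) := fun hζ =>
    Convergent.sumElim (Convergent.sumElim (fun _ => convergent_X _)
      fun _ => (convergent_X _).mul hδc) hζ
  -- the equations `z + s E(x, s δ, z) = v`
  let e' : (τ ⊕ Unit) ⊕ ι → MvPowerSeries (T ⊕ ι) ℂ :=
    Sum.elim (Sum.elim (fun x => X (Sum.inl (Sum.inl (Sum.inl x)))) fun _ =>
      X (Sum.inl s') * rename Sum.inl δ) fun j => X (Sum.inr j)
  have he' : NoConst e' := (NoConst.sumElim (noConst_X_comp _) fun _ => by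
    rw [map_mul, constantCoeff_X, zero_mul]).sumElim (noConst_X_comp _)
  have hec' : ∀ i, Convergent (e' i) := Convergent.sumElim
    (Convergent.sumElim (fun _ => convergent_X _) fun _ => (convergent_X _).mul (hδc.rename _))
    fun _ => convergent_X _
  let Q : ι → MvPowerSeries (T ⊕ ι) ℂ := fun l =>
    X (Sum.inr l) + X (Sum.inl s') * subst e' (E l) - X (Sum.inl (Sum.inr l))
  have hQ : NoConst Q := fun l => by simp [Q]
  have hQ' : ∀ l j, constantCoeff (pderiv ℂ (Sum.inr j) (Q l)) = if l = j then 1 else 0 := by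
    intro l j
    simp only [Q]
    rw [map_sub, map_add, Derivation.leibniz, pderiv_X_of_ne (by simp : Sum.inl s' ≠ Sum.inr j),
      pderiv_X_of_ne (by simp : (Sum.inl (Sum.inr l) : T ⊕ ι) ≠ Sum.inr j), smul_zero, add_zero,
      sub_zero, smul_eq_mul, map_add, map_mul, constantCoeff_X, zero_mul, add_zero]
    split_ifs with h
    · rw [h, pderiv_X_self, map_one]
    · rw [pderiv_X_of_ne (by simpa using h), map_zero]
  obtain ⟨z, hz, hzQ, hzc⟩ := exists_implicit hQ hQ'
  have hzc := hzc fun l => ((convergent_X _).add ((convergent_X _).mul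
    ((hEc l).subst he' hec'))).sub (convergent_X _)
  have hXz : NoConst (Sum.elim X z : T ⊕ ι → MvPowerSeries T ℂ) := noConst_X.sumElim hz
  have heq : ∀ l, z l + X s' * subst (e z) (E l) = X (Sum.inr l) := by
    intro l
    have h1 := hzQ l
    simp only [Q] at h1
    rw [subst_sub hXz.hasSubst, subst_add hXz.hasSubst, subst_mul hXz.hasSubst, subst_X' hXz,
      subst_X' hXz, subst_X' hXz, subst_subst he' hXz, sub_eq_zero] at h1
    simp only [Sum.elim_inl, Sum.elim_inr] at h1
    rw [← h1]
    congr 3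
    funext x
    rcases x with (x | x) | x
    · simp only [e', e, Sum.elim_inl]
      rw [subst_X' hXz]
      rfl
    · simp only [e', e, Sum.elim_inl, Sum.elim_inr]
      rw [subst_mul hXz.hasSubst, subst_X' hXz, subst_rename _ hXz]
      simp only [Sum.elim_inl]
      rw [show (fun x => (X x : MvPowerSeries T ℂ)) = X from rfl, subst_X_self]
    · simp only [e', e, Sum.elim_inr]
      rw [subst_X' hXz]
      rfl
  let b : τ ⊕ ι → MvPowerSeries ((τ ⊕ Unit) ⊕ ι) ℂ :=
    Sum.elim (fun x => X (Sum.inl (Sum.inl x))) fun k => X (Sum.inl (Sum.inr ())) *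
        ∑ j, rename (fun x => Sum.inl (Sum.inl x)) (A.adjugate k j) * X (Sum.inr j)
  have hb : NoConst b := (noConst_X_comp _).sumElim fun k => by
    rw [map_mul, constantCoeff_X, zero_mul]
  have hbc : ∀ x, Convergent (b x) := Convergent.sumElim (fun _ => convergent_X _) fun k =>
    (convergent_X _).mul (Convergent.sum fun j _ =>
      ((convergent_adjugate hAc k j).rename _).mul (convergent_X _))
  have hez := he hz
  -- With ε = sδ and δ = det A the expansion reads sδ² z + s²δ² E = sδ² (z + sE) = sδ² v, so w
  -- becomes multiplication of v by sδ².
  let η : MvPowerSeries (τ ⊕ Unit) ℂ := X (Sum.inr ()) * rename Sum.inl A.det ^ 2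
  have hη : ∀ l, subst (e z) (subst b (w l)) = rename Sum.inl η * X (Sum.inr l) := by
    intro l
    rw [hE l, subst_add hez.hasSubst, subst_mul hez.hasSubst, subst_mul hez.hasSubst,
      subst_mul hez.hasSubst, subst_mul hez.hasSubst, subst_X' hez, subst_X' hez,
      subst_rename _ hez]
    have h2 : subst (fun x => e z (Sum.inl (Sum.inl x))) A.det = δ := by
      simp only [e, δ, Sum.elim_inl]
      rw [rename_eq_subst']
    rw [h2]
    simp only [e, Sum.elim_inl, Sum.elim_inr, η]
    rw [← heq l, map_mul, map_pow, rename_X, rename_rename]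
    change _ = X s' * δ ^ 2 * _
    simp only [e]
    ring
  have h3 : Convergent (subst (e z) (subst b (subst w F))) :=
    (hF.subst hb hbc).subst hez (hec hzc)
  rw [subst_subst hw hb, subst_subst (hw.subst hb) hez] at h3
  simp only [hη] at h3
  refine convergent_of_subst_smul (η := η) ?_ ?_ h3
  · simp only [η, pow_two]
    exact (convergent_X _).mul ((hdc.rename _).mul (hdc.rename _))
  · have hXs : (X (Sum.inr ()) : MvPowerSeries (τ ⊕ Unit) ℂ) ≠ 0 := fun h => one_ne_zero (α := ℂ) (by
      rw [← coeff_index_single_self_X (R := ℂ) (Sum.inr () : τ ⊕ Unit), h, map_zero])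
    refine mul_ne_zero hXs (pow_ne_zero _ fun h0 => hdet ?_)
    have h4 := congrArg (subst (Sum.elim X 0 : τ ⊕ Unit → MvPowerSeries τ ℂ)) h0
    have hX0' : NoConst (Sum.elim X 0 : τ ⊕ Unit → MvPowerSeries τ ℂ) :=
      noConst_X.sumElim noConst_zero
    rw [subst_rename _ hX0', subst_zero' hX0'] at h4
    simp only [Sum.elim_inl] at h4
    rw [← subst_X_self A.det]
    exact h4

/-! ### Convergence of formal CR submersive maps -/

theorem convergent_of_crSubmersive {N N' d d' : ℕ} {ρ : Fin d → Ser N} {ρ' : Fin d' → Ser N'}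
    (hρ : IsFormalGeneric ρ) (hρc : ∀ j, Convergent (ρ j)) (hρ' : IsFormalGeneric ρ')
    (hρ'c : ∀ j, Convergent (ρ' j)) (hfin : FiniteType ρ) (hnd : FinitelyNondegenerate ρ')
    {H : Fin N' → MvPowerSeries (Fin N) ℂ} (hH : MapsInto ρ ρ' H) (hsub : CRSubmersive ρ ρ' H)
    (k : Fin N') : Convergent (H k) := by
  obtain ⟨κ, _, _, c, Θ, hΘ⟩ := hρ.exists_isStraight hρc
  obtain ⟨κ', _, _, c', Θ', hΘ'⟩ := hρ'.exists_isStraight hρ'c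
  have hspan := span_segreJet_eq_top hΘ hΘ' hρ hρ' hH hsub hnd
  obtain ⟨τ, _, W, hW, hW0, hdet⟩ := hΘ.exists_reach hρ hfin
  exact convergent_of_subst ((hW.noConst hΘ.isFlow_crFlow).comp Sum.inl)
    (fun l => hW.convergent hΘ.isFlow_crFlow _) (fun l => hW0 _) hdet
    (hΘ.reach_convergent hρ hρ'c hH hspan hW k)

/-! ### Points of the manifolds -/

theorem value_rename [Fintype σ] [Fintype τ] (e : σ → τ) {f : MvPowerSeries σ ℂ} {x : τ → ℂ}
    (h : wnorm (radii fun i => x (e i)) f ≠ ⊤) :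
    value (rename e f) x = value f fun i => x (e i) := by
  have h1 : (fun i => wnorm (radii x) (X (e i))) = radii fun i => x (e i) := by
    funext i
    rw [wnorm_X]
    rfl
  rw [rename_eq_subst', value_subst (noConst_X_comp e)]
  · simp only [value_X]
  · intro i
    rw [wnorm_X]
    exact enorm_ne_top
  · rw [h1]
    exact h

theorem tendsto_comp_zero (e : σ → τ) :
    Tendsto (fun (x : τ → ℂ) i => x (e i)) (𝓝 0) (𝓝 (0 : σ → ℂ)) := by
  have h : Continuous fun (x : τ → ℂ) (i : σ) => x (e i) := by fun_prop
  exact h.tendsto 0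

theorem Convergent.eventually_value_rename [Fintype σ] [Fintype τ] {f : MvPowerSeries σ ℂ}
    (hf : Convergent f) (e : σ → τ) :
    ∀ᶠ x : τ → ℂ in 𝓝 0, value (MvPowerSeries.rename e f) x = value f fun i => x (e i) :=
  ((tendsto_comp_zero e).eventually hf.eventually_ne_top).mono fun _ hx => value_rename e hx

theorem diag_zero {N : ℕ} : diag (0 : Fin N → ℂ) = 0 := by
  funext x
  rcases x with x | x <;> simp [diag]

theorem tendsto_diag {N : ℕ} : Tendsto (diag (N := N)) (𝓝 0) (𝓝 0) := by
  have h : Continuous (diag (N := N)) := by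
    refine continuous_pi fun x => ?_
    rcases x with x | x
    · exact continuous_apply x
    · exact Complex.continuous_conj.comp (continuous_apply x)
  have := h.tendsto 0
  rwa [diag_zero] at this

/-- A convergent element of the ideal of the manifold vanishes on the complexified manifold. -/
theorem Convergent.eventually_value_eq_zero {N d : ℕ} {ρ : Fin d → Ser N} (hρ : IsFormalGeneric ρ)
    (hρc : ∀ j, Convergent (ρ j)) {f : Ser N} (hf : Convergent f) (hfρ : f ∈ defIdeal ρ) :
    ∀ᶠ x in 𝓝 0, (∀ j, value (ρ j) x = 0) → value f x = 0 := by
  obtain ⟨κ, _, _, c, Θ, h⟩ := hρ.exists_isStraight hρc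
  let g : Fin N ⊕ (Fin d ⊕ κ) → MvPowerSeries (Fin N ⊕ κ) ℂ :=
    Sum.elim (fun x => X (Sum.inl x)) (Sum.elim 0 fun k => X (Sum.inr k))
  have hg : NoConst g := (noConst_X_comp _).sumElim (noConst_zero.sumElim (noConst_X_comp _))
  have hgc : ∀ i, Convergent (g i) := Convergent.sumElim (fun _ => convergent_X _)
    (Convergent.sumElim (fun _ => convergent_zero) fun _ => convergent_X _)
  -- `S` parametrizes the complexified manifold by (Z, ζ_c), and f∘S = 0. Near 0 each point with ρ =
  -- 0 is the value of `S` at its own coordinates.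
  let S : Fin N ⊕ Fin N → MvPowerSeries (Fin N ⊕ κ) ℂ :=
    Sum.elim (fun x => X (Sum.inl x)) fun i => MvPowerSeries.subst g (Θ i)
  have hS : NoConst S := (noConst_X_comp _).sumElim (h.noConst.subst hg)
  have hSc : ∀ i, Convergent (S i) := Convergent.sumElim (fun _ => convergent_X _)
    fun i => (h.convergent i).subst hg hgc
  have hSρ : ∀ j, MvPowerSeries.subst S (ρ j) = 0 := fun j =>
    h.subst_def (noConst_X_comp _) noConst_zero (noConst_X_comp _) j
  have hSf : MvPowerSeries.subst S f = 0 := subst_mem_zero_of_mem_defIdeal hS hSρ hfρ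
  let e : Fin N ⊕ κ → Fin N ⊕ Fin N := Sum.elim Sum.inl fun k => Sum.inr (c k)
  have hcc : ∀ q, Convergent (straightCoord ρ c q) := Convergent.sumElim (fun _ => convergent_X _)
    (Convergent.sumElim hρc fun _ => convergent_X _)
  have h1 : ∀ᶠ x in 𝓝 (0 : Fin N ⊕ Fin N → ℂ), ∀ i, value (MvPowerSeries.subst (straightCoord ρ c)
      (Θ i)) x = value (Θ i) fun q => value (straightCoord ρ c q) x :=
    eventually_all.2 fun i => (h.convergent i).eventually_value_subst h.noConst_coord hcc
  have h2 : ∀ᶠ y in 𝓝 (0 : Fin N ⊕ κ → ℂ), ∀ i, value (MvPowerSeries.subst g (Θ i)) y =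
      value (Θ i) fun q => value (g q) y :=
    eventually_all.2 fun i => (h.convergent i).eventually_value_subst hg hgc
  have h3 := hf.eventually_value_subst hS hSc
  filter_upwards [h1, (tendsto_comp_zero e).eventually h2, (tendsto_comp_zero e).eventually h3]
    with x hx1 hx2 hx3 hxρ
  rw [hSf, value_zero] at hx3
  rw [hx3]
  congr 1
  funext i
  rcases i with i | i
  · simp only [S, Sum.elim_inl, value_X]
    rfl
  · simp only [S, Sum.elim_inr]
    rw [hx2 i]
    have hx1i := hx1 i
    rw [h.subst_coord, value_X] at hx1i
    rw [hx1i]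
    congr 1
    funext q
    rcases q with q | q | q
    · simp only [straightCoord, g, Sum.elim_inl, value_X]
      rfl
    · simp only [straightCoord, g, Sum.elim_inl, Sum.elim_inr, hxρ, Pi.zero_apply, value_zero]
    · simp only [straightCoord, g, Sum.elim_inr, value_X]
      rfl

/-! ### Convergent formal maps at real points -/

section Maps

variable {N N' d d' : ℕ} {ρ : Fin d → Ser N} {ρ' : Fin d' → Ser N'}
  {H : Fin N' → MvPowerSeries (Fin N) ℂ}

theorem noConst_complexify (hH : NoConst H) : NoConst (complexify H) :=
  (hH.rename _).sumElim (hH.conj.rename _)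

theorem convergent_complexify (hHc : ∀ k, Convergent (H k)) (i : Fin N' ⊕ Fin N') :
    Convergent (complexify H i) :=
  Convergent.sumElim (fun k => (hHc k).rename _) (fun k => (hHc k).conj.rename _) i

/-- The complexification of `H` at a real point. -/
theorem eventually_value_complexify (hH : NoConst H) (hHc : ∀ k, Convergent (H k))
    {f : Ser N'} (hf : Convergent f) :
    ∀ᶠ z in 𝓝 0, value (subst (complexify H) f) (diag z) = value f (diag fun k => value (H k) z) := by
  have h1 := hf.eventually_value_subst (noConst_complexify hH) (convergent_complexify hHc)
  have h2 : ∀ᶠ x in 𝓝 (0 : Fin N ⊕ Fin N → ℂ), ∀ k, value (rename Sum.inl (H k)) x =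
      value (H k) fun i => x (Sum.inl i) :=
    eventually_all.2 fun k => (hHc k).eventually_value_rename _
  have h3 : ∀ᶠ x in 𝓝 (0 : Fin N ⊕ Fin N → ℂ), ∀ k, value (rename Sum.inr (conj (H k))) x =
      value (conj (H k)) fun i => x (Sum.inr i) :=
    eventually_all.2 fun k => (hHc k).conj.eventually_value_rename _
  filter_upwards [tendsto_diag.eventually h1, tendsto_diag.eventually h2,
    tendsto_diag.eventually h3] with z hz1 hz2 hz3
  rw [hz1]
  congr 1
  funext i
  rcases i with i | i
  · exact hz2 i
  · refine (hz3 i).trans ?_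
    simp only [diag, Sum.elim_inr]
    exact value_conj _ _

theorem tendsto_sub_self {n : ℕ} (p : Fin n → ℂ) : Tendsto (fun Z => Z - p) (𝓝 p) (𝓝 0) := by
  have h : Continuous fun Z : Fin n → ℂ => Z - p := by fun_prop
  have := h.tendsto p
  rwa [sub_self] at this

/-- A convergent formal map of `M` into `M'` maps points of `M` near `p` to points of `M'`. -/
theorem MapsInto.eventually_mem {M : Set (Fin N → ℂ)} {p : Fin N → ℂ} {M' : Set (Fin N' → ℂ)}
    {p' : Fin N' → ℂ} (hM : IsRealAnalyticGenericAt M p ρ) (hM' : IsRealAnalyticGenericAt M' p' ρ')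
    (hH : MapsInto ρ ρ' H) (hHc : ∀ k, Convergent (H k)) :
    ∀ᶠ Z in 𝓝 p, Z ∈ M → (fun k => p' k + value (H k) (Z - p)) ∈ M' := by
  have hH0 : NoConst H := hH.1
  have hF : Tendsto (fun Z k => p' k + value (H k) (Z - p)) (𝓝 p) (𝓝 p') := by
    have h1 := (tendsto_value_tuple hH0 hHc).comp (tendsto_sub_self p)
    have h2 := (tendsto_const_nhds (x := p')).add h1
    rw [add_zero] at h2
    exact h2
  have h1 : ∀ᶠ z in 𝓝 (0 : Fin N → ℂ), ∀ j, value (subst (complexify H) (ρ' j)) (diag z) =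
      value (ρ' j) (diag fun k => value (H k) z) :=
    eventually_all.2 fun j => eventually_value_complexify hH0 hHc (hM'.convergent j)
  have h2 : ∀ᶠ x in 𝓝 (0 : Fin N ⊕ Fin N → ℂ), ∀ j, (∀ k, value (ρ k) x = 0) →
      value (subst (complexify H) (ρ' j)) x = 0 :=
    eventually_all.2 fun j => Convergent.eventually_value_eq_zero hM.formalGeneric hM.convergent
      ((hM'.convergent j).subst (noConst_complexify hH0) (convergent_complexify hHc)) (hH.mem j)
  filter_upwards [hM.mem_iff, hF.eventually hM'.mem_iff, (tendsto_sub_self p).eventually h1,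
    (tendsto_diag.comp (tendsto_sub_self p)).eventually h2] with Z hZ1 hZ2 hZ3 hZ4 hZ
  rw [hZ2]
  intro j
  have h3 : (fun k => p' k + value (H k) (Z - p)) - p' = fun k => value (H k) (Z - p) := by
    funext k
    simp
  rw [h3, ← hZ3 j]
  exact hZ4 j (hZ1.1 hZ)

theorem analyticAt_value_sub (p : Fin N → ℂ) (p' : Fin N' → ℂ) (hHc : ∀ k, Convergent (H k)) :
    AnalyticAt ℂ (fun Z k => p' k + value (H k) (Z - p)) p := by
  rw [analyticAt_pi_iff]
  intro k
  have h1 : AnalyticAt ℂ (fun Z : Fin N → ℂ => Z - p) p := analyticAt_id.sub analyticAt_const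
  refine analyticAt_const.add (AnalyticAt.comp_of_eq (hHc k).analyticAt_value h1 (sub_self p))

end Maps

/-! ### Formal equivalences -/

section Maps

variable {N N' d d' : ℕ} {ρ : Fin d → Ser N} {ρ' : Fin d' → Ser N'}
  {H : Fin N' → MvPowerSeries (Fin N) ℂ} {K : Fin N → MvPowerSeries (Fin N') ℂ}

theorem subst_complexify_complexify (hH : NoConst H)
    (hHK : ∀ k, subst H (K k) = X k) (i : Fin N ⊕ Fin N) :
    subst (complexify H) (complexify K i) = X i := by
  have hH' := noConst_complexify hH
  rcases i with i | i
  · simp only [complexify, Sum.elim_inl]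
    change subst (complexify H) _ = _
    rw [subst_rename _ hH']
    have h1 := congrArg (rename (Sum.inl : Fin N → Fin N ⊕ Fin N)) (hHK i)
    rw [rename_subst hH, rename_X] at h1
    exact h1
  · simp only [complexify, Sum.elim_inr]
    change subst (complexify H) _ = _
    rw [subst_rename _ hH']
    have h1 := congrArg (fun f => rename (Sum.inr : Fin N → Fin N ⊕ Fin N) (conj f)) (hHK i)
    simp only [conj_subst hH, conj_X, rename_subst hH.conj, rename_X] at h1
    exact h1

theorem tangentMap_apply (H : Fin N' → MvPowerSeries (Fin N) ℂ) (v : Fin N ⊕ Fin N → ℂ)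
    (k : Fin N' ⊕ Fin N') :
    tangentMap H v k = ∑ i, constantCoeff (pderiv ℂ i (complexify H k)) * v i := rfl

theorem tangentMap_tangentMap (hH : NoConst H)
    (hHK : ∀ k, subst H (K k) = X k) (v : Fin N ⊕ Fin N → ℂ) :
    tangentMap K (tangentMap H v) = v := by
  classical
  have hH' := noConst_complexify hH
  funext k
  simp only [tangentMap_apply, Finset.mul_sum]
  rw [Finset.sum_comm]
  have h1 : ∀ i, ∑ j, constantCoeff (pderiv ℂ j (complexify K k)) *
      constantCoeff (pderiv ℂ i (complexify H j)) = if k = i then 1 else 0 := by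
    intro i
    have h2 := congrArg (fun f => constantCoeff (pderiv ℂ i f))
      (subst_complexify_complexify hH hHK k)
    simp only [pderiv_subst hH', map_sum, map_mul, constantCoeff_subst' hH'] at h2
    rw [h2]
    split_ifs with h
    · rw [h, pderiv_X_self, map_one]
    · rw [pderiv_X_of_ne h, map_zero]
  rw [Finset.sum_eq_single k]
  · simp only [← mul_assoc, ← Finset.sum_mul, h1]
    simp
  · intro i _ hi
    simp only [← mul_assoc, ← Finset.sum_mul, h1]
    rw [if_neg (Ne.symm hi), zero_mul]
  · simp

theorem pderiv_rename_of_ne [Fintype σ] {e : σ → τ} {i : τ} (h : ∀ x, e x ≠ i)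
    (f : MvPowerSeries σ ℂ) : pderiv ℂ i (rename e f) = 0 := by
  rw [rename_eq_subst', pderiv_subst (noConst_X_comp e)]
  exact Finset.sum_eq_zero fun x _ => by rw [pderiv_X_of_ne (h x), mul_zero]

theorem pderiv_complexify_inl_inr (k : Fin N') (i : Fin N) :
    pderiv ℂ (Sum.inr i) (complexify H (Sum.inl k)) = 0 :=
  pderiv_rename_of_ne (by simp) _

theorem pderiv_complexify_inr_inl (k : Fin N') (i : Fin N) :
    pderiv ℂ (Sum.inl i) (complexify H (Sum.inr k)) = 0 :=
  pderiv_rename_of_ne (by simp) _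

/-- Differentiate ρ'∘ℋ = cρ at 0; the derivative of c drops out because ρ(0) = 0. The two blocks
separate since ℋ acts on Z and ζ independently. -/
theorem MapsInto.tangentMap_mem (hH : MapsInto ρ ρ' H) (hρ : IsFormalGeneric ρ)
    (hρc : ∀ j, Convergent (ρ j)) (hρ' : IsFormalGeneric ρ') (hρ'c : ∀ j, Convergent (ρ' j))
    {v : Fin N ⊕ Fin N → ℂ} (hv : v ∈ crModuleAt ρ) : tangentMap H v ∈ crModuleAt ρ' := by
  obtain ⟨hH0, a, ha⟩ := hH
  have hH' := noConst_complexify hH0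
  rw [mem_crModuleAt_iff hρ hρc] at hv
  rw [mem_crModuleAt_iff hρ' hρ'c]
  have key : ∀ j i, ∑ k, constantCoeff (pderiv ℂ k (ρ' j)) *
      constantCoeff (pderiv ℂ i (complexify H k)) =
      ∑ k, constantCoeff (a j k) * constantCoeff (pderiv ℂ i (ρ k)) := by
    intro j i
    have h1 := congrArg (fun f => constantCoeff (pderiv ℂ i f)) (ha j)
    simp only [pderiv_subst hH', map_sum, map_mul, constantCoeff_subst' hH', Derivation.leibniz,
      smul_eq_mul, map_add, hρ.zero, zero_mul, add_zero] at h1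
    exact h1
  constructor
  · intro j
    simp only [tangentMap_apply, Fintype.sum_sum_type, pderiv_complexify_inl_inr, map_zero,
      zero_mul, Finset.sum_const_zero, add_zero, Finset.mul_sum]
    rw [Finset.sum_comm]
    have h2 : ∀ i, ∑ k, constantCoeff (pderiv ℂ (Sum.inl k) (ρ' j)) *
        constantCoeff (pderiv ℂ (Sum.inl i) (complexify H (Sum.inl k))) =
        ∑ k, constantCoeff (a j k) * constantCoeff (pderiv ℂ (Sum.inl i) (ρ k)) := by
      intro i
      rw [← key, Fintype.sum_sum_type]
      simp [pderiv_complexify_inr_inl]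
    simp only [← mul_assoc, ← Finset.sum_mul, h2]
    simp only [Finset.sum_mul, mul_assoc]
    rw [Finset.sum_comm]
    simp only [← Finset.mul_sum, hv.1, mul_zero, Finset.sum_const_zero]
  · intro j
    simp only [tangentMap_apply, Fintype.sum_sum_type, pderiv_complexify_inr_inl, map_zero,
      zero_mul, Finset.sum_const_zero, zero_add, Finset.mul_sum]
    rw [Finset.sum_comm]
    have h2 : ∀ i, ∑ k, constantCoeff (pderiv ℂ (Sum.inr k) (ρ' j)) *
        constantCoeff (pderiv ℂ (Sum.inr i) (complexify H (Sum.inr k))) =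
        ∑ k, constantCoeff (a j k) * constantCoeff (pderiv ℂ (Sum.inr i) (ρ k)) := by
      intro i
      rw [← key, Fintype.sum_sum_type]
      simp [pderiv_complexify_inl_inr]
    simp only [← mul_assoc, ← Finset.sum_mul, h2]
    simp only [Finset.sum_mul, mul_assoc]
    rw [Finset.sum_comm]
    simp only [← Finset.mul_sum, hv.2, mul_zero, Finset.sum_const_zero]

/-- Formal equivalences are CR submersive. -/
theorem MapsInto.crSubmersive (hH : MapsInto ρ ρ' H) (hK : MapsInto ρ' ρ K)
    (hρ : IsFormalGeneric ρ) (hρc : ∀ j, Convergent (ρ j)) (hρ' : IsFormalGeneric ρ')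
    (hρ'c : ∀ j, Convergent (ρ' j)) (hKH : ∀ k, subst K (H k) = X k) : CRSubmersive ρ ρ' H := by
  refine le_antisymm ?_ fun v hv => ?_
  · rintro _ ⟨v, hv, rfl⟩
    exact hH.tangentMap_mem hρ hρc hρ' hρ'c hv
  · exact ⟨tangentMap K v, hK.tangentMap_mem hρ' hρ'c hρ hρc hv,
      tangentMap_tangentMap hK.1 hKH v⟩

/-- The inverse of a convergent formal map is convergent. -/
theorem convergent_inverse (hH : NoConst H) (hK : NoConst K) (hHc : ∀ k, Convergent (H k))
    (hHK : ∀ k, subst H (K k) = X k) (hKH : ∀ k, subst K (H k) = X k) (k : Fin N) :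
    Convergent (K k) := by
  classical
  let H' : Fin N' → MvPowerSeries (Empty ⊕ Fin N) ℂ := fun j => rename Sum.inr (H j)
  have hH' : NoConst H' := hH.rename _
  have hd : ∀ j i, pderiv ℂ (Sum.inr i) (H' j) = rename Sum.inr (pderiv ℂ i (H j)) := fun j i =>
    pderiv_rename_equiv (Equiv.emptySum Empty (Fin N)).symm (H j) i
  have hgen : LinearIndependent ℂ fun (j : Fin N') (i : Fin N) =>
      constantCoeff (pderiv ℂ (Sum.inr i) (H' j)) := by
    rw [Fintype.linearIndependent_iff]
    intro g hg l
    have h1 : ∀ i, ∑ j, g j * constantCoeff (pderiv ℂ i (H j)) = 0 := by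
      intro i
      have h2 := congrFun hg i
      simp only [hd, constantCoeff_rename, Finset.sum_apply, Pi.smul_apply, smul_eq_mul,
        Pi.zero_apply] at h2
      exact h2
    have h2 : ∀ j, ∑ i, constantCoeff (pderiv ℂ i (H j)) * constantCoeff (pderiv ℂ l (K i)) =
        if j = l then 1 else 0 := by
      intro j
      have h3 := congrArg (fun f => constantCoeff (pderiv ℂ l f)) (hKH j)
      simp only [pderiv_subst hK, map_sum, map_mul, constantCoeff_subst' hK] at h3
      rw [h3]
      split_ifs with h
      · rw [h, pderiv_X_self, map_one]
      · rw [pderiv_X_of_ne h, map_zero]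
    have h3 : ∑ j, g j * ∑ i, constantCoeff (pderiv ℂ i (H j)) * constantCoeff (pderiv ℂ l (K i)) =
        0 := by
      simp only [Finset.mul_sum, ← mul_assoc]
      rw [Finset.sum_comm]
      simp only [← Finset.sum_mul, h1, zero_mul, Finset.sum_const_zero]
    simpa [h2] using h3
  obtain ⟨κ, _, _, c, Θ, hΘ, hΘc, hΘ1, -, -⟩ := exists_straighten hH' hgen
  have hΘc := hΘc fun j => (hHc j).rename _
  -- The complementary coordinates are set to zero, so equality of the dimensions is not needed. The
  -- result `L` is a convergent right inverse of H, and it coincides with K because K is a left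
  -- inverse.
  let s : Empty ⊕ (Fin N' ⊕ κ) → MvPowerSeries (Fin N') ℂ := Sum.elim 0 (Sum.elim X 0)
  have hs : NoConst s := noConst_zero.sumElim (noConst_X.sumElim noConst_zero)
  have hsc : ∀ i, Convergent (s i) := Convergent.sumElim (fun _ => convergent_zero)
    (Convergent.sumElim (fun _ => convergent_X _) fun _ => convergent_zero)
  let L : Fin N → MvPowerSeries (Fin N') ℂ := fun i => subst s (Θ i)
  have hL : NoConst L := hΘ.subst hs
  have hXΘ : NoConst (Sum.elim (fun x => X (Sum.inl x)) Θ :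
      Empty ⊕ Fin N → MvPowerSeries (Empty ⊕ (Fin N' ⊕ κ)) ℂ) := (noConst_X_comp _).sumElim hΘ
  have hHL : ∀ j, subst L (H j) = X j := by
    intro j
    have h1 := congrArg (subst s) (hΘ1 j)
    simp only [H'] at h1
    rw [subst_rename _ hXΘ, subst_X' hs] at h1
    simp only [Sum.elim_inr] at h1
    rw [subst_subst hΘ hs] at h1
    exact h1
  have hLK : L k = K k := by
    have h1 := congrArg (subst L) (hHK k)
    rw [subst_subst hH hL, subst_X' hL] at h1
    simp only [hHL] at h1
    rw [← h1]
    exact subst_X_self _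
  rw [← hLK]
  exact (hΘc k).subst hs hsc

theorem eventually_value_inverse (hH : NoConst H) (hHc : ∀ k, Convergent (H k))
    (hKc : ∀ k, Convergent (K k)) (hHK : ∀ k, subst H (K k) = X k) (p : Fin N → ℂ)
    (p' : Fin N' → ℂ) :
    ∀ᶠ Z in 𝓝 p, (fun k => p k + value (K k)
      ((fun k => p' k + value (H k) (Z - p)) - p')) = Z := by
  have h1 : ∀ᶠ z in 𝓝 (0 : Fin N → ℂ), ∀ k, value (subst H (K k)) z =
      value (K k) fun i => value (H i) z :=
    eventually_all.2 fun k => (hKc k).eventually_value_subst hH hHc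
  filter_upwards [(tendsto_sub_self p).eventually h1] with Z hZ
  funext k
  have h2 : (fun k => p' k + value (H k) (Z - p)) - p' = fun k => value (H k) (Z - p) := by
    funext k
    simp
  rw [h2, ← hZ k, hHK, value_X]
  simp

/-- A convergent formal equivalence gives a biholomorphic one. -/
theorem biholomorphicallyEquivalent_of_convergent {M : Set (Fin N → ℂ)} {p : Fin N → ℂ}
    {M' : Set (Fin N' → ℂ)} {p' : Fin N' → ℂ} (hM : IsRealAnalyticGenericAt M p ρ)
    (hM' : IsRealAnalyticGenericAt M' p' ρ') (hH : MapsInto ρ ρ' H) (hK : MapsInto ρ' ρ K)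
    (hHc : ∀ k, Convergent (H k)) (hHK : ∀ k, subst H (K k) = X k)
    (hKH : ∀ k, subst K (H k) = X k) : BiholomorphicallyEquivalent M p M' p' := by
  have hKc := convergent_inverse hH.1 hK.1 hHc hHK hKH
  refine ⟨fun Z k => p' k + value (H k) (Z - p), fun W k => p k + value (K k) (W - p'),
    analyticAt_value_sub p p' hHc, analyticAt_value_sub p' p hKc, ?_, ?_,
    eventually_value_inverse hH.1 hHc hKc hHK p p', eventually_value_inverse hK.1 hKc hHc hKH p' p,
    hH.eventually_mem hM hM' hHc, hK.eventually_mem hM' hM hKc⟩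
  · funext k
    beta_reduce
    rw [sub_self, value_zero_right, hH.1 k, add_zero]
  · funext k
    beta_reduce
    rw [sub_self, value_zero_right, hK.1 k, add_zero]

end Maps

/-! ### Real parametrizations -/

/-- A regular system of real convergent equations has a real convergent parametrization `γ` of its
solutions, and the series vanishing along `γ` lie in the ideal of the equations. -/
theorem exists_real_parametrization [Fintype ι] [DecidableEq ι] [Fintype δ] [DecidableEq δ]
    {r : δ → MvPowerSeries ι ℂ} (hr : NoConst r) (hrc : ∀ j, Convergent (r j))
    (hconj : ∀ j, conj (r j) = r j)
    (hgen : LinearIndependent ℂ fun (j : δ) (i : ι) => constantCoeff (pderiv ℂ i (r j))) :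
    ∃ (κ : Type) (_ : Fintype κ) (γ : ι → MvPowerSeries κ ℂ), NoConst γ ∧ (∀ i, Convergent (γ i)) ∧
      (∀ i, conj (γ i) = γ i) ∧ (∀ j, subst γ (r j) = 0) ∧
      ∀ f, subst γ f = 0 → f ∈ Ideal.span (Set.range r) := by
  let r' : δ → MvPowerSeries (Empty ⊕ ι) ℂ := fun j => rename Sum.inr (r j)
  have hr' : NoConst r' := hr.rename _
  have hgen' : LinearIndependent ℂ fun (j : δ) (i : ι) =>
      constantCoeff (pderiv ℂ (Sum.inr i) (r' j)) := by
    convert hgen using 3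
    rename_i j i
    have h1 := pderiv_rename_equiv (Equiv.emptySum Empty ι).symm (r j) i
    have h2 : pderiv ℂ (Sum.inr i) (r' j) = rename Sum.inr (pderiv ℂ i (r j)) := h1
    rw [h2, constantCoeff_rename]
  obtain ⟨κ, _, _, c, Θ, hΘ, hΘc, e1, e2, e3⟩ := exists_straighten hr' hgen'
  have hΘc := hΘc fun j => (hrc j).rename _
  -- The values of the equations are set to zero and the free coordinates serve as parameters.
  let s : Empty ⊕ (δ ⊕ κ) → MvPowerSeries κ ℂ := Sum.elim 0 (Sum.elim 0 X)
  have hs : NoConst s := noConst_zero.sumElim (noConst_zero.sumElim noConst_X)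
  have hsc : ∀ i, Convergent (s i) := Convergent.sumElim (fun _ => convergent_zero)
    (Convergent.sumElim (fun _ => convergent_zero) fun _ => convergent_X _)
  let γ : ι → MvPowerSeries κ ℂ := fun i => subst s (Θ i)
  have hγ : NoConst γ := hΘ.subst hs
  have hXΘ : NoConst (Sum.elim (fun x => X (Sum.inl x)) Θ :
      Empty ⊕ ι → MvPowerSeries (Empty ⊕ (δ ⊕ κ)) ℂ) := (noConst_X_comp _).sumElim hΘ
  have hγr : ∀ j, subst γ (r j) = 0 := by
    intro j
    have h1 := congrArg (subst s) (e1 j)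
    simp only [r'] at h1
    rw [subst_rename _ hXΘ, subst_X' hs] at h1
    simp only [Sum.elim_inr] at h1
    rw [subst_subst hΘ hs] at h1
    exact h1
  have hγc : ∀ k, γ (c k) = X k := by
    intro k
    simp only [γ]
    rw [e2, subst_X' hs]
    rfl
  have hco : NoConst (Sum.elim (fun x => X (Sum.inl x)) (Sum.elim r' fun k => X (Sum.inr (c k))) :
      Empty ⊕ (δ ⊕ κ) → MvPowerSeries (Empty ⊕ ι) ℂ) :=
    (noConst_X_comp _).sumElim (hr'.sumElim (noConst_X_comp _))
  -- points are determined by the values of `r` and the coordinates `c`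
  have hpt : ∀ {υ : Type} {g : ι → MvPowerSeries υ ℂ}, NoConst g → ∀ i,
      subst (Sum.elim 0 (Sum.elim (fun j => subst g (r j)) fun k => g (c k)) :
        Empty ⊕ (δ ⊕ κ) → MvPowerSeries υ ℂ) (Θ i) = g i := by
    intro υ g hg i
    have hg' : NoConst (Sum.elim 0 g : Empty ⊕ ι → MvPowerSeries υ ℂ) := noConst_zero.sumElim hg
    have h1 := congrArg (subst (Sum.elim 0 g : Empty ⊕ ι → MvPowerSeries υ ℂ)) (e3 i)
    rw [subst_subst hco hg', subst_X' hg'] at h1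
    simp only [Sum.elim_inr] at h1
    rw [← h1]
    congr 1
    funext x
    rcases x with x | x | x
    · exact x.elim
    · simp only [Sum.elim_inr, Sum.elim_inl, r']
      rw [subst_rename _ hg']
      rfl
    · simp only [Sum.elim_inr]
      rw [subst_X' hg']
      rfl
  refine ⟨κ, inferInstance, γ, hγ, fun i => (hΘc i).subst hs hsc, fun i => ?_, hγr, fun f hf => ?_⟩
  -- The conjugate of γ solves the same real equations with the same free coordinates, so it equals
  -- γ.
  · rw [← hpt hγ.conj i]
    have h1 : ∀ j, subst (fun i => conj (γ i)) (r j) = 0 := by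
      intro j
      rw [← hconj j, ← conj_subst hγ, hγr, conj_zero]
    simp only [h1, hγc, conj_X]
    rfl
  -- Modulo the equations every point lies on γ over its free coordinates. Hence f is congruent to
  -- f∘γ evaluated at these coordinates, which is zero.
  · have hX : ∀ i, X i - subst (fun k => X (c k)) (γ i) ∈ Ideal.span (Set.range r) := by
      intro i
      have hXc : NoConst (fun k => X (c k) : κ → MvPowerSeries ι ℂ) := noConst_X_comp _
      have h1 := hpt (noConst_X (σ := ι)) i
      simp only [γ]
      rw [← h1, subst_subst hs hXc]
      refine subst_sub_subst_mem _ _ ?_ (hs.subst hXc) ?_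
      · refine noConst_zero.sumElim (NoConst.sumElim (fun j => ?_) (noConst_X_comp _))
        rw [constantCoeff_subst' noConst_X, hr j]
      · rintro (x | x | x)
        · exact x.elim
        · simp only [s, Sum.elim_inr, Sum.elim_inl, Pi.zero_apply]
          rw [subst_zero' hXc, sub_zero, show subst (fun i => X i) (r x) = r x from subst_X_self _]
          exact Ideal.subset_span ⟨x, rfl⟩
        · simp only [s, Sum.elim_inr]
          rw [subst_X' hXc, sub_self]
          exact Ideal.zero_mem _
    have hXc : NoConst (fun k => X (c k) : κ → MvPowerSeries ι ℂ) := noConst_X_comp _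
    have h1 := subst_sub_subst_mem _ f noConst_X (hγ.subst hXc) hX
    rwa [subst_X_self, ← subst_subst hγ hXc, hf, subst_zero' hXc, sub_zero] at h1

/-! ### Real coordinates and the ideal of the manifold -/

/-- `(a, b) ↦ (a + ib, a - ib)` -/
def realCoord (N : ℕ) : Fin N ⊕ Fin N → Ser N :=
  Sum.elim (fun k => X (Sum.inl k) + C Complex.I * X (Sum.inr k))
    fun k => X (Sum.inl k) - C Complex.I * X (Sum.inr k)

/-- `(Z, ζ) ↦ ((Z + ζ) / 2, (Z - ζ) / 2i)` -/
def realCoordInv (N : ℕ) : Fin N ⊕ Fin N → Ser N :=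
  Sum.elim (fun k => C (1 / 2) * (X (Sum.inl k) + X (Sum.inr k)))
    fun k => C (-Complex.I / 2) * (X (Sum.inl k) - X (Sum.inr k))

theorem noConst_realCoord (N : ℕ) : NoConst (realCoord N) := by
  rintro (k | k) <;> simp [realCoord]

theorem noConst_realCoordInv (N : ℕ) : NoConst (realCoordInv N) := by
  rintro (k | k) <;> simp [realCoordInv]

theorem subst_realCoordInv_realCoord {N : ℕ} (i : Fin N ⊕ Fin N) :
    subst (realCoordInv N) (realCoord N i) = X i := by
  have h := noConst_realCoordInv N
  have h1 : (C Complex.I * C (-Complex.I / 2) : Ser N) = C (1 / 2) := by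
    rw [← map_mul]
    congr 1
    rw [mul_div_assoc', mul_neg, Complex.I_mul_I, neg_neg]
  have h2 : (C (1 / 2) + C (1 / 2) : Ser N) = 1 := by
    rw [← map_add, add_halves, map_one]
  rcases i with k | k
  · simp only [realCoord, Sum.elim_inl]
    rw [subst_add h.hasSubst, subst_mul h.hasSubst, subst_X' h, subst_X' h, subst_C]
    simp only [realCoordInv, Sum.elim_inl, Sum.elim_inr]
    linear_combination (X (Sum.inl k) - X (Sum.inr k)) * h1 + X (Sum.inl k) * h2
  · simp only [realCoord, Sum.elim_inr]
    rw [subst_sub h.hasSubst, subst_mul h.hasSubst, subst_X' h, subst_X' h, subst_C]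
    simp only [realCoordInv, Sum.elim_inl, Sum.elim_inr]
    linear_combination -(X (Sum.inl k) - X (Sum.inr k)) * h1 + X (Sum.inr k) * h2

theorem conj_realCoord {N : ℕ} (i : Fin N ⊕ Fin N) :
    conj (realCoord N i) = realCoord N (Sum.swap i) := by
  have hC : conj (C Complex.I : Ser N) = -C Complex.I := by
    rw [conj, map_C, Complex.conj_I, map_neg]
  rcases i with k | k
  · simp only [realCoord, Sum.elim_inl, Sum.swap_inl, Sum.elim_inr]
    rw [conj, map_add, map_mul, map_X, map_X]
    change _ + conj _ * _ = _
    rw [hC]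
    ring
  · simp only [realCoord, Sum.elim_inl, Sum.swap_inr, Sum.elim_inr]
    rw [conj, map_sub, map_mul, map_X, map_X]
    change _ - conj _ * _ = _
    rw [hC]
    ring

theorem IsFormalGeneric.conj_subst_realCoord {N d : ℕ} {ρ : Fin d → Ser N}
    (h : IsFormalGeneric ρ) (j : Fin d) :
    FormalCR.conj (subst (realCoord N) (ρ j)) = subst (realCoord N) (ρ j) := by
  have hL := noConst_realCoord N
  rw [conj_subst hL]
  simp only [conj_realCoord]
  exact subst_comp_swap_conj h hL j

theorem IsFormalGeneric.linearIndependent_realCoord {N d : ℕ} {ρ : Fin d → Ser N}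
    (h : IsFormalGeneric ρ) :
    LinearIndependent ℂ fun (j : Fin d) (i : Fin N ⊕ Fin N) =>
      constantCoeff (pderiv ℂ i (subst (realCoord N) (ρ j))) := by
  have hL := noConst_realCoord N
  have hL' := noConst_realCoordInv N
  rw [Fintype.linearIndependent_iff]
  intro g hg
  refine Fintype.linearIndependent_iff.1 h.generic g ?_
  have h1 : ∀ i, ∑ j, g j * constantCoeff (pderiv ℂ i (subst (realCoord N) (ρ j))) = 0 := by
    intro i
    have := congrFun hg i
    simpa only [Finset.sum_apply, Pi.smul_apply, smul_eq_mul, Pi.zero_apply] using this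
  have h2 : ∀ j, ρ j = subst (realCoordInv N) (subst (realCoord N) (ρ j)) := by
    intro j
    rw [subst_subst hL hL']
    simp only [subst_realCoordInv_realCoord]
    exact (subst_X_self _).symm
  funext k
  simp only [Finset.sum_apply, Pi.smul_apply, smul_eq_mul, Pi.zero_apply]
  have h3 : ∀ j, constantCoeff (pderiv ℂ (Sum.inl k) (ρ j)) =
      ∑ i, constantCoeff (pderiv ℂ i (subst (realCoord N) (ρ j))) *
        constantCoeff (pderiv ℂ (Sum.inl k) (realCoordInv N i)) := by
    intro j
    conv_lhs => rw [h2 j]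
    rw [pderiv_subst hL', map_sum]
    exact Finset.sum_congr rfl fun i _ => by rw [map_mul, constantCoeff_subst' hL']
  simp only [h3, Finset.mul_sum, ← mul_assoc]
  rw [Finset.sum_comm]
  simp only [← Finset.sum_mul, h1, zero_mul, Finset.sum_const_zero]

/-- A convergent series that vanishes on the manifold lies in its ideal. -/
theorem Convergent.mem_defIdeal {N d : ℕ} {ρ : Fin d → Ser N} (hρ : IsFormalGeneric ρ)
    (hρc : ∀ j, Convergent (ρ j)) {f : Ser N} (hf : Convergent f)
    (h : ∀ᶠ z in 𝓝 0, (∀ j, value (ρ j) (diag z) = 0) → value f (diag z) = 0) :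
    f ∈ defIdeal ρ := by
  have hL := noConst_realCoord N
  have hL' := noConst_realCoordInv N
  have hLc : ∀ i, Convergent (realCoord N i) := by
    refine Convergent.sumElim (fun k => ?_) fun k => ?_
    · exact (convergent_X _).add ((convergent_C _).mul (convergent_X _))
    · exact (convergent_X _).sub ((convergent_C _).mul (convergent_X _))
  have hr : NoConst (fun j => MvPowerSeries.subst (realCoord N) (ρ j)) := fun j => by
    rw [constantCoeff_subst' hL, hρ.zero]
  have hrc : ∀ j, Convergent (MvPowerSeries.subst (realCoord N) (ρ j)) := fun j =>
    (hρc j).subst hL hLc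
  obtain ⟨κ, _, γ, hγ, hγc, hγr, hγ0, hγf⟩ := exists_real_parametrization hr hrc
    hρ.conj_subst_realCoord hρ.linearIndependent_realCoord
  let S : Fin N ⊕ Fin N → MvPowerSeries κ ℂ := fun i => MvPowerSeries.subst γ (realCoord N i)
  have hS : NoConst S := hL.subst hγ
  have hSc : ∀ i, Convergent (S i) := fun i => (hLc i).subst hγ hγc
  have hSρ : ∀ j, MvPowerSeries.subst S (ρ j) = 0 := by
    intro j
    rw [← subst_subst hL hγ, hγ0]
  have hSconj : ∀ i, FormalCR.conj (S i) = S (Sum.swap i) := by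
    intro i
    simp only [S]
    rw [conj_subst hγ, conj_realCoord]
    simp only [hγr]
  have hofReal : Tendsto (fun (t : κ → ℝ) (i : κ) => (t i : ℂ)) (𝓝 0) (𝓝 0) := by
    have hc : Continuous fun (t : κ → ℝ) (i : κ) => (t i : ℂ) := by fun_prop
    have := hc.tendsto 0
    simp only [Pi.zero_apply, Complex.ofReal_zero] at this
    exact this
  -- At real parameters the parametrization lands on ζ = Z̄, that is, on actual points of M, where
  -- the hypothesis on `f` can be used.
  have hdiag : ∀ t : κ → ℝ, (fun i => value (S i) fun i => (t i : ℂ)) =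
      diag fun k => value (S (Sum.inl k)) fun i => (t i : ℂ) := by
    intro t
    funext i
    rcases i with i | i
    · rfl
    · simp only [diag, Sum.elim_inr]
      rw [← value_conj, hSconj]
      simp only [Complex.conj_ofReal]
      rfl
  have h1 : ∀ᶠ x in 𝓝 (0 : κ → ℂ), ∀ j, value (MvPowerSeries.subst S (ρ j)) x =
      value (ρ j) fun i => value (S i) x :=
    eventually_all.2 fun j => (hρc j).eventually_value_subst hS hSc
  have h2 := hf.eventually_value_subst hS hSc
  have h3 : Tendsto (fun (x : κ → ℂ) k => value (S (Sum.inl k)) x) (𝓝 0) (𝓝 0) :=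
    tendsto_value_tuple (hS.comp Sum.inl) fun k => hSc _
  have hSf : MvPowerSeries.subst S f = 0 := by
    refine (hf.subst hS hSc).eq_zero_of_real ?_
    filter_upwards [hofReal.eventually h1, hofReal.eventually h2,
      hofReal.eventually (h3.eventually h)] with t ht1 ht2 ht3
    rw [ht2, hdiag]
    refine ht3 fun j => ?_
    rw [← hdiag, ← ht1, hSρ, value_zero]
  have hmem := hγf (MvPowerSeries.subst (realCoord N) f) (by rw [subst_subst hL hγ]; exact hSf)
  -- The membership holds in real coordinates; the inverse linear change carries it back to (Z, ζ).
  obtain ⟨a, ha⟩ := (Ideal.mem_span_range_iff_exists_fun).1 hmem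
  have h4 := congrArg (MvPowerSeries.subst (realCoordInv N)) ha
  have h5 : ∀ g : Ser N, MvPowerSeries.subst (realCoordInv N)
      (MvPowerSeries.subst (realCoord N) g) = g := by
    intro g
    rw [subst_subst hL hL']
    simp only [subst_realCoordInv_realCoord]
    exact subst_X_self _
  rw [h5, subst_sum' hL'] at h4
  rw [← h4]
  refine Ideal.sum_mem _ fun j _ => ?_
  rw [subst_mul hL'.hasSubst, h5]
  exact Ideal.mul_mem_left _ _ (Ideal.subset_span ⟨j, rfl⟩)

/-! ### Biholomorphic equivalences are formal equivalences -/

section Maps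

variable {N N' d d' : ℕ} {ρ : Fin d → Ser N} {ρ' : Fin d' → Ser N'}

/-- The Taylor series of a holomorphic map, centred at the origin. -/
theorem exists_formal_of_analyticAt {F : (Fin N → ℂ) → (Fin N' → ℂ)} {p : Fin N → ℂ}
    {p' : Fin N' → ℂ} (hF : AnalyticAt ℂ F p) (hp : F p = p') :
    ∃ H : Fin N' → MvPowerSeries (Fin N) ℂ, NoConst H ∧ (∀ k, Convergent (H k)) ∧
      ∀ᶠ z in 𝓝 0, (fun k => value (H k) z) = F (p + z) - p' := by
  have h1 : ∀ k, AnalyticAt ℂ (fun Z => F Z k - p' k) p := fun k =>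
    (analyticAt_pi_iff.1 hF k).sub analyticAt_const
  choose H hHc hHv using fun k => exists_convergent_of_analyticAt (h1 k)
  refine ⟨H, fun k => ?_, hHc, ?_⟩
  · have h2 := (hHv k).self_of_nhds
    rw [add_zero, hp, sub_self] at h2
    rw [← value_zero_right]
    exact h2.tsum_eq
  · filter_upwards [eventually_all.2 hHv] with z hz
    funext k
    exact (hz k).tsum_eq

theorem tendsto_add_self {n : ℕ} (p : Fin n → ℂ) : Tendsto (fun z => p + z) (𝓝 0) (𝓝 p) := by
  have h : Continuous fun z : Fin n → ℂ => p + z := by fun_prop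
  have := h.tendsto 0
  rwa [add_zero] at this

theorem subst_eq_X_of_eventually {H : Fin N' → MvPowerSeries (Fin N) ℂ}
    {K : Fin N → MvPowerSeries (Fin N') ℂ} (hH : NoConst H) (hHc : ∀ k, Convergent (H k))
    (hKc : ∀ k, Convergent (K k))
    (h : ∀ᶠ z in 𝓝 0, (fun i => value (K i) fun k => value (H k) z) = z) (i : Fin N) :
    MvPowerSeries.subst H (K i) = MvPowerSeries.X i := by
  have hc := (hKc i).subst hH hHc
  have hX : Convergent (-X i : MvPowerSeries (Fin N) ℂ) := (convergent_X i).neg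
  rw [← sub_eq_zero, sub_eq_add_neg]
  refine (hc.add hX).eq_zero_of_value ?_
  filter_upwards [h, (hKc i).eventually_value_subst hH hHc, hc.eventually_value_add hX]
    with z hz1 hz2 hz3
  rw [hz3, hz2, value_neg, value_X, congrFun hz1 i, add_neg_cancel]

/-- Preservation of points means that ρ'∘ℋ vanishes at the points of M near `p`;
`Convergent.mem_defIdeal` upgrades this to the formal identity. -/
theorem mapsInto_of_eventually {M : Set (Fin N → ℂ)} {p : Fin N → ℂ} {M' : Set (Fin N' → ℂ)}
    {p' : Fin N' → ℂ} (hM : IsRealAnalyticGenericAt M p ρ) (hM' : IsRealAnalyticGenericAt M' p' ρ')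
    {F : (Fin N → ℂ) → (Fin N' → ℂ)} (hF : ContinuousAt F p) (hp : F p = p')
    (hFM : ∀ᶠ Z in 𝓝 p, Z ∈ M → F Z ∈ M') {H : Fin N' → MvPowerSeries (Fin N) ℂ}
    (hH : NoConst H) (hHc : ∀ k, Convergent (H k))
    (hHF : ∀ᶠ z in 𝓝 0, (fun k => value (H k) z) = F (p + z) - p') : MapsInto ρ ρ' H := by
  have hF' : Tendsto F (𝓝 p) (𝓝 p') := by
    have := hF.tendsto
    rwa [hp] at this
  have h1 : ∀ j, MvPowerSeries.subst (complexify H) (ρ' j) ∈ defIdeal ρ := by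
    intro j
    refine Convergent.mem_defIdeal hM.formalGeneric hM.convergent
      ((hM'.convergent j).subst (noConst_complexify hH) (convergent_complexify hHc)) ?_
    filter_upwards [hHF, eventually_value_complexify hH hHc (hM'.convergent j),
      (tendsto_add_self p).eventually hFM, (tendsto_add_self p).eventually hM.mem_iff,
      (hF'.comp (tendsto_add_self p)).eventually hM'.mem_iff] with z hz1 hz2 hz3 hz4 hz5 hz
    rw [add_sub_cancel_left] at hz4
    rw [hz2, hz1]
    exact hz5.1 (hz3 (hz4.2 hz)) j
  choose c hc using fun j => Ideal.mem_span_range_iff_exists_fun.1 (h1 j)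
  exact ⟨hH, c, fun j => (hc j).symm⟩

theorem BiholomorphicallyEquivalent.formallyEquivalent {M : Set (Fin N → ℂ)} {p : Fin N → ℂ}
    {M' : Set (Fin N' → ℂ)} {p' : Fin N' → ℂ} (hM : IsRealAnalyticGenericAt M p ρ)
    (hM' : IsRealAnalyticGenericAt M' p' ρ') (h : BiholomorphicallyEquivalent M p M' p') :
    FormallyEquivalent ρ ρ' := by
  obtain ⟨F, G, hF, hG, hFp, hGp, hGF, hFG, hFM, hGM⟩ := h
  obtain ⟨H, hH, hHc, hHF⟩ := exists_formal_of_analyticAt hF hFp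
  obtain ⟨K, hK, hKc, hKG⟩ := exists_formal_of_analyticAt hG hGp
  refine ⟨H, K, mapsInto_of_eventually hM hM' hF.continuousAt hFp hFM hH hHc hHF,
    mapsInto_of_eventually hM' hM hG.continuousAt hGp hGM hK hKc hKG,
    subst_eq_X_of_eventually hH hHc hKc ?_, subst_eq_X_of_eventually hK hKc hHc ?_⟩
  · filter_upwards [hHF, (tendsto_value_tuple hH hHc).eventually hKG,
      (tendsto_add_self p).eventually hGF] with z hz1 hz2 hz3
    rw [hz2, hz1, add_sub_cancel, hz3, add_sub_cancel_left]
  · filter_upwards [hKG, (tendsto_value_tuple hK hKc).eventually hHF,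
      (tendsto_add_self p').eventually hFG] with z hz1 hz2 hz3
    rw [hz2, hz1, add_sub_cancel, hz3, add_sub_cancel_left]

/-- A convergent formal map is the Taylor series of its sum. -/
theorem isTaylorSeriesAt_value_sub {p : Fin N → ℂ} {p' : Fin N' → ℂ}
    {H : Fin N' → MvPowerSeries (Fin N) ℂ} (hHc : ∀ k, Convergent (recentre p' H k)) :
    IsTaylorSeriesAt p H fun Z k => p' k + value (recentre p' H k) (Z - p) := by
  refine eventually_all.2 fun k => ?_
  have hC : Convergent (C (p' k) : MvPowerSeries (Fin N) ℂ) := convergent_C _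
  have h1 : C (p' k) + recentre p' H k = H k := add_sub_cancel _ _
  have hc : Convergent (H k) := by
    rw [← h1]
    exact hC.add (hHc k)
  filter_upwards [(tendsto_sub_self p).eventually hc.eventually_ne_top,
    (tendsto_sub_self p).eventually (hC.eventually_value_add (hHc k))] with Z hZ1 hZ2
  rw [h1, value_C] at hZ2
  rw [← hZ2]
  exact hasSum_value hZ1

end Maps

end FormalCR

end

theorem theorem3 {N N' d d' : ℕ}
    (M : Set (Fin N → ℂ)) (p₀ : Fin N → ℂ) (ρ : Fin d → FormalCR.Ser N)
    (M' : Set (Fin N' → ℂ)) (p₀' : Fin N' → ℂ) (ρ' : Fin d' → FormalCR.Ser N')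
    (hM : FormalCR.IsRealAnalyticGenericAt M p₀ ρ)
    (hM' : FormalCR.IsRealAnalyticGenericAt M' p₀' ρ')
    (hfin : FormalCR.FiniteType ρ)
    (hnondeg : FormalCR.FinitelyNondegenerate ρ') :
    (∀ Hhat : Fin N' → MvPowerSeries (Fin N) ℂ,
      FormalCR.IsFormalCRSubmersiveMap ρ p₀' ρ' Hhat →
        ∃ H : (Fin N → ℂ) → (Fin N' → ℂ),
          AnalyticAt ℂ H p₀ ∧ H p₀ = p₀' ∧
          FormalCR.IsTaylorSeriesAt p₀ Hhat H ∧
          ∀ᶠ Z in 𝓝 p₀, Z ∈ M → H Z ∈ M') ∧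
    (FormalCR.FormallyEquivalent ρ ρ' ↔
      FormalCR.BiholomorphicallyEquivalent M p₀ M' p₀') := by
  refine ⟨fun Hhat hH => ?_, ?_, fun h => h.formallyEquivalent hM hM'⟩
  · have hc := FormalCR.convergent_of_crSubmersive hM.formalGeneric hM.convergent
      hM'.formalGeneric hM'.convergent hfin hnondeg hH.mapsInto hH.submersive
    refine ⟨_, FormalCR.analyticAt_value_sub p₀ p₀' hc, ?_,
      FormalCR.isTaylorSeriesAt_value_sub hc, hH.mapsInto.eventually_mem hM hM' hc⟩
    funext k
    rw [sub_self, FormalCR.value_zero_right, hH.mapsInto.1 k, add_zero]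
  · rintro ⟨H, K, hH, hK, hHK, hKH⟩
    have hsub := hH.crSubmersive hK hM.formalGeneric hM.convergent hM'.formalGeneric
      hM'.convergent hKH
    exact FormalCR.biholomorphicallyEquivalent_of_convergent hM hM' hH hK
      (FormalCR.convergent_of_crSubmersive hM.formalGeneric hM.convergent hM'.formalGeneric
        hM'.convergent hfin hnondeg hH hsub) hHK hKH
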